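/- Let $n\ge 2$, let $0<q<n$, and let $B_1$ be the open unit ball of $\mathbb{R}^n$ centred at $0$. For $x\in\mathbb{R}^n$ write $x'=(x_1,\dots,x_{n-1})$. There exists a convex function $v\ge 0$ on $B_1$ that solves $$\det D^2 v = v^q\chi_{\{v>0\}}\quad\text{in } B_1$$ in the Aleksandrov sense (the Lebesgue measure of the image of every Borel set $A\subseteq B_1$ under the subdifferential of $v$ equals $\int_A v^q\chi_{\{v>0\}}\,dx$) and has the following properties. Let $K=\{x\in B_1: v(x)=0\}$ be its coincidence set, $\Gamma=B_1\cap\partial K$ its free boundary, and $\Gamma_{nsc}$ the set of all points of $\Gamma$ that are not exposed points of $K$. Then: 1. $K=\{|x'|\le 1/2\}\cap B_1$. 2. $\Gamma_{nsc}=\{|x'|=1/2\}\cap B_1$, a cylindrical hypersurface, of Hausdorff dimension $n-1$. 3. $v$ is merely Lipschitz continuous: it is Lipschitz on $B_1$, but is not differentiable at any point of $\Gamma_{nsc}$. 4. $v$ is not in $W^{2,1}$ near $K$: for every open set $U\subseteq B_1$ with $U\cap\Gamma_{nsc}\neq\emptyset$, in particular for every open $U$ with $K\subseteq U\subseteq B_1$,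 one has $v\notin W^{2,1}(U)$. -/

import Mathlib

open MeasureTheory Set
open scoped NNReal ENNReal ContDiff

noncomputable section

/-- The Euclidean norm `|x'|` of the first `n - 1` coordinates `x' = (x₁, …, x_{n-1})` of
`x ∈ ℝⁿ`. -/
def primeNorm {n : ℕ} (x : EuclideanSpace ℝ (Fin n)) : ℝ :=
  Real.sqrt (∑ i ∈ Finset.univ.filter (fun i : Fin n => (i : ℕ) + 1 < n), x i ^ 2)

/-- The subdifferential at `x` of a function `v` on `Ω`: all slopes `p` of affine functions that
support the graph of `v` over `Ω` from below at `x`. -/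
def subdifferential {n : ℕ} (Ω : Set (EuclideanSpace ℝ (Fin n)))
    (v : EuclideanSpace ℝ (Fin n) → ℝ) (x : EuclideanSpace ℝ (Fin n)) :
    Set (EuclideanSpace ℝ (Fin n)) :=
  {p | ∀ y ∈ Ω, v x + inner ℝ p (y - x) ≤ v y}

/-- The Monge–Ampère measure of `v` on `Ω`, evaluated at `A ⊆ Ω`: the Lebesgue measure of the
image of `A` under the subdifferential. -/
def mongeAmpere {n : ℕ} (Ω : Set (EuclideanSpace ℝ (Fin n)))
    (v : EuclideanSpace ℝ (Fin n) → ℝ) (A : Set (EuclideanSpace ℝ (Fin n))) : ℝ≥0∞ :=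
  volume (⋃ x ∈ A, subdifferential Ω v x)

/-- `v` is an Aleksandrov solution of the obstacle problem
`det D²v = v^q χ_{v > 0}` in `Ω`, `v ≥ 0` convex. -/
structure IsObstacleSolution {n : ℕ} (q : ℝ) (Ω : Set (EuclideanSpace ℝ (Fin n)))
    (v : EuclideanSpace ℝ (Fin n) → ℝ) : Prop where
  convexOn : ConvexOn ℝ Ω v
  nonneg : ∀ x ∈ Ω, 0 ≤ v x
  mongeAmpere_eq : ∀ A : Set (EuclideanSpace ℝ (Fin n)), MeasurableSet A → A ⊆ Ω →
    mongeAmpere Ω v A = ∫⁻ x in A, ENNReal.ofReal ({y | 0 < v y}.indicator (fun y => v y ^ q) x)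

/-- The coincidence set `K = {x ∈ Ω : v(x) = 0}`. -/
def coincidenceSet {n : ℕ} (Ω : Set (EuclideanSpace ℝ (Fin n)))
    (v : EuclideanSpace ℝ (Fin n) → ℝ) : Set (EuclideanSpace ℝ (Fin n)) :=
  {x | x ∈ Ω ∧ v x = 0}

/-- The free boundary `Γ = Ω ∩ ∂K`. -/
def freeBoundary {n : ℕ} (Ω : Set (EuclideanSpace ℝ (Fin n)))
    (v : EuclideanSpace ℝ (Fin n) → ℝ) : Set (EuclideanSpace ℝ (Fin n)) :=
  Ω ∩ frontier (coincidenceSet Ω v)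

/-- The strictly convex part `Γ_sc` of the free boundary: the exposed points of `K`. -/
def strictlyConvexPart {n : ℕ} (Ω : Set (EuclideanSpace ℝ (Fin n)))
    (v : EuclideanSpace ℝ (Fin n) → ℝ) : Set (EuclideanSpace ℝ (Fin n)) :=
  {x | x ∈ Ω ∧ x ∈ (coincidenceSet Ω v).exposedPoints ℝ}

/-- The non-strictly convex part `Γ_nsc = Γ \ Γ_sc` of the free boundary. -/
def nonStrictlyConvexPart {n : ℕ} (Ω : Set (EuclideanSpace ℝ (Fin n)))
    (v : EuclideanSpace ℝ (Fin n) → ℝ) : Set (EuclideanSpace ℝ (Fin n)) :=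
  freeBoundary Ω v \ strictlyConvexPart Ω v

/-- `g` is the weak (distributional) partial derivative `∂ᵢ v` on the open set `U`
(used for `v` and `g` integrable on `U`). -/
def IsWeakPartial {n : ℕ} (U : Set (EuclideanSpace ℝ (Fin n))) (i : Fin n)
    (v g : EuclideanSpace ℝ (Fin n) → ℝ) : Prop :=
  ∀ φ : EuclideanSpace ℝ (Fin n) → ℝ, ContDiff ℝ ∞ φ → HasCompactSupport φ → tsupport φ ⊆ U →
    ∫ x in U, v x * fderiv ℝ φ x (EuclideanSpace.single i 1) = - ∫ x in U, g x * φ x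

/-- Membership in the Sobolev space `W^{2,1}(U)`: `v` and its weak partial derivatives of first
and second order are integrable on `U`. -/
def MemW21 {n : ℕ} (U : Set (EuclideanSpace ℝ (Fin n)))
    (v : EuclideanSpace ℝ (Fin n) → ℝ) : Prop :=
  IntegrableOn v U ∧
    ∃ (g : Fin n → EuclideanSpace ℝ (Fin n) → ℝ)
      (h : Fin n → Fin n → EuclideanSpace ℝ (Fin n) → ℝ),
      (∀ i, IntegrableOn (g i) U ∧ IsWeakPartial U i v (g i)) ∧
      ∀ i j, IntegrableOn (h i j) U ∧ IsWeakPartial U j (g i) (h i j)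

end

/-! The solution is sought as a function of `r = |x'|` and `t = x_n`, described by the radius `ρ(u,
t)` of its sublevel set `{v ≤ u}` (a partial hodograph transform). The equation becomes `ρ_uu ρ_tt -
ρ_ut² = ε u^q ρ_u^(n+2) ρ^(n-2)`, and the free boundary becomes the fixed line `u = 0`, on which `ρ
= 1/2` and `ρ_u = 1`. Any `ε > 0` is admissible: replacing `v` by `c v` multiplies the determinant
by `c^n` and `v^q` by `c^q`, and `q < n`.

The ansatz is `ρ = 1/2 + u - k u^β Z` with `β = 1 + q/2`, the exponent for which both sides carry
the same factor `u^q`. With `θ = u ∂_u`, `Z = 1 + s ∂_t⁻² f` and `ε = k² s`, the equation is a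
Cauchy problem in `t`, written as a fixed-point equation for `f` in which every `θ` is paired with a
`∂_t⁻¹`. It is solved in power series in `t`, `u`, `y = u^(q/2)` by a Cauchy–Kovalevskaya argument:
in a suitable weighted `ℓ¹` algebra the operators `(θ + c) ∂_t⁻¹` are bounded (`wnorm_tInt_le`). A
small `s` makes the nonlinear terms preserve a ball, so the solution exists for all `|t| < 1`, `0 <
u < 1` (`exists_hodographMap_eq`, `exists_isHodographProfile`).

The positive determinant and `ρ_uu < 0` make `ρ` concave, which is convexity of `v`. The bounds `ρ_u
≥ 1/2`, `|ρ_t| ≤ 1` make `v` Lipschitz, and `1/2 + u/2 ≤ ρ ≤ 1/2 + u` identifies the zero set and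
gives `v ≥ c (r - 1/2)`, a corner along the cylinder. Outside the cylinder the gradient is injective
with Jacobian `v^q`, so the area formula gives the Monge–Ampère measure; over the closed cylinder
all subgradients are orthogonal to the axis and fill only a null set (`mongeAmpere_eq`).

The corner puts surface mass on the cylinder into a second derivative `∂_ii v`. Tested against
cutoffs of shrinking neighbourhoods of the cylinder, this mass stays bounded below, whereas for an
`L¹` function it would tend to zero (`not_memW21`). -/

noncomputable section

/-- Real formal power series in the three variables `t = X 0`, `u = X 1`, `y = X 2`. -/
abbrev TriSeries := MvPowerSeries (Fin 3) ℝ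

/-! ### A weighted `ℓ¹` algebra of power series. -/

namespace TriSeries

open MvPowerSeries Finset

/-- Total degree of an exponent. -/
def mdeg (a : Fin 3 →₀ ℕ) : ℕ := a 0 + a 1 + a 2

/-- The weight `2 ^ |a| / (|a| choose a₀)` of an exponent. -/
def wt (a : Fin 3 →₀ ℕ) : ℝ≥0 := 2 ^ mdeg a / (mdeg a).choose (a 0)

lemma mdeg_add (a b : Fin 3 →₀ ℕ) : mdeg (a + b) = mdeg a + mdeg b := by
  simp [mdeg]; ring

lemma choose_mdeg_pos (a : Fin 3 →₀ ℕ) : 0 < (mdeg a).choose (a 0) :=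
  Nat.choose_pos (by unfold mdeg; omega)

/-- By Vandermonde, the product of the two binomial coefficients is one term of the sum for the
binomial coefficient of `a + b`. This makes `wnorm` submultiplicative. -/
lemma wt_add_le (a b : Fin 3 →₀ ℕ) : wt (a + b) ≤ wt a * wt b := by
  unfold wt
  rw [div_mul_div_comm, ← pow_add, mdeg_add]
  have h : (mdeg a).choose (a 0) * (mdeg b).choose (b 0)
      ≤ (mdeg a + mdeg b).choose ((a + b) 0) := by
    rw [Nat.add_choose_eq]
    exact Finset.single_le_sum (f := fun ij : ℕ × ℕ => (mdeg a).choose ij.1 * (mdeg b).choose ij.2)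
      (fun _ _ => Nat.zero_le _) (a := (a 0, b 0)) (by simp)
  have h1 : (0 : ℝ≥0) < ((mdeg a).choose (a 0) * (mdeg b).choose (b 0) : ℕ) := by
    exact_mod_cast Nat.mul_pos (choose_mdeg_pos a) (choose_mdeg_pos b)
  push_cast at h1
  gcongr
  exact_mod_cast h

lemma one_le_wt (a : Fin 3 →₀ ℕ) : 1 ≤ wt a := by
  unfold wt
  have h1 : (0 : ℝ≥0) < ((mdeg a).choose (a 0) : ℕ) := by exact_mod_cast choose_mdeg_pos a
  rw [one_le_div h1]
  exact_mod_cast Nat.choose_le_two_pow _ _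

/-- The weight is designed for this identity: raising the `t`-exponent converts the factor `1 / (a₀
+ 1)` gained by integration in `t` into `1 / (|a| + 1)`, which pays for one application of `θ`. -/
lemma wt_add_single (a : Fin 3 →₀ ℕ) :
    wt (a + Finsupp.single 0 1) * (mdeg a + 1) = 2 * wt a * (a 0 + 1) := by
  have hm : mdeg (a + Finsupp.single 0 1) = mdeg a + 1 := by simp [mdeg]; ring
  have h0 : (a + Finsupp.single 0 1 : Fin 3 →₀ ℕ) 0 = a 0 + 1 := by simp
  unfold wt
  rw [hm, h0]
  have h := Nat.add_one_mul_choose_eq (mdeg a) (a 0)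
  have h1 : (0 : ℝ≥0) < ((mdeg a).choose (a 0) : ℕ) := by exact_mod_cast choose_mdeg_pos a
  have h2 : (0 : ℝ≥0) < ((mdeg a + 1).choose (a 0 + 1) : ℕ) := by
    exact_mod_cast Nat.choose_pos (by unfold mdeg; omega)
  have h' : ((mdeg a : ℝ≥0) + 1) * (mdeg a).choose (a 0)
    = (mdeg a + 1).choose (a 0 + 1) * ((a 0 : ℝ≥0) + 1) := by exact_mod_cast h
  rw [div_mul_eq_mul_div, div_eq_iff h2.ne', pow_succ]
  have : 2 * (2 ^ mdeg a / ((mdeg a).choose (a 0) : ℝ≥0)) * ((a 0 : ℝ≥0) + 1)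
        * ((mdeg a + 1).choose (a 0 + 1) : ℕ)
      = 2 * 2 ^ mdeg a * ((mdeg a + 1).choose (a 0 + 1) * ((a 0 : ℝ≥0) + 1))
        / (mdeg a).choose (a 0) := by ring
  rw [this, ← h', eq_div_iff h1.ne']
  ring

/-- The weighted `ℓ¹` norm. -/
def wnorm (f : TriSeries) : ℝ≥0∞ := ∑' a, ‖coeff a f‖ₑ * wt a

lemma wnorm_add_le (f g : TriSeries) : wnorm (f + g) ≤ wnorm f + wnorm g := by
  unfold wnorm
  rw [← ENNReal.tsum_add]
  refine ENNReal.tsum_le_tsum fun a => ?_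
  rw [← add_mul, map_add]
  gcongr
  exact enorm_add_le _ _

lemma wnorm_neg (f : TriSeries) : wnorm (-f) = wnorm f := by
  simp [wnorm]

lemma wnorm_sub_le (f g : TriSeries) : wnorm (f - g) ≤ wnorm f + wnorm g := by
  rw [sub_eq_add_neg, ← wnorm_neg g]; exact wnorm_add_le _ _

lemma wnorm_mul_le (f g : TriSeries) : wnorm (f * g) ≤ wnorm f * wnorm g := by
  unfold wnorm
  rw [← ENNReal.tsum_mul_right]
  simp_rw [← ENNReal.tsum_mul_left]
  rw [← ENNReal.tsum_prod (f := fun a b => ‖coeff a f‖ₑ * (wt a : ℝ≥0∞) *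
      (‖coeff b g‖ₑ * (wt b : ℝ≥0∞))),
    ← Finset.HasAntidiagonal.sigmaAntidiagonalEquivProd.tsum_eq, ENNReal.tsum_sigma']
  refine ENNReal.tsum_le_tsum fun a => ?_
  rw [tsum_fintype, coeff_mul]
  calc ‖∑ p ∈ antidiagonal a, coeff p.1 f * coeff p.2 g‖ₑ * (wt a : ℝ≥0∞)
      ≤ (∑ p ∈ antidiagonal a, ‖coeff p.1 f * coeff p.2 g‖ₑ) * (wt a : ℝ≥0∞) := by
        gcongr; exact enorm_sum_le _ _
    _ = ∑ p ∈ antidiagonal a, ‖coeff p.1 f * coeff p.2 g‖ₑ * (wt a : ℝ≥0∞) := by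
        rw [Finset.sum_mul]
    _ ≤ ∑ p ∈ antidiagonal a, ‖coeff p.1 f‖ₑ * (wt p.1 : ℝ≥0∞) *
          (‖coeff p.2 g‖ₑ * (wt p.2 : ℝ≥0∞)) := by
        refine Finset.sum_le_sum fun p hp => ?_
        rw [HasAntidiagonal.mem_antidiagonal] at hp
        have : (wt a : ℝ≥0∞) ≤ wt p.1 * wt p.2 := by
          rw [← hp]; exact_mod_cast wt_add_le p.1 p.2
        rw [enorm_mul]
        calc _ ≤ ‖coeff p.1 f‖ₑ * ‖coeff p.2 g‖ₑ * ((wt p.1 : ℝ≥0∞) * wt p.2) := by gcongr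
          _ = _ := by ring
    _ = _ := by
        rw [← Finset.sum_coe_sort]
        rfl

lemma wnorm_monomial (a : Fin 3 →₀ ℕ) (c : ℝ) : wnorm (monomial a c) = ‖c‖ₑ * wt a := by
  classical
  unfold wnorm
  rw [tsum_eq_single a]
  · simp
  · intro b hb
    rw [coeff_monomial, if_neg hb]; simp

lemma wt_zero : wt 0 = 1 := by simp [wt, mdeg]

lemma wnorm_C (c : ℝ) : wnorm (C c) = ‖c‖ₑ := by
  have := wnorm_monomial 0 c
  rwa [wt_zero, monomial_zero_eq_C_apply, ENNReal.coe_one, mul_one] at this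

lemma wnorm_one : wnorm 1 = 1 := by
  have := wnorm_C 1
  simpa using this

lemma wnorm_X_le (i : Fin 3) : wnorm (X i) ≤ 2 := by
  have := wnorm_monomial (Finsupp.single i 1) 1
  rw [show (X i : TriSeries) = monomial (Finsupp.single i 1) 1 from rfl, this]
  have h : wt (Finsupp.single i 1) ≤ 2 := by
    fin_cases i <;> simp [wt, mdeg]
  rw [enorm_one, one_mul]
  exact_mod_cast h

lemma wnorm_pow_le (f : TriSeries) (k : ℕ) : wnorm (f ^ k) ≤ wnorm f ^ k := by
  induction k with
  | zero => simp [wnorm_one]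
  | succ k ih =>
    rw [pow_succ, pow_succ]
    exact (wnorm_mul_le _ _).trans (by gcongr)

/-- The exponent of `u` in the monomial with exponent `a`, where `y = u ^ (q / 2)`. -/
def uexp (q : ℝ) (a : Fin 3 →₀ ℕ) : ℝ := a 1 + q / 2 * a 2

/-- The operator `(s θ + c) ∂ₜ⁻¹` on formal series, where `θ = u ∂ᵤ` and `y = u ^ (q / 2)`. -/
def tInt (q s c : ℝ) (f : TriSeries) : TriSeries := fun a =>
  if a 0 = 0 then 0 else (s * uexp q a + c) / a 0 * coeff (a - Finsupp.single 0 1) f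

lemma coeff_tInt (q s c : ℝ) (f : TriSeries) (a : Fin 3 →₀ ℕ) : coeff a (tInt q s c f) =
    if a 0 = 0 then 0 else (s * uexp q a + c) / a 0 * coeff (a - Finsupp.single 0 1) f := rfl

lemma coeff_add_single_tInt (q s c : ℝ) (f : TriSeries) (a : Fin 3 →₀ ℕ) :
    coeff (a + Finsupp.single 0 1) (tInt q s c f) =
      (s * uexp q a + c) / (a 0 + 1) * coeff a f := by
  rw [coeff_tInt, if_neg (by simp), add_tsub_cancel_right]
  simp [uexp]

lemma exists_add_single {a : Fin 3 →₀ ℕ} (ha : a 0 ≠ 0) : ∃ b, b + Finsupp.single 0 1 = a :=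
  ⟨a - Finsupp.single 0 1, tsub_add_cancel_of_le (by
    rw [Finsupp.single_le_iff]; omega)⟩

lemma add_single_injective :
    Function.Injective (fun a : Fin 3 →₀ ℕ => a + Finsupp.single 0 1) :=
  fun _ _ h => add_right_cancel h

/-- A `t`-primitive has no terms with `a₀ = 0`, so the sum can be reindexed by a shift. The general
`F` serves both norms and termwise derivatives. -/
lemma tsum_tInt {M : Type*} [AddCommMonoid M] [TopologicalSpace M] (q s c : ℝ) (f : TriSeries)
    (F : ℝ → (Fin 3 →₀ ℕ) → M) (hF : ∀ a, F 0 a = 0) :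
    ∑' a, F (coeff a (tInt q s c f)) a
      = ∑' a, F ((s * uexp q a + c) / (a 0 + 1) * coeff a f) (a + Finsupp.single 0 1) := by
  rw [← add_single_injective.tsum_eq]
  · simp_rw [coeff_add_single_tInt]
  · intro a ha
    by_contra h
    refine ha ?_
    have h0 : a 0 = 0 := by
      by_contra h0
      exact h (exists_add_single h0)
    simp only [coeff_tInt, h0, if_true, hF]

/-- The core of the Cauchy–Kovalevskaya argument: `θ` alone is unbounded, but its eigenvalue `uexp q
a` grows at most like `|a| + 1`, which `wt_add_single` compensates after one integration in `t`. -/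
lemma wnorm_tInt_le {q : ℝ} (hq : 0 < q) (s c : ℝ) (f : TriSeries) :
    wnorm (tInt q s c f) ≤ ENNReal.ofReal (2 * (|s| * (1 + q) + |c|)) * wnorm f := by
  unfold wnorm
  rw [tsum_tInt q s c f (fun x a => ‖x‖ₑ * (wt a : ℝ≥0∞)) (by simp), ← ENNReal.tsum_mul_left]
  refine ENNReal.tsum_le_tsum fun a => ?_
  rw [enorm_mul]
  suffices h : ‖(s * uexp q a + c) / ((a 0 : ℝ) + 1)‖ₑ * (wt (a + Finsupp.single 0 1) : ℝ≥0∞)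
      ≤ ENNReal.ofReal (2 * (|s| * (1 + q) + |c|)) * (wt a : ℝ≥0∞) by
    calc _ = ‖(s * uexp q a + c) / ((a 0 : ℝ) + 1)‖ₑ * (wt (a + Finsupp.single 0 1) : ℝ≥0∞)
          * ‖coeff a f‖ₑ := by ring
      _ ≤ ENNReal.ofReal (2 * (|s| * (1 + q) + |c|)) * (wt a : ℝ≥0∞) * ‖coeff a f‖ₑ := by gcongr
      _ = _ := by ring
  rw [← ofReal_norm, ← ENNReal.ofReal_coe_nnreal, ← ENNReal.ofReal_coe_nnreal,
    ← ENNReal.ofReal_mul (norm_nonneg _), ← ENNReal.ofReal_mul (by positivity)]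
  refine ENNReal.ofReal_le_ofReal ?_
  have hw : (wt (a + Finsupp.single 0 1) : ℝ) * (mdeg a + 1) = 2 * wt a * (a 0 + 1) := by
    exact_mod_cast wt_add_single a
  have hp : (0 : ℝ) < (a 0 : ℝ) + 1 := by positivity
  have hp' : (0 : ℝ) < (mdeg a : ℝ) + 1 := by positivity
  have hw' : (wt (a + Finsupp.single 0 1) : ℝ) / (a 0 + 1) = 2 * wt a / (mdeg a + 1) := by
    rw [div_eq_div_iff hp.ne' hp'.ne', hw]
  rw [Real.norm_eq_abs, abs_div, abs_of_pos hp, div_mul_eq_mul_div, mul_div_assoc, hw',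
    ← mul_div_assoc, div_le_iff₀ hp']
  have he : |s * uexp q a + c| ≤ (|s| * (1 + q) + |c|) * (mdeg a + 1) := by
    have h1 : 0 ≤ uexp q a := by unfold uexp; positivity
    have h2 : uexp q a ≤ (1 + q) * (mdeg a + 1) := by
      unfold uexp mdeg; push_cast
      have := mul_nonneg hq.le (Nat.cast_nonneg (α := ℝ) (a 0))
      have := mul_nonneg hq.le (Nat.cast_nonneg (α := ℝ) (a 1))
      have := mul_nonneg hq.le (Nat.cast_nonneg (α := ℝ) (a 2))
      have := (Nat.cast_nonneg (α := ℝ) (a 0))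
      have := (Nat.cast_nonneg (α := ℝ) (a 2))
      nlinarith
    calc |s * uexp q a + c| ≤ |s * uexp q a| + |c| := abs_add_le _ _
      _ = |s| * uexp q a + |c| := by rw [abs_mul, abs_of_nonneg h1]
      _ ≤ |s| * ((1 + q) * (mdeg a + 1)) + |c| * (mdeg a + 1) := by
        gcongr
        exact le_mul_of_one_le_right (abs_nonneg _) (by linarith [(Nat.cast_nonneg (α := ℝ) (mdeg a))])
      _ = _ := by ring
  calc |s * uexp q a + c| * (2 * (wt a : ℝ))
      ≤ ((|s| * (1 + q) + |c|) * (mdeg a + 1)) * (2 * (wt a : ℝ)) := by gcongr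
    _ = _ := by ring

/-- Congruence modulo `t ^ m`. -/
lemma dvd_tInt_sub {q s c : ℝ} {f g : TriSeries} {m : ℕ} (h : (X 0 : TriSeries) ^ m ∣ f - g) :
    (X 0 : TriSeries) ^ (m + 1) ∣ tInt q s c f - tInt q s c g := by
  rw [X_pow_dvd_iff] at h ⊢
  intro a ha
  rw [map_sub, coeff_tInt, coeff_tInt]
  split_ifs with h0
  · simp
  · have h1 := h (a - Finsupp.single 0 1) (by simp; omega)
    rw [map_sub] at h1
    rw [← mul_sub, h1, mul_zero]

end TriSeries

/-! ### The hodograph equation as a fixed-point problem for formal series. -/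

namespace TriSeries

open MvPowerSeries Finset

/-- `Z = 1 + s ∂ₜ⁻² f`. -/
def profile (q s : ℝ) (f : TriSeries) : TriSeries := 1 + C s * tInt q 0 1 (tInt q 0 1 f)

/-- `(θ + β) Z` for `Z = 1 + s ∂ₜ⁻² f`, with `β = 1 + q / 2`. -/
def profileTheta (q s : ℝ) (f : TriSeries) : TriSeries :=
  C (1 + q / 2) + C s * tInt q 1 (1 + q / 2) (tInt q 0 1 f)

/-- The right-hand side of the equation satisfied by `Z`. -/
def source (n : ℕ) (q k s : ℝ) (f : TriSeries) : TriSeries :=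
  (1 - C k * X 2 * profileTheta q s f) ^ (n + 2) *
    (C (1 / 2) + X 1 - C k * X 1 * X 2 * profile q s f) ^ (n - 2)

/-- The equation for `f = s⁻¹ ∂ₜ² Z` reads `f = hodographMap f`. -/
def hodographMap (n : ℕ) (q k s : ℝ) (f : TriSeries) : TriSeries :=
  C (((1 + q / 2) * (q / 2))⁻¹) * (source n q k s f + C s * tInt q 1 (1 + q / 2) f ^ 2
    - C s * f * tInt q 1 (1 + q / 2) (tInt q 1 (q / 2) f))

lemma dvd_mul_sub_mul {R : Type*} [CommRing R] {p a b c d : R} (h : p ∣ a - b) (h' : p ∣ c - d) :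
    p ∣ a * c - b * d := by
  have : a * c - b * d = a * (c - d) + (a - b) * d := by ring
  rw [this]
  exact dvd_add (h'.mul_left _) (h.mul_right _)

lemma dvd_const_mul_sub {R : Type*} [CommRing R] {p b d : R} (a : R) (h : p ∣ b - d) :
    p ∣ a * b - a * d := by
  rw [← mul_sub]; exact h.mul_left _

lemma tInt_zero (q s c : ℝ) : tInt q s c 0 = 0 := by
  ext a; rw [coeff_tInt]; simp

lemma dvd_hodographMap_sub (n : ℕ) (q k s : ℝ) {f g : TriSeries} {m : ℕ}
    (h : (X 0 : TriSeries) ^ m ∣ f - g) :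
    (X 0 : TriSeries) ^ (m + 1) ∣ hodographMap n q k s f - hodographMap n q k s g := by
  have hP : ∀ s' c, (X 0 : TriSeries) ^ (m + 1) ∣ tInt q s' c f - tInt q s' c g :=
    fun s' c => dvd_tInt_sub h
  have hPP : ∀ s' c s'' c', (X 0 : TriSeries) ^ (m + 1) ∣
      tInt q s' c (tInt q s'' c' f) - tInt q s' c (tInt q s'' c' g) :=
    fun s' c s'' c' => (pow_dvd_pow _ (Nat.le_succ _)).trans (dvd_tInt_sub (hP s'' c'))
  have hZ : (X 0 : TriSeries) ^ (m + 1) ∣ profile q s f - profile q s g := by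
    unfold profile
    rw [add_sub_add_left_eq_sub]
    exact dvd_const_mul_sub _ (hPP _ _ _ _)
  have hT : (X 0 : TriSeries) ^ (m + 1) ∣ profileTheta q s f - profileTheta q s g := by
    unfold profileTheta
    rw [add_sub_add_left_eq_sub]
    exact dvd_const_mul_sub _ (hPP _ _ _ _)
  have hS : (X 0 : TriSeries) ^ (m + 1) ∣ source n q k s f - source n q k s g := by
    unfold source
    refine dvd_mul_sub_mul (dvd_trans ?_ (sub_dvd_pow_sub_pow _ _ _))
      (dvd_trans ?_ (sub_dvd_pow_sub_pow _ _ _))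
    · rw [sub_sub_sub_cancel_left, dvd_sub_comm]
      exact dvd_const_mul_sub _ hT
    · rw [sub_sub_sub_cancel_left, dvd_sub_comm]
      exact dvd_const_mul_sub _ hZ
  unfold hodographMap
  refine dvd_const_mul_sub _ ?_
  rw [sub_sub_sub_comm, add_sub_add_comm]
  refine dvd_sub (dvd_add hS (dvd_const_mul_sub _ ((hP _ _).trans (sub_dvd_pow_sub_pow _ _ _)))) ?_
  rw [mul_assoc, mul_assoc]
  refine dvd_const_mul_sub _ ?_
  set I := tInt q 1 (1 + q / 2) with hI
  set J := tInt q 1 (q / 2) with hJ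
  -- The factor `f` is not integrated, so `f - g` alone supplies only `t^m`; the missing power of
  -- `t` comes from `I (J g)`, which is a primitive and hence divisible by `t`.
  have : f * I (J f) - g * I (J g) = f * (I (J f) - I (J g)) + (f - g) * I (J g) := by ring
  rw [this]
  refine dvd_add ((hPP _ _ _ _).mul_left _) ?_
  rw [pow_succ]
  refine mul_dvd_mul h ?_
  have := dvd_tInt_sub (q := q) (s := 1) (c := 1 + q / 2) (f := J g) (g := 0) (m := 0) (by simp)
  rw [tInt_zero, sub_zero, zero_add, pow_one] at this
  exact this

/-- `M` bounds the right-hand side when `Z` and `(θ + β) Z` have norm at most `2` and `β + 1`; its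
two extra summands `1` absorb the quadratic terms, each carrying a factor `s`. Neither `K` nor `M`
involves `s`, which can therefore be chosen afterwards. -/
lemma wnorm_hodographMap_le {n : ℕ} {q k s : ℝ} (hq : 0 < q) (hk0 : 0 ≤ k) (hk : k ≤ 1)
    {K M : ℝ≥0∞} (hK : ∀ s' c : ℝ, 0 ≤ s' → s' ≤ 1 → 0 ≤ c → c ≤ 1 + q / 2 → ∀ f,
      wnorm (tInt q s' c f) ≤ K * wnorm f)
    (hM : ‖((1 + q / 2) * (q / 2))⁻¹‖ₑ * ((1 + 2 * (‖1 + q / 2‖ₑ + 1)) ^ (n + 2) *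
      (‖(1 / 2 : ℝ)‖ₑ + 2 + 2 * 2 * (1 + 1)) ^ (n - 2) + 1 + 1) ≤ M)
    (hs1 : ‖s‖ₑ * (K * (K * M)) ≤ 1) (hs2 : ‖s‖ₑ * (K * M) ^ 2 ≤ 1)
    {f : TriSeries} (hf : wnorm f ≤ M) : wnorm (hodographMap n q k s f) ≤ M := by
  have hPP : ∀ s' c s'' c' : ℝ, 0 ≤ s' → s' ≤ 1 → 0 ≤ c → c ≤ 1 + q / 2 →
      0 ≤ s'' → s'' ≤ 1 → 0 ≤ c' → c' ≤ 1 + q / 2 →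
      wnorm (tInt q s' c (tInt q s'' c' f)) ≤ K * (K * M) := by
    intro s' c s'' c' h1 h2 h3 h4 h5 h6 h7 h8
    refine (hK s' c h1 h2 h3 h4 _).trans ?_
    gcongr
    refine (hK s'' c' h5 h6 h7 h8 _).trans ?_
    gcongr
  have hk' : ‖k‖ₑ ≤ 1 := by
    rw [← ofReal_norm, Real.norm_eq_abs, abs_of_nonneg hk0]
    simpa using hk
  have hZ : wnorm (profile q s f) ≤ 1 + 1 := by
    refine (wnorm_add_le _ _).trans ?_
    rw [wnorm_one]
    gcongr
    refine (wnorm_mul_le _ _).trans (le_trans ?_ hs1)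
    rw [wnorm_C]
    gcongr
    exact hPP _ _ _ _ le_rfl zero_le_one zero_le_one (by linarith) le_rfl zero_le_one zero_le_one
      (by linarith)
  have hT : wnorm (profileTheta q s f) ≤ ‖1 + q / 2‖ₑ + 1 := by
    refine (wnorm_add_le _ _).trans ?_
    rw [wnorm_C]
    gcongr
    refine (wnorm_mul_le _ _).trans (le_trans ?_ hs1)
    rw [wnorm_C]
    gcongr
    exact hPP _ _ _ _ zero_le_one le_rfl (by linarith) le_rfl le_rfl zero_le_one zero_le_one
      (by linarith)
  refine le_trans ?_ hM
  refine (wnorm_mul_le _ _).trans ?_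
  rw [wnorm_C]
  gcongr
  refine (wnorm_sub_le _ _).trans ?_
  gcongr
  · refine (wnorm_add_le _ _).trans ?_
    gcongr
    · refine (wnorm_mul_le _ _).trans ?_
      gcongr
      · refine (wnorm_pow_le _ _).trans ?_
        gcongr
        refine (wnorm_sub_le _ _).trans ?_
        rw [wnorm_one]
        gcongr
        refine (wnorm_mul_le _ _).trans ?_
        gcongr
        refine (wnorm_mul_le _ _).trans ?_
        rw [wnorm_C]
        calc ‖k‖ₑ * wnorm (X 2) ≤ 1 * 2 := by gcongr; exact wnorm_X_le 2
          _ = 2 := one_mul _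
      · refine (wnorm_pow_le _ _).trans ?_
        gcongr
        refine (wnorm_sub_le _ _).trans ?_
        gcongr
        · refine (wnorm_add_le _ _).trans ?_
          rw [wnorm_C]
          gcongr
          exact wnorm_X_le 1
        · refine (wnorm_mul_le _ _).trans ?_
          gcongr
          refine (wnorm_mul_le _ _).trans ?_
          gcongr
          · refine (wnorm_mul_le _ _).trans ?_
            rw [wnorm_C]
            calc ‖k‖ₑ * wnorm (X 1) ≤ 1 * 2 := by gcongr; exact wnorm_X_le 1
              _ = 2 := one_mul _
          · exact wnorm_X_le 2
    · refine (wnorm_mul_le _ _).trans (le_trans ?_ hs2)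
      rw [wnorm_C]
      gcongr
      refine (wnorm_pow_le _ _).trans ?_
      gcongr
      refine (hK _ _ zero_le_one le_rfl (by linarith) le_rfl _).trans ?_
      gcongr
  · refine (wnorm_mul_le _ _).trans (le_trans ?_ hs2)
    calc _ ≤ (‖s‖ₑ * M) * (K * (K * M)) := by
          gcongr
          · refine (wnorm_mul_le _ _).trans ?_
            rw [wnorm_C]
            gcongr
          · exact hPP _ _ _ _ zero_le_one le_rfl (by linarith) le_rfl zero_le_one le_rfl
              (by linarith) (by linarith)
      _ = _ := by ring

/-- The iterates of a `t`-adically contracting map that preserves a ball of the weighted `ℓ¹`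
norm converge coefficientwise to a fixed point in this ball. -/
lemma exists_fixedPoint {G : TriSeries → TriSeries} {M : ℝ≥0∞}
    (hG : ∀ f g m, (X 0 : TriSeries) ^ m ∣ f - g → (X 0 : TriSeries) ^ (m + 1) ∣ G f - G g)
    (hM : ∀ f, wnorm f ≤ M → wnorm (G f) ≤ M) : ∃ f, G f = f ∧ wnorm f ≤ M := by
  set x : ℕ → TriSeries := fun m => G^[m] 0 with hx
  have hsucc : ∀ m, x (m + 1) = G (x m) := fun m => Function.iterate_succ_apply' _ _ _
  have hbd : ∀ m, wnorm (x m) ≤ M := by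
    intro m
    induction m with
    | zero => simp [hx, wnorm]
    | succ m ih => rw [hsucc]; exact hM _ ih
  have hstep : ∀ m, (X 0 : TriSeries) ^ m ∣ x (m + 1) - x m := by
    intro m
    induction m with
    | zero => simp
    | succ m ih => rw [hsucc (m + 1), hsucc m]; exact hG _ _ _ (by rwa [hsucc m] at ih)
  have hlim : ∀ m j, (X 0 : TriSeries) ^ m ∣ x (m + j) - x m := by
    intro m j
    induction j with
    | zero => simp
    | succ j ih =>
      have := dvd_add ((pow_dvd_pow _ (Nat.le_add_right m j)).trans (hstep (m + j))) ih
      rwa [sub_add_sub_cancel] at this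
  -- The coefficient at `a` is frozen from iterate `a₀ + 1` on, which defines the limit without any
  -- contraction estimate in norm.
  have hco : ∀ (a : Fin 3 →₀ ℕ) m, a 0 < m → coeff a (x m) = coeff a (x (a 0 + 1)) := by
    intro a m ha
    obtain ⟨j, rfl⟩ := Nat.exists_eq_add_of_le (Nat.succ_le_of_lt ha)
    have := (X_pow_dvd_iff.1 (hlim (a 0 + 1) j)) a (Nat.lt_succ_self _)
    rw [map_sub, sub_eq_zero] at this
    exact this
  set f : TriSeries := fun a => coeff a (x (a 0 + 1)) with hf
  have hfc : ∀ a, coeff a f = coeff a (x (a 0 + 1)) := fun a => rfl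
  have hfx : ∀ m, (X 0 : TriSeries) ^ m ∣ f - x m := by
    intro m
    rw [X_pow_dvd_iff]
    intro a ha
    rw [map_sub, hfc, hco a m ha, sub_self]
  refine ⟨f, ?_, ?_⟩
  · ext a
    have h1 := X_pow_dvd_iff.1 (hG _ _ _ (hfx (a 0))) a (Nat.lt_succ_self _)
    rw [map_sub, sub_eq_zero] at h1
    rw [h1, ← hsucc, hfc]
  -- Every finite partial sum of the norm of the limit is already a partial sum for one late
  -- iterate.
  · unfold wnorm
    rw [ENNReal.tsum_eq_iSup_sum]
    refine iSup_le fun S => ?_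
    obtain ⟨m, hm⟩ : ∃ m, ∀ a ∈ S, a 0 < m :=
      ⟨S.sup (fun a => a 0) + 1, fun a ha => Nat.lt_succ_of_le (Finset.le_sup (f := fun a : Fin 3 →₀ ℕ => a 0) ha)⟩
    calc ∑ a ∈ S, ‖coeff a f‖ₑ * (wt a : ℝ≥0∞) = ∑ a ∈ S, ‖coeff a (x m)‖ₑ * (wt a : ℝ≥0∞) := by
          refine Finset.sum_congr rfl fun a ha => ?_
          rw [hfc, hco a m (hm a ha)]
      _ ≤ wnorm (x m) := ENNReal.sum_le_tsum S
      _ ≤ M := hbd m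

/-- Besides preserving the ball, a small `s` keeps `s` times the first and second primitives of `f`
below `η`; these bounds later fix the signs and sizes of the derivatives of `ρ`. -/
theorem exists_hodographMap_eq (n : ℕ) {q k η : ℝ} (hq : 0 < q) (hk0 : 0 ≤ k) (hk : k ≤ 1)
    (hη : 0 < η) : ∃ s : ℝ, 0 < s ∧ ∃ f : TriSeries, hodographMap n q k s f = f ∧ wnorm f < ⊤ ∧
      (∀ s' c : ℝ, 0 ≤ s' → s' ≤ 1 → 0 ≤ c → c ≤ 1 + q / 2 →
        ‖s‖ₑ * wnorm (tInt q s' c f) ≤ ENNReal.ofReal η) ∧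
      (∀ s' c s'' c' : ℝ, 0 ≤ s' → s' ≤ 1 → 0 ≤ c → c ≤ 1 + q / 2 →
        0 ≤ s'' → s'' ≤ 1 → 0 ≤ c' → c' ≤ 1 + q / 2 →
        ‖s‖ₑ * wnorm (tInt q s' c (tInt q s'' c' f)) ≤ ENNReal.ofReal η) := by
  set K : ℝ≥0∞ := ENNReal.ofReal (2 * (1 * (1 + q) + (1 + q / 2))) with hKdef
  have hK : ∀ s' c : ℝ, 0 ≤ s' → s' ≤ 1 → 0 ≤ c → c ≤ 1 + q / 2 → ∀ f,
      wnorm (tInt q s' c f) ≤ K * wnorm f := by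
    intro s' c h1 h2 h3 h4 f
    refine (wnorm_tInt_le hq s' c f).trans ?_
    rw [abs_of_nonneg h1, abs_of_nonneg h3, hKdef]
    gcongr
  set M : ℝ≥0∞ := ‖((1 + q / 2) * (q / 2))⁻¹‖ₑ * ((1 + 2 * (‖1 + q / 2‖ₑ + 1)) ^ (n + 2) *
      (‖(1 / 2 : ℝ)‖ₑ + 2 + 2 * 2 * (1 + 1)) ^ (n - 2) + 1 + 1) with hMdef
  have hMt : M < ⊤ := by
    rw [hMdef, lt_top_iff_ne_top]
    finiteness
  have hKt : K < ⊤ := ENNReal.ofReal_lt_top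
  obtain ⟨s, hs, hsB⟩ : ∃ s : ℝ, 0 < s ∧
      ‖s‖ₑ * (K * M + K * (K * M) + (K * M) ^ 2) ≤ min 1 (ENNReal.ofReal η) := by
    set B := K * M + K * (K * M) + (K * M) ^ 2 with hB
    have hBt : B ≠ ⊤ := by rw [hB]; finiteness
    have hm : 0 < min 1 (ENNReal.ofReal η) := lt_min one_pos (by simpa using hη)
    have hmt : min 1 (ENNReal.ofReal η) ≠ ⊤ := (lt_of_le_of_lt (min_le_left _ _) ENNReal.one_lt_top).ne
    set μ := (min 1 (ENNReal.ofReal η)).toReal with hμ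
    have hμ0 : 0 < μ := ENNReal.toReal_pos hm.ne' hmt
    refine ⟨μ / (B.toReal + 1), by positivity, ?_⟩
    rw [← ofReal_norm, Real.norm_of_nonneg (by positivity), ← ENNReal.ofReal_toReal hBt,
      ← ENNReal.ofReal_mul (by positivity), ← ENNReal.ofReal_toReal hmt]
    refine ENNReal.ofReal_le_ofReal ?_
    rw [ENNReal.toReal_ofReal ENNReal.toReal_nonneg, ← hμ, div_mul_eq_mul_div,
      div_le_iff₀ (by positivity)]
    nlinarith [hμ0, (ENNReal.toReal_nonneg : 0 ≤ B.toReal)]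
  have hle : ∀ x, x ≤ K * M + K * (K * M) + (K * M) ^ 2 → ‖s‖ₑ * x ≤ min 1 (ENNReal.ofReal η) :=
    fun x hx => le_trans (by gcongr) hsB
  have hKM := hle (K * M) (le_add_right (le_add_right le_rfl))
  have hKKM := hle (K * (K * M)) (le_add_right (le_add_left le_rfl))
  have hKM2 := hle ((K * M) ^ 2) (le_add_left le_rfl)
  obtain ⟨f, hf, hfM⟩ := exists_fixedPoint (fun f g m h => dvd_hodographMap_sub n q k s h)
    (fun f hf => wnorm_hodographMap_le (n := n) (s := s) hq hk0 hk hK hMdef.ge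
      (hKKM.trans (min_le_left _ _)) (hKM2.trans (min_le_left _ _)) hf)
  have h1 : ∀ s' c : ℝ, 0 ≤ s' → s' ≤ 1 → 0 ≤ c → c ≤ 1 + q / 2 →
      wnorm (tInt q s' c f) ≤ K * M := fun s' c h1 h2 h3 h4 =>
    (hK s' c h1 h2 h3 h4 f).trans (by gcongr)
  refine ⟨s, hs, f, hf, hfM.trans_lt hMt, ?_, ?_⟩
  · intro s' c h2 h3 h4 h5
    exact le_trans (by gcongr; exact h1 s' c h2 h3 h4 h5) (hKM.trans (min_le_right _ _))
  · intro s' c s'' c' h2 h3 h4 h5 h6 h7 h8 h9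
    refine le_trans ?_ (hKKM.trans (min_le_right _ _))
    gcongr
    exact (hK s' c h2 h3 h4 h5 _).trans (by gcongr; exact h1 s'' c' h6 h7 h8 h9)

end TriSeries

/-! ### Evaluation and termwise differentiation of the series. -/

namespace TriSeries

open MvPowerSeries Finset

/-- The value of a series at `t`, `u = exp z`, `y = u ^ (q / 2)`, where `p = (z, t)`. -/
def ev (q : ℝ) (f : TriSeries) (p : ℝ × ℝ) : ℝ :=
  ∑' a, coeff a f * (Real.exp (uexp q a * p.1) * p.2 ^ a 0)

lemma summable_norm_coeff {f : TriSeries} (hf : wnorm f < ⊤) :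
    Summable fun a => ‖coeff a f‖ := by
  have h : ∑' a, ‖coeff a f‖ₑ ≠ ⊤ := by
    refine (lt_of_le_of_lt (ENNReal.tsum_le_tsum fun a => ?_) hf).ne
    exact le_mul_of_one_le_right' (by exact_mod_cast one_le_wt a)
  have := ENNReal.summable_toReal h
  simpa using this

lemma tsum_norm_coeff_le {f : TriSeries} (hf : wnorm f < ⊤) :
    ∑' a, ‖coeff a f‖ ≤ (wnorm f).toReal := by
  have h : ∑' a, ‖coeff a f‖ₑ ≤ wnorm f := ENNReal.tsum_le_tsum fun a =>
    le_mul_of_one_le_right' (by exact_mod_cast one_le_wt a)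
  have h2 := ENNReal.toReal_mono hf.ne h
  rw [ENNReal.tsum_toReal_eq (by simp)] at h2
  simpa using h2

lemma uexp_nonneg {q : ℝ} (hq : 0 < q) (a : Fin 3 →₀ ℕ) : 0 ≤ uexp q a := by
  unfold uexp; positivity

lemma norm_monomial_le {q : ℝ} (hq : 0 < q) (a : Fin 3 →₀ ℕ) {p : ℝ × ℝ} (hz : p.1 ≤ 0)
    (ht : |p.2| ≤ 1) : ‖Real.exp (uexp q a * p.1) * p.2 ^ a 0‖ ≤ 1 := by
  rw [norm_mul, norm_pow, Real.norm_eq_abs, Real.norm_eq_abs, abs_of_pos (Real.exp_pos _)]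
  refine mul_le_one₀ (Real.exp_le_one_iff.2 ?_) (by positivity) (pow_le_one₀ (abs_nonneg _) ht)
  exact mul_nonpos_of_nonneg_of_nonpos (uexp_nonneg hq a) hz

lemma norm_term_le {q : ℝ} (hq : 0 < q) (f : TriSeries) (a : Fin 3 →₀ ℕ) {p : ℝ × ℝ}
    (hz : p.1 ≤ 0) (ht : |p.2| ≤ 1) :
    ‖coeff a f * (Real.exp (uexp q a * p.1) * p.2 ^ a 0)‖ ≤ ‖coeff a f‖ := by
  rw [norm_mul]
  exact mul_le_of_le_one_right (norm_nonneg _) (norm_monomial_le hq a hz ht)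

lemma summable_norm_term {q : ℝ} (hq : 0 < q) {f : TriSeries} (hf : wnorm f < ⊤) {p : ℝ × ℝ}
    (hz : p.1 ≤ 0) (ht : |p.2| ≤ 1) :
    Summable fun a => ‖coeff a f * (Real.exp (uexp q a * p.1) * p.2 ^ a 0)‖ :=
  (summable_norm_coeff hf).of_nonneg_of_le (fun _ => norm_nonneg _)
    fun a => norm_term_le hq f a hz ht

lemma abs_ev_le {q : ℝ} (hq : 0 < q) {f : TriSeries} (hf : wnorm f < ⊤) {p : ℝ × ℝ}
    (hz : p.1 ≤ 0) (ht : |p.2| ≤ 1) : |ev q f p| ≤ (wnorm f).toReal := by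
  refine (norm_tsum_le_tsum_norm (summable_norm_term hq hf hz ht)).trans
    (le_trans ?_ (tsum_norm_coeff_le hf))
  exact (summable_norm_term hq hf hz ht).tsum_le_tsum (fun a => norm_term_le hq f a hz ht)
    (summable_norm_coeff hf)

lemma abs_mul_ev_le {q : ℝ} (hq : 0 < q) {f : TriSeries} (hf : wnorm f < ⊤) {p : ℝ × ℝ}
    (hz : p.1 ≤ 0) (ht : |p.2| ≤ 1) {s η : ℝ} (hη : 0 ≤ η)
    (h : ‖s‖ₑ * wnorm f ≤ ENNReal.ofReal η) : |s * ev q f p| ≤ η := by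
  have h1 := ENNReal.toReal_mono ENNReal.ofReal_ne_top h
  rw [ENNReal.toReal_mul, ENNReal.toReal_ofReal hη, toReal_enorm, Real.norm_eq_abs] at h1
  rw [abs_mul]
  exact le_trans (by gcongr; exact abs_ev_le hq hf hz ht) h1

lemma continuousOn_ev {q : ℝ} (hq : 0 < q) {f : TriSeries} (hf : wnorm f < ⊤) :
    ContinuousOn (ev q f) {p | p.1 ≤ 0 ∧ |p.2| ≤ 1} :=
  continuousOn_tsum (fun a => by fun_prop) (summable_norm_coeff hf)
    fun a _ hp => norm_term_le hq f a hp.1 hp.2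

/-- `f` has finite weighted norm, and its value at `p` is `x`. -/
structure HasValue (q : ℝ) (p : ℝ × ℝ) (f : TriSeries) (x : ℝ) : Prop where
  lt_top : wnorm f < ⊤
  ev_eq : ev q f p = x

section

variable {q : ℝ} {p : ℝ × ℝ} {f g : TriSeries} {x y : ℝ}

lemma HasValue.add (hq : 0 < q) (hz : p.1 ≤ 0) (ht : |p.2| ≤ 1) (hf : HasValue q p f x)
    (hg : HasValue q p g y) : HasValue q p (f + g) (x + y) := by
  refine ⟨(wnorm_add_le _ _).trans_lt (ENNReal.add_lt_top.2 ⟨hf.1, hg.1⟩), ?_⟩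
  rw [← hf.2, ← hg.2]
  unfold ev
  rw [← (summable_norm_term hq hf.1 hz ht).of_norm.tsum_add
    (summable_norm_term hq hg.1 hz ht).of_norm]
  simp_rw [map_add, add_mul]

lemma HasValue.sub (hq : 0 < q) (hz : p.1 ≤ 0) (ht : |p.2| ≤ 1) (hf : HasValue q p f x)
    (hg : HasValue q p g y) : HasValue q p (f - g) (x - y) := by
  refine ⟨(wnorm_sub_le _ _).trans_lt (ENNReal.add_lt_top.2 ⟨hf.1, hg.1⟩), ?_⟩
  rw [← hf.2, ← hg.2]
  unfold ev
  rw [← (summable_norm_term hq hf.1 hz ht).of_norm.tsum_sub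
    (summable_norm_term hq hg.1 hz ht).of_norm]
  simp_rw [map_sub, sub_mul]

lemma HasValue.mul (hq : 0 < q) (hz : p.1 ≤ 0) (ht : |p.2| ≤ 1) (hf : HasValue q p f x)
    (hg : HasValue q p g y) : HasValue q p (f * g) (x * y) := by
  refine ⟨(wnorm_mul_le _ _).trans_lt (ENNReal.mul_lt_top hf.1 hg.1), ?_⟩
  rw [← hf.2, ← hg.2]
  unfold ev
  have hsf := summable_norm_term hq hf.1 hz ht
  have hsg := summable_norm_term hq hg.1 hz ht
  rw [hsf.of_norm.tsum_mul_tsum_eq_tsum_sum_antidiagonal hsg.of_norm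
    (summable_mul_of_summable_norm hsf hsg)]
  refine tsum_congr fun a => ?_
  rw [coeff_mul, Finset.sum_mul]
  refine Finset.sum_congr rfl fun b hb => ?_
  rw [HasAntidiagonal.mem_antidiagonal] at hb
  have h1 : uexp q a = uexp q b.1 + uexp q b.2 := by rw [← hb]; simp [uexp]; ring
  have h2 : a 0 = b.1 0 + b.2 0 := by rw [← hb]; simp
  rw [h1, h2, add_mul, Real.exp_add, pow_add]
  ring

lemma hasValue_monomial (a : Fin 3 →₀ ℕ) (c : ℝ) :
    HasValue q p (monomial a c) (c * (Real.exp (uexp q a * p.1) * p.2 ^ a 0)) := by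
  classical
  refine ⟨?_, ?_⟩
  · rw [wnorm_monomial]; finiteness
  · unfold ev
    rw [tsum_eq_single a]
    · simp
    · intro b hb
      rw [coeff_monomial, if_neg hb, zero_mul]

lemma hasValue_C (c : ℝ) : HasValue q p (C c) c := by
  have := hasValue_monomial (q := q) (p := p) 0 c
  rw [monomial_zero_eq_C_apply] at this
  simpa [uexp] using this

lemma hasValue_one : HasValue q p 1 1 := by
  simpa using hasValue_C (q := q) (p := p) 1

lemma hasValue_X_one : HasValue q p (X 1) (Real.exp p.1) := by
  have := hasValue_monomial (q := q) (p := p) (Finsupp.single 1 1) 1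
  rw [show (X 1 : TriSeries) = monomial (Finsupp.single 1 1) 1 from rfl]
  simpa [uexp] using this

lemma hasValue_X_two : HasValue q p (X 2) (Real.exp (q / 2 * p.1)) := by
  have := hasValue_monomial (q := q) (p := p) (Finsupp.single 2 1) 1
  rw [show (X 2 : TriSeries) = monomial (Finsupp.single 2 1) 1 from rfl]
  simpa [uexp] using this

lemma HasValue.pow (hq : 0 < q) (hz : p.1 ≤ 0) (ht : |p.2| ≤ 1) (hf : HasValue q p f x) (k : ℕ) :
    HasValue q p (f ^ k) (x ^ k) := by
  induction k with
  | zero => simpa using hasValue_one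
  | succ k ih => rw [pow_succ, pow_succ]; exact ih.mul hq hz ht hf

lemma HasValue.tInt (hq : 0 < q) (hf : HasValue q p f x) (s c : ℝ) :
    HasValue q p (tInt q s c f) (ev q (tInt q s c f) p) :=
  ⟨(wnorm_tInt_le hq s c f).trans_lt (ENNReal.mul_lt_top ENNReal.ofReal_lt_top hf.1), rfl⟩

end

lemma wnorm_tInt_lt_top {q : ℝ} (hq : 0 < q) {f : TriSeries} (hf : wnorm f < ⊤) (s c : ℝ) :
    wnorm (tInt q s c f) < ⊤ :=
  (wnorm_tInt_le hq s c f).trans_lt (ENNReal.mul_lt_top ENNReal.ofReal_lt_top hf)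

lemma coeff_tInt_one (q c : ℝ) (f : TriSeries) (a : Fin 3 →₀ ℕ) :
    coeff a (tInt q 1 c f) = (uexp q a + c) * coeff a (tInt q 0 1 f) := by
  rw [coeff_tInt, coeff_tInt]
  split_ifs <;> simp
  ring

lemma ev_tInt_one {q : ℝ} (hq : 0 < q) {f : TriSeries} (hf : wnorm f < ⊤) (c : ℝ) {p : ℝ × ℝ}
    (hz : p.1 ≤ 0) (ht : |p.2| ≤ 1) :
    ev q (tInt q 1 c f) p = ev q (tInt q 1 0 f) p + c * ev q (tInt q 0 1 f) p := by
  unfold ev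
  rw [← tsum_mul_left, ← Summable.tsum_add]
  · refine tsum_congr fun a => ?_
    rw [coeff_tInt_one, coeff_tInt_one]; ring
  · exact (summable_norm_term hq (wnorm_tInt_lt_top hq hf 1 0) hz ht).of_norm
  · exact (summable_norm_term hq (wnorm_tInt_lt_top hq hf 0 1) hz ht).of_norm.mul_left c

/-- `uexp` ignores the exponent of `t`, so `θ` commutes with `∂_t⁻¹`. -/
lemma tInt_comm (q s c s' c' : ℝ) (f : TriSeries) :
    tInt q s c (tInt q s' c' f) = tInt q s' c' (tInt q s c f) := by
  ext a
  rw [coeff_tInt q s c _ a, coeff_tInt q s' c' _ a]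
  split_ifs with h
  · rfl
  · obtain ⟨b, rfl⟩ := exists_add_single h
    rw [add_tsub_cancel_right, coeff_tInt, coeff_tInt]
    have : uexp q (b + Finsupp.single 0 1) = uexp q b := by simp [uexp]
    split_ifs
    · simp
    · rw [this]; ring

/-- `∂ₜ⁻¹ f` has derivatives `θ ∂ₜ⁻¹ f` in `z = log u` and `f` in `t`. -/
lemma hasFDerivAt_ev_tInt {q : ℝ} (hq : 0 < q) {f : TriSeries} (hf : wnorm f < ⊤) {p : ℝ × ℝ}
    (hz : p.1 < 0) (ht : |p.2| < 1) :
    HasFDerivAt (ev q (tInt q 0 1 f))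
      (ev q (tInt q 1 0 f) p • ContinuousLinearMap.fst ℝ ℝ ℝ
        + ev q f p • ContinuousLinearMap.snd ℝ ℝ ℝ) p := by
  set g := tInt q 0 1 f with hg
  have hgf : wnorm g < ⊤ := wnorm_tInt_lt_top hq hf 0 1
  have hθ : wnorm (tInt q 1 0 f) < ⊤ := wnorm_tInt_lt_top hq hf 1 0
  have hco : ∀ a, coeff a (tInt q 1 0 f) = uexp q a * coeff a g := fun a => by
    rw [coeff_tInt_one, add_zero]
  -- Both differentiated series converge absolutely without shrinking the domain: `θ g` is `tInt q 1
  -- 0 f`, of finite norm, and `∂_t g` is a shift of the coefficients of `f`.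
  have hs1 : Summable fun a : Fin 3 →₀ ℕ => ‖uexp q a * coeff a g‖ := by
    simpa only [hco] using summable_norm_coeff hθ
  have hbase : ∀ a : Fin 3 →₀ ℕ, coeff (a + Finsupp.single 0 1) g * ((a + Finsupp.single 0 1 : Fin 3 →₀ ℕ) 0 : ℕ)
      = coeff a f := by
    intro a
    rw [hg, coeff_add_single_tInt]
    have : ((a 0 : ℝ) + 1) ≠ 0 := by positivity
    simp
    field_simp
  have hs2 : Summable fun a : Fin 3 →₀ ℕ => ‖coeff a g * (a 0 : ℕ)‖ := by
    rw [← add_single_injective.summable_iff]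
    · refine (summable_norm_coeff hf).congr fun a => ?_
      simp only [Function.comp_apply]
      rw [hbase]
    · intro a ha
      have h0 : a 0 = 0 := by
        by_contra h0
        exact ha (exists_add_single h0)
      simp [h0]
  set D : (Fin 3 →₀ ℕ) → ℝ × ℝ → (ℝ × ℝ →L[ℝ] ℝ) := fun a p =>
    (uexp q a * coeff a g * (Real.exp (uexp q a * p.1) * p.2 ^ a 0)) • ContinuousLinearMap.fst ℝ ℝ ℝ
      + (coeff a g * (a 0 : ℕ) * (Real.exp (uexp q a * p.1) * p.2 ^ (a 0 - 1)))
        • ContinuousLinearMap.snd ℝ ℝ ℝ with hD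
  have hb1 : ∀ a (p : ℝ × ℝ), p.1 ≤ 0 → |p.2| ≤ 1 →
      ‖uexp q a * coeff a g * (Real.exp (uexp q a * p.1) * p.2 ^ a 0)‖
        ≤ ‖uexp q a * coeff a g‖ := by
    intro a p h1 h2
    rw [norm_mul]
    exact mul_le_of_le_one_right (norm_nonneg _) (norm_monomial_le hq a h1 h2)
  have hb2 : ∀ a (p : ℝ × ℝ), p.1 ≤ 0 → |p.2| ≤ 1 →
      ‖coeff a g * (a 0 : ℕ) * (Real.exp (uexp q a * p.1) * p.2 ^ (a 0 - 1))‖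
        ≤ ‖coeff a g * (a 0 : ℕ)‖ := by
    intro a p h1 h2
    rw [norm_mul]
    refine mul_le_of_le_one_right (norm_nonneg _) ?_
    rw [norm_mul, norm_pow, Real.norm_eq_abs, Real.norm_eq_abs, abs_of_pos (Real.exp_pos _)]
    refine mul_le_one₀ (Real.exp_le_one_iff.2 ?_) (by positivity) (pow_le_one₀ (abs_nonneg _) h2)
    exact mul_nonpos_of_nonneg_of_nonpos (uexp_nonneg hq a) h1
  have hopen : IsOpen {p : ℝ × ℝ | p.1 < 0 ∧ |p.2| < 1} :=
    IsOpen.inter (isOpen_lt continuous_fst continuous_const)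
      (isOpen_lt continuous_snd.abs continuous_const)
  have hconv : Convex ℝ {p : ℝ × ℝ | p.1 < 0 ∧ |p.2| < 1} := by
    have : {p : ℝ × ℝ | p.1 < 0 ∧ |p.2| < 1} = Set.Iio 0 ×ˢ Set.Ioo (-1) 1 := by
      ext p; simp [abs_lt]
    rw [this]
    exact (convex_Iio 0).prod (convex_Ioo _ _)
  have key := hasFDerivAt_tsum_of_isPreconnected (𝕜 := ℝ)
    (f := fun a (p : ℝ × ℝ) => coeff a g * (Real.exp (uexp q a * p.1) * p.2 ^ a 0))
    (f' := D) (x := p) (x₀ := p)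
    (u := fun a => ‖uexp q a * coeff a g‖ + ‖coeff a g * (a 0 : ℕ)‖) (hs1.add hs2) hopen
    hconv.isPreconnected ?_ ?_ ⟨hz, ht⟩ (summable_norm_term hq hgf hz.le ht.le).of_norm ⟨hz, ht⟩
  · refine key.congr_fderiv ?_
    rw [hD]
    have e1 := summable_norm_term hq hθ hz.le ht.le
    have e2 : Summable fun a : Fin 3 →₀ ℕ =>
        coeff a g * (a 0 : ℕ) * (Real.exp (uexp q a * p.1) * p.2 ^ (a 0 - 1)) :=
      (hs2.of_nonneg_of_le (fun _ => norm_nonneg _) fun a => hb2 a p hz.le ht.le).of_norm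
    simp_rw [hco] at e1
    rw [Summable.tsum_add, e1.of_norm.tsum_smul_const, e2.tsum_smul_const]
    · congr 2
      · unfold ev
        simp_rw [hco]
      · unfold ev
        rw [tsum_tInt q 0 1 f (fun x a => x * (a 0 : ℕ) * (Real.exp (uexp q a * p.1) * p.2 ^ (a 0 - 1)))
          (by simp)]
        refine tsum_congr fun a => ?_
        rw [← coeff_add_single_tInt, ← hg, hbase]
        simp [uexp]
    · exact e1.of_norm.smul_const _
    · exact e2.smul_const _
  · intro a p _
    have h1 : HasFDerivAt (fun p : ℝ × ℝ => Real.exp (uexp q a * p.1))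
        (Real.exp (uexp q a * p.1) • (uexp q a • ContinuousLinearMap.fst ℝ ℝ ℝ)) p :=
      (hasFDerivAt_fst.const_mul (uexp q a)).exp
    have h2 : HasFDerivAt (fun p : ℝ × ℝ => p.2 ^ a 0)
        (((a 0 : ℕ) * p.2 ^ (a 0 - 1)) • ContinuousLinearMap.snd ℝ ℝ ℝ) p := by
      have := (hasDerivAt_pow (a 0) p.2).comp_hasFDerivAt p
        (hasFDerivAt_snd (𝕜 := ℝ) (E := ℝ) (F := ℝ))
      exact this
    refine ((h1.mul h2).const_mul (coeff a g)).congr_fderiv ?_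
    rw [hD]
    ext <;> simp <;> ring
  · intro a p hp
    refine (norm_add_le _ _).trans (add_le_add ?_ ?_)
    · rw [norm_smul]
      exact (mul_le_of_le_one_right (norm_nonneg _) (ContinuousLinearMap.norm_fst_le ..)).trans
        (hb1 a p hp.1.le hp.2.le)
    · rw [norm_smul]
      exact (mul_le_of_le_one_right (norm_nonneg _) (ContinuousLinearMap.norm_snd_le ..)).trans
        (hb2 a p hp.1.le hp.2.le)

end TriSeries

/-! ### Construction of the hodograph profile. -/

/-- `ρ(u, t)` is the radius of the sublevel set `{v ≤ u}` at height `t`, in the hodograph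
formulation of the Monge–Ampère equation for functions of `(|x'|, x_n)`; the other functions are
its first and second partial derivatives. -/
structure IsHodographProfile (n : ℕ) (q ε : ℝ) (ρ ρu ρt ρuu ρut ρtt : ℝ × ℝ → ℝ) : Prop where
  hasFDerivAt : ∀ p : ℝ × ℝ, 0 < p.1 → p.1 < 1 → |p.2| < 1 → HasFDerivAt ρ
    (ρu p • ContinuousLinearMap.fst ℝ ℝ ℝ + ρt p • ContinuousLinearMap.snd ℝ ℝ ℝ) p
  hasFDerivAt_u : ∀ p : ℝ × ℝ, 0 < p.1 → p.1 < 1 → |p.2| < 1 → HasFDerivAt ρu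
    (ρuu p • ContinuousLinearMap.fst ℝ ℝ ℝ + ρut p • ContinuousLinearMap.snd ℝ ℝ ℝ) p
  hasFDerivAt_t : ∀ p : ℝ × ℝ, 0 < p.1 → p.1 < 1 → |p.2| < 1 → HasFDerivAt ρt
    (ρut p • ContinuousLinearMap.fst ℝ ℝ ℝ + ρtt p • ContinuousLinearMap.snd ℝ ℝ ℝ) p
  det_eq : ∀ p : ℝ × ℝ, 0 < p.1 → p.1 < 1 → |p.2| < 1 →
    ρuu p * ρtt p - ρut p ^ 2 = ε * p.1 ^ q * ρu p ^ (n + 2) * ρ p ^ (n - 2)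
  uu_neg : ∀ p : ℝ × ℝ, 0 < p.1 → p.1 < 1 → |p.2| < 1 → ρuu p < 0
  half_le_u : ∀ p : ℝ × ℝ, 0 < p.1 → p.1 < 1 → |p.2| < 1 → 1 / 2 ≤ ρu p
  abs_t_le : ∀ p : ℝ × ℝ, 0 < p.1 → p.1 < 1 → |p.2| < 1 → |ρt p| ≤ 1
  lower : ∀ p : ℝ × ℝ, 0 < p.1 → p.1 < 1 → |p.2| < 1 → 1 / 2 + p.1 / 2 ≤ ρ p
  upper : ∀ p : ℝ × ℝ, 0 < p.1 → p.1 < 1 → |p.2| < 1 → ρ p ≤ 1 / 2 + p.1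
  surj : ∀ r t : ℝ, 1 / 2 < r → r < 1 → |t| < 1 → ∃ u, 0 < u ∧ u < 1 ∧ ρ (u, t) = r

namespace TriSeries

open MvPowerSeries

/-- Conjugation by `u^c` turns `θ` into `θ + c`. Up to elementary terms, `ρ`, `ρ_u` and `ρ_t` all
have this form, with `(A, c)` equal to `(1, β)`, `(β, q/2)` and `(0, β)`. -/
lemma hasFDerivAt_rpow_mul {q : ℝ} (hq : 0 < q) {g : TriSeries} (hg : wnorm g < ⊤) (A s c : ℝ)
    {p : ℝ × ℝ} (h0 : 0 < p.1) (h1 : p.1 < 1) (ht : |p.2| < 1) :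
    HasFDerivAt (fun p : ℝ × ℝ => p.1 ^ c * (A + s * ev q (tInt q 0 1 g) (Real.log p.1, p.2)))
      ((p.1 ^ (c - 1) * (c * A + s * ev q (tInt q 1 c g) (Real.log p.1, p.2)))
          • ContinuousLinearMap.fst ℝ ℝ ℝ
        + (p.1 ^ c * (s * ev q g (Real.log p.1, p.2))) • ContinuousLinearMap.snd ℝ ℝ ℝ) p := by
  have hz : Real.log p.1 < 0 := Real.log_neg h0 h1
  have hlog : HasFDerivAt (fun p : ℝ × ℝ => (Real.log p.1, p.2))
      ((p.1⁻¹ • ContinuousLinearMap.fst ℝ ℝ ℝ).prod (ContinuousLinearMap.snd ℝ ℝ ℝ)) p :=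
    HasFDerivAt.prodMk (hasFDerivAt_fst.log h0.ne') hasFDerivAt_snd
  have hev := (hasFDerivAt_ev_tInt hq hg (p := (Real.log p.1, p.2)) hz ht).comp p hlog
  have hpow : HasFDerivAt (fun p : ℝ × ℝ => p.1 ^ c)
      ((c * p.1 ^ (c - 1)) • ContinuousLinearMap.fst ℝ ℝ ℝ) p :=
    (Real.hasDerivAt_rpow_const (p := c) (Or.inl h0.ne')).comp_hasFDerivAt p
      (hasFDerivAt_fst (𝕜 := ℝ) (E := ℝ) (F := ℝ))
  refine (hpow.mul ((hev.const_mul s).const_add A)).congr_fderiv ?_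
  have hc : p.1 ^ c = p.1 ^ (c - 1) * p.1 := by
    rw [← Real.rpow_add_one h0.ne', sub_add_cancel]
  rw [ev_tInt_one hq hg c (p := (Real.log p.1, p.2)) hz.le ht.le]
  ext
  · simp [hc]
    field_simp
    ring
  · simp

end TriSeries

open TriSeries MvPowerSeries in
theorem exists_isHodographProfile (n : ℕ) {q : ℝ} (hq : 0 < q) :
    ∃ ε : ℝ, 0 < ε ∧ ∃ ρ ρu ρt ρuu ρut ρtt, IsHodographProfile n q ε ρ ρu ρt ρuu ρut ρtt := by
  set β : ℝ := 1 + q / 2 with hβ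
  -- Since `(θ + β) Z ≤ β + 1`, this choice gives `ρ_u ≥ 1 - k (β + 1) = 1/2`.
  set k : ℝ := 1 / (2 * (β + 1)) with hk
  -- The first bound keeps `Z` between `1/2` and `3/2`; the second preserves the sign of `(θ + β)(θ
  -- + q/2) Z`, hence `ρ_uu < 0`.
  set η : ℝ := min (1 / 2) (β * (q / 2) / 2) with hη
  have hβ1 : 1 < β := by rw [hβ]; linarith
  have hk0 : 0 < k := by positivity
  have hkβ : k * (β + 1) = 1 / 2 := by rw [hk]; field_simp
  have hk4 : k < 1 / 4 := by
    rw [hk, div_lt_div_iff₀ (by positivity) (by positivity)]; linarith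
  have hη0 : 0 < η := by rw [hη]; positivity
  have hη1 : η ≤ 1 / 2 := min_le_left _ _
  have hη2 : η ≤ β * (q / 2) / 2 := min_le_right _ _
  obtain ⟨s, hs, f, hfix, hf, hb1, hb2⟩ :=
    exists_hodographMap_eq n hq hk0.le (by linarith) hη0
  set P : TriSeries → TriSeries := tInt q 0 1 with hP
  have hPf : wnorm (P f) < ⊤ := wnorm_tInt_lt_top hq hf _ _
  have hIf : wnorm (tInt q 1 β f) < ⊤ := wnorm_tInt_lt_top hq hf _ _
  have hz : ∀ p : ℝ × ℝ, 0 < p.1 → p.1 ≤ 1 → Real.log p.1 ≤ 0 :=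
    fun p h0 h1 => Real.log_nonpos h0.le h1
  have bZ : ∀ p : ℝ × ℝ, 0 < p.1 → p.1 ≤ 1 → |p.2| ≤ 1 →
      |s * ev q (P (P f)) (Real.log p.1, p.2)| ≤ η := fun p h0 h1 ht =>
    abs_mul_ev_le hq (wnorm_tInt_lt_top hq hPf _ _) (p := (Real.log p.1, p.2)) (hz p h0 h1) ht hη0.le
      (hb2 _ _ _ _ le_rfl zero_le_one zero_le_one (by linarith) le_rfl zero_le_one zero_le_one
        (by linarith))
  have bT : ∀ p : ℝ × ℝ, 0 < p.1 → p.1 ≤ 1 → |p.2| ≤ 1 →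
      |s * ev q (tInt q 1 β (P f)) (Real.log p.1, p.2)| ≤ η := fun p h0 h1 ht =>
    abs_mul_ev_le hq (wnorm_tInt_lt_top hq hPf _ _) (p := (Real.log p.1, p.2)) (hz p h0 h1) ht hη0.le
      (hb2 _ _ _ _ zero_le_one le_rfl (by linarith) le_rfl le_rfl zero_le_one zero_le_one
        (by linarith))
  have bC : ∀ p : ℝ × ℝ, 0 < p.1 → p.1 ≤ 1 → |p.2| ≤ 1 →
      |s * ev q (tInt q 1 (q / 2) (tInt q 1 β f)) (Real.log p.1, p.2)| ≤ η := fun p h0 h1 ht =>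
    abs_mul_ev_le hq (wnorm_tInt_lt_top hq hIf _ _) (p := (Real.log p.1, p.2)) (hz p h0 h1) ht hη0.le
      (hb2 _ _ _ _ zero_le_one le_rfl (by linarith) (by linarith) zero_le_one le_rfl (by linarith)
        le_rfl)
  have bP : ∀ p : ℝ × ℝ, 0 < p.1 → p.1 ≤ 1 → |p.2| ≤ 1 →
      |s * ev q (P f) (Real.log p.1, p.2)| ≤ η := fun p h0 h1 ht =>
    abs_mul_ev_le hq hPf (p := (Real.log p.1, p.2)) (hz p h0 h1) ht hη0.le
      (hb1 _ _ le_rfl zero_le_one zero_le_one (by linarith))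
  have hpow1 : ∀ (p : ℝ × ℝ) (c : ℝ), 0 < p.1 → p.1 ≤ 1 → 0 ≤ c → p.1 ^ c ≤ 1 :=
    fun p c h0 h1 hc => Real.rpow_le_one h0.le h1 hc
  have hβq : ∀ p : ℝ × ℝ, 0 < p.1 → p.1 ^ β = p.1 * p.1 ^ (q / 2) := fun p h0 => by
    rw [hβ, Real.rpow_add h0, Real.rpow_one]
  set ρ : ℝ × ℝ → ℝ := fun p =>
    1 / 2 + p.1 - k * (p.1 ^ β * (1 + s * ev q (P (P f)) (Real.log p.1, p.2))) with hρ
  set ρu : ℝ × ℝ → ℝ := fun p =>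
    1 - k * (p.1 ^ (q / 2) * (β + s * ev q (P (tInt q 1 β f)) (Real.log p.1, p.2))) with hρu
  set ρt : ℝ × ℝ → ℝ := fun p =>
    -(k * (p.1 ^ β * (0 + s * ev q (P f) (Real.log p.1, p.2)))) with hρt
  set ρuu : ℝ × ℝ → ℝ := fun p => -(k * (p.1 ^ (q / 2 - 1) *
    (q / 2 * β + s * ev q (tInt q 1 (q / 2) (tInt q 1 β f)) (Real.log p.1, p.2)))) with hρuu
  set ρut : ℝ × ℝ → ℝ := fun p =>
    -(k * (p.1 ^ (q / 2) * (s * ev q (tInt q 1 β f) (Real.log p.1, p.2)))) with hρut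
  set ρtt : ℝ × ℝ → ℝ := fun p =>
    -(k * (p.1 ^ β * (s * ev q f (Real.log p.1, p.2)))) with hρtt
  have hcomm : P (tInt q 1 β f) = tInt q 1 β (P f) := tInt_comm _ _ _ _ _ _
  have hlow : ∀ p : ℝ × ℝ, 0 < p.1 → p.1 ≤ 1 → |p.2| ≤ 1 → 1 / 2 + p.1 / 2 < ρ p := by
    intro p h0 h1 ht
    have h2 := abs_le.1 (bZ p h0 h1 ht)
    have h3 := hpow1 p (q / 2) h0 h1 (by positivity)
    have h4 : 0 < p.1 ^ (q / 2) := Real.rpow_pos_of_pos h0 _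
    have h5 : k * (p.1 ^ (q / 2) * (1 + s * ev q (P (P f)) (Real.log p.1, p.2)))
        ≤ 1 / 4 * (1 * (3 / 2)) := by
      gcongr
      · nlinarith
      · linarith
      · linarith
    simp only [hρ]
    rw [hβq p h0]
    nlinarith
  refine ⟨k ^ 2 * s, by positivity, ρ, ρu, ρt, ρuu, ρut, ρtt, ?_, ?_, ?_, ?_, ?_, ?_, ?_, ?_, ?_, ?_⟩
  · intro p h0 h1 ht
    have h := (hasFDerivAt_rpow_mul hq hPf 1 s β h0 h1 ht).const_mul k
    have h' := ((hasFDerivAt_fst (𝕜 := ℝ) (E := ℝ) (F := ℝ) (p := p)).const_add (1 / 2)).sub h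
    refine h'.congr_fderiv ?_
    have hb : β - 1 = q / 2 := by rw [hβ]; ring
    ext
    · simp [hρu, hb, hcomm]
    · simp [hρt]
  · intro p h0 h1 ht
    have h := ((hasFDerivAt_rpow_mul hq hIf β s (q / 2) h0 h1 ht).const_mul k).const_sub 1
    refine h.congr_fderiv ?_
    ext
    · simp [hρuu]
    · simp [hρut]
  · intro p h0 h1 ht
    have h := ((hasFDerivAt_rpow_mul hq hf 0 s β h0 h1 ht).const_mul k).neg
    refine h.congr_fderiv ?_
    have hb : β - 1 = q / 2 := by rw [hβ]; ring
    ext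
    · simp [hρut, hb]
    · simp [hρtt]
  · intro p h0 h1 ht
    have hzp : (Real.log p.1, p.2).1 ≤ 0 := hz p h0 h1.le
    have htp : |(Real.log p.1, p.2).2| ≤ 1 := ht.le
    -- Evaluation respects sums and products, so the formal fixed-point identity can be read off at
    -- `(log u, t)`; the factor `u^q` then comes from `u^(q/2-1) u^β = u^(q/2) u^(q/2)`.
    have hvf : HasValue q (Real.log p.1, p.2) f (ev q f (Real.log p.1, p.2)) := ⟨hf, rfl⟩
    have hvP := hvf.tInt hq 0 1
    have hvI := hvf.tInt hq 1 β
    have hvPP := hvP.tInt hq 0 1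
    have hvT := hvP.tInt hq 1 β
    have hvC := (hvf.tInt hq 1 (q / 2)).tInt hq 1 β
    have hZ := hasValue_one.add hq hzp htp ((hasValue_C s).mul hq hzp htp hvPP)
    have hT := (hasValue_C β).add hq hzp htp ((hasValue_C s).mul hq hzp htp hvT)
    have hk1 := (hasValue_C (q := q) (p := (Real.log p.1, p.2)) k)
    have hS := ((hasValue_one.sub hq hzp htp ((hk1.mul hq hzp htp hasValue_X_two).mul hq hzp htp
      hT)).pow hq hzp htp (n + 2)).mul hq hzp htp
      ((((hasValue_C (1 / 2)).add hq hzp htp hasValue_X_one).sub hq hzp htp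
        (((hk1.mul hq hzp htp hasValue_X_one).mul hq hzp htp hasValue_X_two).mul hq hzp htp
          hZ)).pow hq hzp htp (n - 2))
    have hG := (hasValue_C ((β * (q / 2))⁻¹)).mul hq hzp htp
      ((hS.add hq hzp htp ((hasValue_C s).mul hq hzp htp (hvI.pow hq hzp htp 2))).sub hq hzp htp
        (((hasValue_C s).mul hq hzp htp hvf).mul hq hzp htp hvC))
    have heq := hG.ev_eq
    have hfix' : C ((β * (q / 2))⁻¹) * (source n q k s f + C s * tInt q 1 β f ^ 2
      - C s * f * tInt q 1 β (tInt q 1 (q / 2) f)) = f := hfix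
    unfold source profile profileTheta at hfix'
    rw [← hβ] at hfix'
    rw [hfix'] at heq
    rw [tInt_comm q 1 β 1 (q / 2) f] at heq
    have hexp : Real.exp (Real.log p.1) = p.1 := Real.exp_log h0
    have hexp2 : Real.exp (q / 2 * Real.log p.1) = p.1 ^ (q / 2) := by
      rw [Real.rpow_def_of_pos h0, mul_comm]
    simp only [hexp, hexp2] at heq
    have hβ0 : β * (q / 2) ≠ 0 := by positivity
    have hρueq : ρu p = 1 - k * p.1 ^ (q / 2) *
        (β + s * ev q (tInt q 1 β (tInt q 0 1 f)) (Real.log p.1, p.2)) := by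
      simp only [hρu, hcomm]; ring
    have hρeq : ρ p = 1 / 2 + p.1 - k * p.1 * p.1 ^ (q / 2) *
        (1 + s * ev q (tInt q 0 1 (tInt q 0 1 f)) (Real.log p.1, p.2)) := by
      simp only [hρ, hβq p h0]; ring
    rw [← hρueq, ← hρeq, eq_inv_mul_iff_mul_eq₀ hβ0] at heq
    have h1' : p.1 ^ (q / 2 - 1) * p.1 ^ β = p.1 ^ q := by
      rw [← Real.rpow_add h0]; congr 1; rw [hβ]; ring
    have h2' : p.1 ^ (q / 2) * p.1 ^ (q / 2) = p.1 ^ q := by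
      rw [← Real.rpow_add h0]; congr 1; ring
    simp only [hρuu, hρut, hρtt]
    set x := ev q f (Real.log p.1, p.2)
    set B := ev q (tInt q 1 β f) (Real.log p.1, p.2)
    set c := ev q (tInt q 1 (q / 2) (tInt q 1 β f)) (Real.log p.1, p.2)
    calc _ = k ^ 2 * s * ((p.1 ^ (q / 2 - 1) * p.1 ^ β) * ((q / 2 * β + s * c) * x)
          - (p.1 ^ (q / 2) * p.1 ^ (q / 2)) * (s * B ^ 2)) := by ring
      _ = k ^ 2 * s * p.1 ^ q * (β * (q / 2) * x + s * x * c - s * B ^ 2) := by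
        rw [h1', h2']; ring
      _ = _ := by rw [heq]; ring
  · intro p h0 h1 ht
    have h2 := abs_le.1 (bC p h0 h1.le ht.le)
    have h4 : 0 < p.1 ^ (q / 2 - 1) := Real.rpow_pos_of_pos h0 _
    have h5 : 0 < β * (q / 2) := by positivity
    simp only [hρuu, neg_lt_zero]
    refine mul_pos hk0 (mul_pos h4 ?_)
    linarith
  · intro p h0 h1 ht
    have h2 := abs_le.1 (bT p h0 h1.le ht.le)
    have h3 := hpow1 p (q / 2) h0 h1.le (by positivity)
    have h4 : 0 < p.1 ^ (q / 2) := Real.rpow_pos_of_pos h0 _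
    have h5 : k * (p.1 ^ (q / 2) * (β + s * ev q (tInt q 1 β (P f)) (Real.log p.1, p.2)))
        ≤ k * (1 * (β + 1)) := by
      gcongr
      · linarith
      · linarith
    simp only [hρu, hcomm]
    linarith
  · intro p h0 h1 ht
    have h2 := bP p h0 h1.le ht.le
    have h3 := hpow1 p β h0 h1.le (by positivity)
    have h4 : 0 < p.1 ^ β := Real.rpow_pos_of_pos h0 _
    simp only [hρt]
    rw [abs_neg, abs_mul, abs_mul, abs_of_pos hk0, abs_of_pos h4, zero_add]
    calc k * (p.1 ^ β * |s * ev q (P f) (Real.log p.1, p.2)|) ≤ 1 * (1 * 1) := by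
          gcongr <;> linarith
      _ = 1 := by norm_num
  · exact fun p h0 h1 ht => (hlow p h0 h1.le ht.le).le
  · intro p h0 h1 ht
    have h2 := abs_le.1 (bZ p h0 h1.le ht.le)
    have h4 : 0 < p.1 ^ β := Real.rpow_pos_of_pos h0 _
    have : 0 ≤ k * (p.1 ^ β * (1 + s * ev q (P (P f)) (Real.log p.1, p.2))) :=
      mul_nonneg hk0.le (mul_nonneg h4.le (by linarith))
    simp only [hρ]
    linarith
  · intro r t hr1 hr2 ht
    have hcont : ContinuousOn (fun u => ρ (u, t)) (Icc (r - 1 / 2) 1) := by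
      have hne : ∀ u ∈ Icc (r - 1 / 2) 1, u ≠ 0 := fun u hu => by linarith [hu.1]
      have hlogc : ContinuousOn (fun u : ℝ => (Real.log u, t)) (Icc (r - 1 / 2) 1) :=
        (continuousOn_id.log hne).prodMk continuousOn_const
      have hev : ContinuousOn (fun u : ℝ => ev q (P (P f)) (Real.log u, t)) (Icc (r - 1 / 2) 1) :=
        (continuousOn_ev hq (wnorm_tInt_lt_top hq hPf _ _)).comp hlogc fun u hu =>
          ⟨Real.log_nonpos (by linarith [hu.1]) hu.2, ht.le⟩
      have hpw : ContinuousOn (fun u : ℝ => u ^ β) (Icc (r - 1 / 2) 1) :=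
        continuousOn_id.rpow_const fun u hu => Or.inl (hne u hu)
      simp only [hρ]
      fun_prop
    -- Intermediate values on `[r - 1/2, 1]`: the upper bound gives `ρ ≤ r` at the left end, the
    -- lower bound `ρ > 1 > r` at the right end.
    have hle : r - 1 / 2 ≤ 1 := by linarith
    have hlo : ρ (r - 1 / 2, t) ≤ r := by
      have h2 := abs_le.1 (bZ (r - 1 / 2, t) (by simp; linarith) hle ht.le)
      have h4 : 0 < (r - 1 / 2) ^ β := Real.rpow_pos_of_pos (by linarith) _
      have : 0 ≤ k * ((r - 1 / 2) ^ β * (1 + s * ev q (P (P f)) (Real.log (r - 1 / 2), t))) :=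
        mul_nonneg hk0.le (mul_nonneg h4.le (by linarith))
      simp only [hρ]
      linarith
    have hhi : 1 < ρ (1, t) := by
      have := hlow (1, t) one_pos le_rfl ht.le
      norm_num at this
      exact this
    obtain ⟨u, hu, hur⟩ := intermediate_value_Icc hle hcont ⟨hlo, (hr2.trans hhi).le⟩
    refine ⟨u, by linarith [hu.1], lt_of_le_of_ne hu.2 ?_, hur⟩
    rintro rfl
    simp only at hur
    linarith

/-! ### Monotonicity and concavity of the profile, and inversion in `u`. -/

namespace IsHodographProfile

variable {n : ℕ} {q ε : ℝ} {ρ ρu ρt ρuu ρut ρtt : ℝ × ℝ → ℝ}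

lemma hasDerivAt_u (H : IsHodographProfile n q ε ρ ρu ρt ρuu ρut ρtt) {u t : ℝ} (h0 : 0 < u)
    (h1 : u < 1) (ht : |t| < 1) : HasDerivAt (fun u => ρ (u, t)) (ρu (u, t)) u := by
  exact ((H.hasFDerivAt (u, t) h0 h1 ht).comp_hasDerivAt u
    ((hasDerivAt_id u).prodMk (hasDerivAt_const u t))).congr_deriv (by simp)

lemma hasDerivAt_t (H : IsHodographProfile n q ε ρ ρu ρt ρuu ρut ρtt) {u t : ℝ} (h0 : 0 < u)
    (h1 : u < 1) (ht : |t| < 1) : HasDerivAt (fun t => ρ (u, t)) (ρt (u, t)) t := by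
  exact ((H.hasFDerivAt (u, t) h0 h1 ht).comp_hasDerivAt t
    ((hasDerivAt_const t u).prodMk (hasDerivAt_id t))).congr_deriv (by simp)

lemma half_mul_sub_le (H : IsHodographProfile n q ε ρ ρu ρt ρuu ρut ρtt) {u u' t : ℝ}
    (h0 : 0 < u) (hu : u ≤ u') (h1 : u' < 1) (ht : |t| < 1) :
    1 / 2 * (u' - u) ≤ ρ (u', t) - ρ (u, t) := by
  have hd : ∀ w ∈ Icc u u', HasDerivAt (fun u => ρ (u, t)) (ρu (w, t)) w := fun w hw =>
    H.hasDerivAt_u (h0.trans_le hw.1) (hw.2.trans_lt h1) ht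
  refine (convex_Icc u u').mul_sub_le_image_sub_of_le_deriv (f := fun u => ρ (u, t))
    (fun w hw => (hd w hw).continuousAt.continuousWithinAt)
    (fun w hw => (hd w (interior_subset hw)).differentiableAt.differentiableWithinAt)
    (fun w hw => ?_) u (left_mem_Icc.2 hu) u' (right_mem_Icc.2 hu) hu
  have hw' := interior_subset hw
  rw [(hd w hw').deriv]
  exact H.half_le_u (w, t) (h0.trans_le hw'.1) (hw'.2.trans_lt h1) ht

lemma le_of_le (H : IsHodographProfile n q ε ρ ρu ρt ρuu ρut ρtt) {u u' t : ℝ}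
    (h0 : 0 < u) (hu : u ≤ u') (h1 : u' < 1) (ht : |t| < 1) : ρ (u, t) ≤ ρ (u', t) := by
  linarith [H.half_mul_sub_le h0 hu h1 ht]

lemma lt_of_lt (H : IsHodographProfile n q ε ρ ρu ρt ρuu ρut ρtt) {u u' t : ℝ}
    (h0 : 0 < u) (hu : u < u') (h1 : u' < 1) (ht : |t| < 1) : ρ (u, t) < ρ (u', t) := by
  linarith [H.half_mul_sub_le h0 hu.le h1 ht]

lemma abs_sub_le (H : IsHodographProfile n q ε ρ ρu ρt ρuu ρut ρtt) {u t t' : ℝ}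
    (h0 : 0 < u) (h1 : u < 1) (ht : |t| < 1) (ht' : |t'| < 1) :
    |ρ (u, t) - ρ (u, t')| ≤ |t - t'| := by
  have := (convex_Ioo (-1 : ℝ) 1).norm_image_sub_le_of_norm_hasDerivWithin_le
    (f := fun t => ρ (u, t)) (f' := fun t => ρt (u, t)) (C := 1) (x := t') (y := t)
    (fun w hw => (H.hasDerivAt_t h0 h1 (abs_lt.2 hw)).hasDerivWithinAt)
    (fun w hw => H.abs_t_le (u, w) h0 h1 (abs_lt.2 hw)) (abs_lt.1 ht') (abs_lt.1 ht)
  simpa using this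

lemma concaveOn (H : IsHodographProfile n q ε ρ ρu ρt ρuu ρut ρtt) (hε : 0 < ε) :
    ConcaveOn ℝ (Ioo 0 1 ×ˢ Ioo (-1) 1) ρ := by
  have hconv : Convex ℝ (Ioo (0 : ℝ) 1 ×ˢ Ioo (-1 : ℝ) 1) := (convex_Ioo _ _).prod (convex_Ioo _ _)
  refine ⟨hconv, fun p hp p' hp' a b ha hb hab => ?_⟩
  set d := p' - p with hd
  have hmem : ∀ s ∈ Icc (0 : ℝ) 1, p + s • d ∈ Ioo (0 : ℝ) 1 ×ˢ Ioo (-1 : ℝ) 1 := fun s hs =>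
    hconv.add_smul_sub_mem hp hp' hs
  have hline : ∀ s : ℝ, HasDerivAt (fun s : ℝ => p + s • d) d s := fun s => by
    simpa using ((hasDerivAt_id s).smul_const d).const_add p
  have hc : ConcaveOn ℝ (Icc (0 : ℝ) 1) (fun s => ρ (p + s • d)) := by
    have h1 : ∀ s ∈ Icc (0 : ℝ) 1, HasDerivAt (fun s => ρ (p + s • d))
        (ρu (p + s • d) * d.1 + ρt (p + s • d) * d.2) s := by
      intro s hs
      have hm := hmem s hs
      exact ((H.hasFDerivAt _ hm.1.1 hm.1.2 (abs_lt.2 hm.2)).comp_hasDerivAt s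
        (hline s)).congr_deriv (by simp)
    refine concaveOn_of_hasDerivWithinAt2_nonpos (convex_Icc _ _)
      (f' := fun s => ρu (p + s • d) * d.1 + ρt (p + s • d) * d.2)
      (f'' := fun s => (ρuu (p + s • d) * d.1 + ρut (p + s • d) * d.2) * d.1
        + (ρut (p + s • d) * d.1 + ρtt (p + s • d) * d.2) * d.2)
      (fun s hs => (h1 s hs).continuousAt.continuousWithinAt)
      (fun s hs => (h1 s (interior_subset hs)).hasDerivWithinAt) ?_ ?_
    · intro s hs
      have hm := hmem s (interior_subset hs)
      have e1 := (H.hasFDerivAt_u _ hm.1.1 hm.1.2 (abs_lt.2 hm.2)).comp_hasDerivAt s (hline s)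
      have e2 := (H.hasFDerivAt_t _ hm.1.1 hm.1.2 (abs_lt.2 hm.2)).comp_hasDerivAt s (hline s)
      have := (e1.mul_const d.1).add (e2.mul_const d.2)
      simp at this
      exact this.hasDerivWithinAt
    · intro s hs
      have hm := hmem s (interior_subset hs)
      have hdet := H.det_eq _ hm.1.1 hm.1.2 (abs_lt.2 hm.2)
      have huu := H.uu_neg _ hm.1.1 hm.1.2 (abs_lt.2 hm.2)
      have hu := H.half_le_u _ hm.1.1 hm.1.2 (abs_lt.2 hm.2)
      have hlo := H.lower _ hm.1.1 hm.1.2 (abs_lt.2 hm.2)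
      have h0 := hm.1.1
      generalize p + s • d = z at *
      have hpos : 0 ≤ ρuu z * ρtt z - ρut z ^ 2 := by
        rw [hdet]
        have : 0 < ρ z := by linarith
        have : 0 < ρu z := by linarith
        have := Real.rpow_pos_of_pos h0 q
        positivity
      set A := ρuu z
      set B := ρut z
      set C := ρtt z
      -- Completing the square after multiplication by `ρ_uu < 0` shows that the Hessian is
      -- nonpositive.
      have h2 : 0 ≤ A * ((A * d.1 + B * d.2) * d.1 + (B * d.1 + C * d.2) * d.2) := by
        have : A * ((A * d.1 + B * d.2) * d.1 + (B * d.1 + C * d.2) * d.2)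
            = (A * d.1 + B * d.2) ^ 2 + (A * C - B ^ 2) * d.2 ^ 2 := by ring
        rw [this]
        positivity
      exact nonpos_of_mul_nonneg_right h2 huu
  have := hc.2 (left_mem_Icc.2 zero_le_one) (right_mem_Icc.2 zero_le_one) ha hb hab
  have e : a • p + b • p' = p + b • d := by
    rw [hd, eq_sub_of_add_eq hab]; module
  simp only [zero_smul, add_zero, one_smul, smul_eq_mul, mul_zero, mul_one, zero_add] at this
  rw [e]
  simpa [hd] using this

end IsHodographProfile

/-- The value of the level `u` with `ρ(u, t) = r`; `0` if there is none. -/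
def hodographInv (ρ : ℝ × ℝ → ℝ) (r t : ℝ) : ℝ :=
  open Classical in
  if h : ∃ u, 0 < u ∧ u < 1 ∧ ρ (u, t) = r then h.choose else 0

namespace IsHodographProfile

variable {n : ℕ} {q ε : ℝ} {ρ ρu ρt ρuu ρut ρtt : ℝ × ℝ → ℝ}

lemma inv_eq_zero (H : IsHodographProfile n q ε ρ ρu ρt ρuu ρut ρtt) {r t : ℝ} (hr : r ≤ 1 / 2)
    (ht : |t| < 1) : hodographInv ρ r t = 0 := by
  unfold hodographInv
  rw [dif_neg]
  rintro ⟨u, h0, h1, h⟩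
  have := H.lower (u, t) h0 h1 ht
  simp only at this
  linarith

lemma inv_spec (H : IsHodographProfile n q ε ρ ρu ρt ρuu ρut ρtt) {r t : ℝ} (hr : 1 / 2 < r)
    (hr1 : r < 1) (ht : |t| < 1) : 0 < hodographInv ρ r t ∧ hodographInv ρ r t < 1 ∧
      ρ (hodographInv ρ r t, t) = r := by
  unfold hodographInv
  rw [dif_pos (H.surj r t hr hr1 ht)]
  exact (H.surj r t hr hr1 ht).choose_spec

lemma inv_nonneg (H : IsHodographProfile n q ε ρ ρu ρt ρuu ρut ρtt) {r t : ℝ} (hr1 : r < 1)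
    (ht : |t| < 1) : 0 ≤ hodographInv ρ r t := by
  rcases le_or_gt r (1 / 2) with h | h
  · exact (H.inv_eq_zero h ht).ge
  · exact (H.inv_spec h hr1 ht).1.le

lemma inv_lt_one (H : IsHodographProfile n q ε ρ ρu ρt ρuu ρut ρtt) {r t : ℝ} (hr1 : r < 1)
    (ht : |t| < 1) : hodographInv ρ r t < 1 := by
  rcases le_or_gt r (1 / 2) with h | h
  · rw [H.inv_eq_zero h ht]; exact one_pos
  · exact (H.inv_spec h hr1 ht).2.1

/-- Valid also for `r ≤ 1/2`, so the epigraph at positive levels is given by one inequality, inside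
and outside the cylinder. Level `0` is excluded because `ρ` is controlled only for `u > 0`. -/
lemma inv_le_iff (H : IsHodographProfile n q ε ρ ρu ρt ρuu ρut ρtt) {r t δ : ℝ} (hr1 : r < 1)
    (ht : |t| < 1) (h0 : 0 < δ) (h1 : δ < 1) : hodographInv ρ r t ≤ δ ↔ r ≤ ρ (δ, t) := by
  rcases le_or_gt r (1 / 2) with h | h
  · rw [H.inv_eq_zero h ht]
    have := H.lower (δ, t) h0 h1 ht
    simp only at this
    exact ⟨fun _ => by linarith, fun _ => h0.le⟩
  · obtain ⟨hu0, hu1, hu⟩ := H.inv_spec h hr1 ht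
    constructor
    · intro hle
      exact hu.ge.trans (H.le_of_le hu0 hle h1 ht)
    · intro hle
      by_contra hlt
      have := H.lt_of_lt h0 (not_le.1 hlt) hu1 ht
      rw [hu] at this
      linarith

lemma sub_le_inv (H : IsHodographProfile n q ε ρ ρu ρt ρuu ρut ρtt) {r t : ℝ} (hr1 : r < 1)
    (ht : |t| < 1) : r - 1 / 2 ≤ hodographInv ρ r t := by
  rcases le_or_gt r (1 / 2) with h | h
  · rw [H.inv_eq_zero h ht]; linarith
  · obtain ⟨hu0, hu1, hu⟩ := H.inv_spec h hr1 ht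
    have := H.upper (hodographInv ρ r t, t) hu0 hu1 ht
    simp only at this
    linarith

/-- If the levels `g > g'` are positive, then `(g - g') / 2 ≤ ρ(g, t) - ρ(g', t) ≤ |r - r'| + |t -
t'|`, from `ρ_u ≥ 1/2` and `|ρ_t| ≤ 1`. -/
lemma inv_sub_le (H : IsHodographProfile n q ε ρ ρu ρt ρuu ρut ρtt) {r t r' t' : ℝ} (hr1 : r < 1)
    (ht : |t| < 1) (hr1' : r' < 1) (ht' : |t'| < 1) :
    hodographInv ρ r t - hodographInv ρ r' t' ≤ 2 * |r - r'| + 2 * |t - t'| := by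
  rcases le_or_gt r (1 / 2) with h | h
  · rw [H.inv_eq_zero h ht]
    have := H.inv_nonneg hr1' ht'
    have := abs_nonneg (r - r')
    have := abs_nonneg (t - t')
    linarith
  obtain ⟨hu0, hu1, hu⟩ := H.inv_spec h hr1 ht
  rcases le_or_gt r' (1 / 2) with h' | h'
  · rw [H.inv_eq_zero h' ht']
    have := H.lower (hodographInv ρ r t, t) hu0 hu1 ht
    simp only at this
    have := le_abs_self (r - r')
    have := abs_nonneg (t - t')
    linarith
  · obtain ⟨hu0', hu1', hu'⟩ := H.inv_spec h' hr1' ht'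
    set g := hodographInv ρ r t
    set g' := hodographInv ρ r' t'
    rcases le_or_gt g g' with hg | hg
    · have := abs_nonneg (r - r')
      have := abs_nonneg (t - t')
      linarith
    · have h1 := H.half_mul_sub_le hu0' hg.le hu1 ht
      have h2 := (abs_le.1 (H.abs_sub_le hu0' hu1' ht ht')).1
      have h3 := le_abs_self (r - r')
      linarith

end IsHodographProfile

/-- A rank two perturbation of a multiple of the identity. -/
lemma det_smul_id_add_smulRight {n : ℕ} (hn : 2 ≤ n) {a : ℝ} (ha : a ≠ 0)
    (α γ : EuclideanSpace ℝ (Fin n) →L[ℝ] ℝ) (p e : EuclideanSpace ℝ (Fin n)) :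
    (a • ContinuousLinearMap.id ℝ (EuclideanSpace ℝ (Fin n)) + α.smulRight p
      + γ.smulRight e).det = a ^ (n - 2) * ((a + α p) * (a + γ e) - α e * γ p) := by
  set b := (EuclideanSpace.basisFun (Fin n) ℝ).toBasis with hb
  set U : Matrix (Fin n) (Fin 2) ℝ := Matrix.of fun i j => ![p i, e i] j with hU
  set V : Matrix (Fin 2) (Fin n) ℝ := Matrix.of fun j i =>
    ![α (EuclideanSpace.single i 1), γ (EuclideanSpace.single i 1)] j with hV
  have hmat : LinearMap.toMatrix b b ((a • ContinuousLinearMap.id ℝ (EuclideanSpace ℝ (Fin n))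
      + α.smulRight p + γ.smulRight e : EuclideanSpace ℝ (Fin n) →L[ℝ] EuclideanSpace ℝ (Fin n))
        : EuclideanSpace ℝ (Fin n) →ₗ[ℝ] EuclideanSpace ℝ (Fin n))
      = a • (1 + (a⁻¹ • U) * V) := by
    ext i j
    simp [LinearMap.toMatrix_apply, hb, Matrix.mul_apply, hU, hV, Fin.sum_univ_two,
      Matrix.one_apply, mul_add]
    field_simp
    ring
  have hsum : ∀ (φ : EuclideanSpace ℝ (Fin n) →L[ℝ] ℝ) (x : EuclideanSpace ℝ (Fin n)),
      ∑ i, φ (EuclideanSpace.single i 1) * x i = φ x := by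
    intro φ x
    conv_rhs => rw [← (EuclideanSpace.basisFun (Fin n) ℝ).sum_repr x]
    simp [mul_comm]
  -- The identity `det (1 + U V) = det (1 + V U)` reduces the computation to a `2 × 2` determinant.
  rw [ContinuousLinearMap.det, ← LinearMap.det_toMatrix b, hmat, Matrix.det_smul,
    Matrix.det_one_add_mul_comm, Matrix.det_fin_two, Fintype.card_fin]
  have e1 : ∀ (φ : EuclideanSpace ℝ (Fin n) →L[ℝ] ℝ) (x : EuclideanSpace ℝ (Fin n)),
      ∑ i, φ (EuclideanSpace.single i 1) * (a⁻¹ * x i) = a⁻¹ * φ x := by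
    intro φ x
    rw [← hsum φ x, Finset.mul_sum]
    exact Finset.sum_congr rfl fun i _ => by ring
  simp [Matrix.mul_apply, hU, hV, e1]
  have hpow : a ^ n = a ^ (n - 2) * a ^ 2 := by rw [← pow_add]; congr 1; omega
  rw [hpow]
  field_simp

/-! ### Calculus of `|x'|`. -/

section geometry

variable {n : ℕ}

/-- The projection `x ↦ (x', 0)`, where `l` is the last index. -/
def primeProj (l : Fin n) : EuclideanSpace ℝ (Fin n) →L[ℝ] EuclideanSpace ℝ (Fin n) :=
  ContinuousLinearMap.id ℝ _
    - (EuclideanSpace.proj l : EuclideanSpace ℝ (Fin n) →L[ℝ] ℝ).smulRight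
        (EuclideanSpace.single l (1 : ℝ))

lemma primeProj_apply (l : Fin n) (x : EuclideanSpace ℝ (Fin n)) :
    primeProj l x = x - x l • EuclideanSpace.single l 1 := by
  simp [primeProj]

lemma primeProj_apply_apply (l i : Fin n) (x : EuclideanSpace ℝ (Fin n)) :
    primeProj l x i = if i = l then 0 else x i := by
  rw [primeProj_apply]
  simp
  split_ifs with h
  · simp [h]
  · simp

lemma norm_primeProj (l : Fin n) (hl : (l : ℕ) + 1 = n) (x : EuclideanSpace ℝ (Fin n)) :
    ‖primeProj l x‖ = primeNorm x := by
  rw [EuclideanSpace.norm_eq, primeNorm, Finset.sum_filter]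
  congr 1
  refine Finset.sum_congr rfl fun i _ => ?_
  rw [primeProj_apply_apply, Real.norm_eq_abs, sq_abs]
  have : i = l ↔ ¬ ((i : ℕ) + 1 < n) := by
    rw [Fin.ext_iff]; have := i.2; omega
  by_cases h : i = l
  · rw [if_pos h, if_neg (this.1 h)]; simp
  · rw [if_neg h, if_pos (by_contra fun h' => h (this.2 h'))]

lemma inner_primeProj (l : Fin n) (x h : EuclideanSpace ℝ (Fin n)) :
    inner ℝ (primeProj l x) (primeProj l h) = inner ℝ (primeProj l x) h := by
  rw [primeProj_apply l h, inner_sub_right, inner_smul_right, EuclideanSpace.inner_single_right]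
  simp [primeProj_apply_apply]

lemma primeNorm_sq_add_sq (l : Fin n) (hl : (l : ℕ) + 1 = n) (x : EuclideanSpace ℝ (Fin n)) :
    primeNorm x ^ 2 + x l ^ 2 = ‖x‖ ^ 2 := by
  rw [← norm_primeProj l hl, EuclideanSpace.norm_sq_eq, EuclideanSpace.norm_sq_eq,
    ← Finset.add_sum_erase _ _ (Finset.mem_univ l),
    ← Finset.add_sum_erase _ (fun i => ‖x i‖ ^ 2) (Finset.mem_univ l)]
  rw [primeProj_apply_apply, if_pos rfl, Real.norm_eq_abs (x l), sq_abs]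
  have : ∑ i ∈ Finset.univ.erase l, ‖primeProj l x i‖ ^ 2
      = ∑ i ∈ Finset.univ.erase l, ‖x i‖ ^ 2 := by
    refine Finset.sum_congr rfl fun i hi => ?_
    rw [primeProj_apply_apply, if_neg (Finset.ne_of_mem_erase hi)]
  rw [this]
  simp

lemma primeNorm_nonneg (x : EuclideanSpace ℝ (Fin n)) : 0 ≤ primeNorm x := Real.sqrt_nonneg _

lemma primeNorm_le_norm (l : Fin n) (hl : (l : ℕ) + 1 = n) (x : EuclideanSpace ℝ (Fin n)) :
    primeNorm x ≤ ‖x‖ := by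
  refine abs_le_of_sq_le_sq' ?_ (norm_nonneg _) |>.2
  have := primeNorm_sq_add_sq l hl x
  nlinarith [sq_nonneg (x l)]

lemma primeNorm_lt_one (l : Fin n) (hl : (l : ℕ) + 1 = n) {x : EuclideanSpace ℝ (Fin n)}
    (hx : x ∈ Metric.ball 0 1) : primeNorm x < 1 :=
  (primeNorm_le_norm l hl x).trans_lt (by simpa using hx)

lemma abs_apply_lt_one (l : Fin n) {x : EuclideanSpace ℝ (Fin n)}
    (hx : x ∈ Metric.ball 0 1) : |x l| < 1 :=
  (PiLp.norm_apply_le x l).trans_lt (by simpa using hx)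

lemma abs_primeNorm_sub_le (l : Fin n) (hl : (l : ℕ) + 1 = n) (x y : EuclideanSpace ℝ (Fin n)) :
    |primeNorm x - primeNorm y| ≤ ‖x - y‖ := by
  rw [← norm_primeProj l hl, ← norm_primeProj l hl]
  refine (abs_norm_sub_norm_le _ _).trans ?_
  rw [← map_sub, norm_primeProj l hl]
  exact primeNorm_le_norm l hl _

lemma primeNorm_add_smul_le (l : Fin n) (hl : (l : ℕ) + 1 = n) (x y : EuclideanSpace ℝ (Fin n))
    {a b : ℝ} (ha : 0 ≤ a) (hb : 0 ≤ b) :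
    primeNorm (a • x + b • y) ≤ a * primeNorm x + b * primeNorm y := by
  simp only [← norm_primeProj l hl]
  rw [map_add, map_smul, map_smul]
  refine (norm_add_le _ _).trans ?_
  rw [norm_smul, norm_smul, Real.norm_of_nonneg ha, Real.norm_of_nonneg hb]

lemma continuous_primeNorm : Continuous (primeNorm (n := n)) := by
  unfold primeNorm
  fun_prop

lemma hasFDerivAt_primeNorm (l : Fin n) (hl : (l : ℕ) + 1 = n) {x : EuclideanSpace ℝ (Fin n)}
    (hx : 0 < primeNorm x) : HasFDerivAt (primeNorm (n := n))
      ((primeNorm x)⁻¹ • innerSL ℝ (primeProj l x)) x := by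
  have h1 : HasFDerivAt (fun y => ‖primeProj l y‖ ^ 2)
      (2 • (innerSL ℝ (primeProj l x)).comp (primeProj l)) x :=
    (primeProj l).hasFDerivAt.norm_sq
  have hne : ‖primeProj l x‖ ^ 2 ≠ 0 := by
    rw [norm_primeProj l hl]; positivity
  have h2 := h1.sqrt hne
  have : (fun y => Real.sqrt (‖primeProj l y‖ ^ 2)) = primeNorm (n := n) := by
    ext y; rw [Real.sqrt_sq (norm_nonneg _), norm_primeProj l hl]
  rw [this] at h2
  refine h2.congr_fderiv ?_
  ext h
  rw [norm_primeProj l hl, Real.sqrt_sq hx.le]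
  simp only [smul_apply, innerSL_apply_apply, smul_eq_mul,
    ContinuousLinearMap.comp_apply, nsmul_eq_mul, Nat.cast_ofNat, inner_primeProj]
  field_simp

end geometry

/-- The function whose sublevel set `{v ≤ u}` is `{|x'| ≤ ρ(u, x_n)}`. -/
def hodographSol {n : ℕ} (ρ : ℝ × ℝ → ℝ) (l : Fin n) (x : EuclideanSpace ℝ (Fin n)) : ℝ :=
  hodographInv ρ (primeNorm x) (x l)

/-- The gradient of `hodographSol` outside of the cylinder. -/
def hodographGrad {n : ℕ} (ρ ρu ρt : ℝ × ℝ → ℝ) (l : Fin n) (x : EuclideanSpace ℝ (Fin n)) :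
    EuclideanSpace ℝ (Fin n) :=
  (ρu (hodographSol ρ l x, x l) * primeNorm x)⁻¹ • primeProj l x
    + (-(ρt (hodographSol ρ l x, x l) * (ρu (hodographSol ρ l x, x l))⁻¹))
      • EuclideanSpace.single l (1 : ℝ)

/-! ### The solution before scaling: convexity, gradient, Hessian determinant. -/

namespace IsHodographProfile

variable {n : ℕ} {q ε : ℝ} {ρ ρu ρt ρuu ρut ρtt : ℝ × ℝ → ℝ} {l : Fin n}
  {x y : EuclideanSpace ℝ (Fin n)}

lemma abs_sol_sub_le (H : IsHodographProfile n q ε ρ ρu ρt ρuu ρut ρtt) (hl : (l : ℕ) + 1 = n)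
    (hx : x ∈ Metric.ball 0 1) (hy : y ∈ Metric.ball 0 1) :
    |hodographSol ρ l x - hodographSol ρ l y| ≤ 4 * ‖x - y‖ := by
  have hr := abs_primeNorm_sub_le l hl x y
  have ht : |x l - y l| ≤ ‖x - y‖ := PiLp.norm_apply_le (x - y) l
  have h1 := H.inv_sub_le (primeNorm_lt_one l hl hx) (abs_apply_lt_one l hx)
    (primeNorm_lt_one l hl hy) (abs_apply_lt_one l hy)
  have h2 := H.inv_sub_le (primeNorm_lt_one l hl hy) (abs_apply_lt_one l hy)
    (primeNorm_lt_one l hl hx) (abs_apply_lt_one l hx)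
  rw [abs_sub_comm, abs_sub_comm (y l)] at h2
  unfold hodographSol
  rw [abs_le]
  constructor <;> linarith

lemma sol_nonneg (H : IsHodographProfile n q ε ρ ρu ρt ρuu ρut ρtt) (hl : (l : ℕ) + 1 = n)
    (hx : x ∈ Metric.ball 0 1) : 0 ≤ hodographSol ρ l x :=
  H.inv_nonneg (primeNorm_lt_one l hl hx) (abs_apply_lt_one l hx)

lemma sub_le_sol (H : IsHodographProfile n q ε ρ ρu ρt ρuu ρut ρtt) (hl : (l : ℕ) + 1 = n)
    (hx : x ∈ Metric.ball 0 1) : primeNorm x - 1 / 2 ≤ hodographSol ρ l x :=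
  H.sub_le_inv (primeNorm_lt_one l hl hx) (abs_apply_lt_one l hx)

lemma sol_eq_zero_iff (H : IsHodographProfile n q ε ρ ρu ρt ρuu ρut ρtt) (hl : (l : ℕ) + 1 = n)
    (hx : x ∈ Metric.ball 0 1) : hodographSol ρ l x = 0 ↔ primeNorm x ≤ 1 / 2 := by
  constructor
  · intro h
    have := H.sub_le_sol hl hx
    linarith
  · exact fun h => H.inv_eq_zero h (abs_apply_lt_one l hx)

/-- The epigraph is `|x'| ≤ ρ(u, x_n)`, a convex condition because `|x'|` is convex and `ρ` is
concave in `(u, x_n)`. -/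
lemma convexOn_sol (H : IsHodographProfile n q ε ρ ρu ρt ρuu ρut ρtt) (hε : 0 < ε)
    (hl : (l : ℕ) + 1 = n) : ConvexOn ℝ (Metric.ball 0 1) (hodographSol ρ l) := by
  refine ⟨convex_ball _ _, fun x hx y hy a b ha hb hab => ?_⟩
  have hz : a • x + b • y ∈ Metric.ball (0 : EuclideanSpace ℝ (Fin n)) 1 :=
    convex_ball _ _ hx hy ha hb hab
  set g := hodographSol ρ l x with hg
  set g' := hodographSol ρ l y with hg'
  have hg0 : 0 ≤ g := H.sol_nonneg hl hx
  have hg0' : 0 ≤ g' := H.sol_nonneg hl hy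
  have hg1 : g < 1 := H.inv_lt_one (primeNorm_lt_one l hl hx) (abs_apply_lt_one l hx)
  have hg1' : g' < 1 := H.inv_lt_one (primeNorm_lt_one l hl hy) (abs_apply_lt_one l hy)
  -- Levels are raised by `δ` to make them positive, also at points of the cylinder; `δ` is made
  -- small at the end.
  have key : ∀ δ : ℝ, 0 < δ → δ < min (1 - g) (1 - g') →
      hodographSol ρ l (a • x + b • y) ≤ a * g + b * g' + δ := by
    intro δ hδ hδ1
    have hd1 : g + δ < 1 := by linarith [min_le_left (1 - g) (1 - g')]
    have hd1' : g' + δ < 1 := by linarith [min_le_right (1 - g) (1 - g')]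
    have hx1 : primeNorm x ≤ ρ (g + δ, x l) :=
      (H.inv_le_iff (primeNorm_lt_one l hl hx) (abs_apply_lt_one l hx) (by linarith) hd1).1
        (show g ≤ g + δ by linarith)
    have hy1 : primeNorm y ≤ ρ (g' + δ, y l) :=
      (H.inv_le_iff (primeNorm_lt_one l hl hy) (abs_apply_lt_one l hy) (by linarith) hd1').1
        (show g' ≤ g' + δ by linarith)
    have hmx : (g + δ, x l) ∈ Ioo (0 : ℝ) 1 ×ˢ Ioo (-1 : ℝ) 1 :=
      ⟨⟨by simp only; linarith, hd1⟩, abs_lt.1 (abs_apply_lt_one l hx)⟩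
    have hmy : (g' + δ, y l) ∈ Ioo (0 : ℝ) 1 ×ˢ Ioo (-1 : ℝ) 1 :=
      ⟨⟨by simp only; linarith, hd1'⟩, abs_lt.1 (abs_apply_lt_one l hy)⟩
    have hc := (H.concaveOn hε).2 hmx hmy ha hb hab
    have hm := (H.concaveOn hε).1 hmx hmy ha hb hab
    have he : a • (g + δ, x l) + b • (g' + δ, y l) = (a * g + b * g' + δ, (a • x + b • y) l) := by
      ext
      · simp
        linear_combination δ * hab
      · simp
    rw [he] at hc hm
    refine (H.inv_le_iff (primeNorm_lt_one l hl hz) (abs_apply_lt_one l hz) hm.1.1 hm.1.2).2 ?_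
    refine ((primeNorm_add_smul_le l hl x y ha hb).trans ?_).trans hc
    simp only [smul_eq_mul]
    gcongr
  by_contra hlt
  rw [not_le] at hlt
  simp only [smul_eq_mul] at hlt
  set d := hodographSol ρ l (a • x + b • y) - (a * g + b * g') with hd
  have hd0 : 0 < d := by linarith
  have hmin : 0 < min (1 - g) (1 - g') := lt_min (by linarith) (by linarith)
  have h2 := key (min (d / 2) (min (1 - g) (1 - g') / 2)) (by positivity)
    (lt_of_le_of_lt (min_le_right _ _) (by linarith))
  have := min_le_left (d / 2) (min (1 - g) (1 - g') / 2)
  linarith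

lemma isOpen_pos : IsOpen {x : EuclideanSpace ℝ (Fin n) | x ∈ Metric.ball 0 1 ∧ 1 / 2 < primeNorm x} :=
  Metric.isOpen_ball.inter (isOpen_lt continuous_const continuous_primeNorm)

/-- Implicit differentiation of `ρ(v(x), x_n) = |x'|`. The Lipschitz bound gives `v(y) - v(x) = O(y
- x)`, so the remainder in the expansion of `ρ` is `o(y - x)` and one may divide by `ρ_u`. -/
lemma hasFDerivAt_sol (H : IsHodographProfile n q ε ρ ρu ρt ρuu ρut ρtt) (hl : (l : ℕ) + 1 = n)
    (hx : x ∈ Metric.ball 0 1) (hr : 1 / 2 < primeNorm x) :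
    HasFDerivAt (hodographSol ρ l) (innerSL ℝ (hodographGrad ρ ρu ρt l x)) x := by
  obtain ⟨hu0, hu1, hu⟩ := H.inv_spec hr (primeNorm_lt_one l hl hx) (abs_apply_lt_one l hx)
  have ht := abs_apply_lt_one l hx
  have hopen := (isOpen_pos (n := n)).mem_nhds ⟨hx, hr⟩
  set g := hodographSol ρ l with hg
  change 0 < g x at hu0
  change g x < 1 at hu1
  change ρ (g x, x l) = primeNorm x at hu
  have hρ := H.hasFDerivAt (g x, x l) hu0 hu1 ht
  have hρu : 0 < ρu (g x, x l) := by linarith [H.half_le_u (g x, x l) hu0 hu1 ht]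
  have hO : (fun y => (g y, y l) - (g x, x l)) =O[nhds x] fun y => y - x := by
    refine Asymptotics.IsBigO.of_bound 4 ?_
    filter_upwards [hopen] with y hy
    rw [Prod.mk_sub_mk, Prod.norm_mk]
    refine max_le (H.abs_sol_sub_le hl hy.1 hx) ?_
    have : ‖y l - x l‖ ≤ ‖y - x‖ := PiLp.norm_apply_le (y - x) l
    linarith [norm_nonneg (y - x)]
  have hcont : Filter.Tendsto (fun y => (g y, y l)) (nhds x) (nhds (g x, x l)) := by
    rw [tendsto_iff_norm_sub_tendsto_zero]
    have : Filter.Tendsto (fun y => y - x) (nhds x) (nhds 0) := by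
      have := (continuous_sub_right x).tendsto x
      rwa [sub_self] at this
    exact tendsto_zero_iff_norm_tendsto_zero.1 (hO.trans_tendsto this)
  have ho := (hρ.isLittleO.comp_tendsto hcont).trans_isBigO hO
  have hr' := (hasFDerivAt_primeNorm l hl (x := x) (by linarith)).isLittleO
  have key := (hr'.sub ho).const_mul_left (ρu (g x, x l))⁻¹
  refine HasFDerivAt.of_isLittleO (key.congr' ?_ Filter.EventuallyEq.rfl)
  filter_upwards [hopen] with y hy
  have huy : ρ (g y, y l) = primeNorm y :=
    (H.inv_spec hy.2 (primeNorm_lt_one l hl hy.1) (abs_apply_lt_one l hy.1)).2.2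
  simp only [Function.comp_apply, Prod.mk_sub_mk, add_apply, smul_apply,
    ContinuousLinearMap.coe_fst', ContinuousLinearMap.coe_snd', smul_eq_mul, huy, hu,
    innerSL_apply_apply, hodographGrad, inner_add_left, inner_smul_left,
    EuclideanSpace.inner_single_left, ← hg]
  have hr0 : primeNorm x ≠ 0 := by linarith
  simp
  field_simp
  ring

/-- Differentiating the gradient gives `1 / (ρ_u r)` times the identity plus two rank-one terms. The
determinant is `(ρ_u r)^(-(n-2)) (ρ_uu ρ_tt - ρ_ut²) / ρ_u^4`, and the profile equation cancels all
factors except `ε u^q`. -/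
lemma exists_hasFDerivAt_grad (H : IsHodographProfile n q ε ρ ρu ρt ρuu ρut ρtt) (hn : 2 ≤ n)
    (hl : (l : ℕ) + 1 = n) (hx : x ∈ Metric.ball 0 1) (hr : 1 / 2 < primeNorm x) :
    ∃ L : EuclideanSpace ℝ (Fin n) →L[ℝ] EuclideanSpace ℝ (Fin n),
      HasFDerivAt (hodographGrad ρ ρu ρt l) L x ∧ L.det = ε * hodographSol ρ l x ^ q := by
  obtain ⟨hu0, hu1, hu⟩ := H.inv_spec hr (primeNorm_lt_one l hl hx) (abs_apply_lt_one l hx)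
  have ht := abs_apply_lt_one l hx
  have hF := H.hasFDerivAt_sol hl hx hr
  have hdet := H.det_eq (hodographSol ρ l x, x l) hu0 hu1 ht
  have hρu : 0 < ρu (hodographSol ρ l x, x l) := by
    linarith [H.half_le_u (hodographSol ρ l x, x l) hu0 hu1 ht]
  have hz : HasFDerivAt (fun y => (hodographSol ρ l y, y l))
      ((innerSL ℝ (hodographGrad ρ ρu ρt l x)).prod (EuclideanSpace.proj l)) x :=
    hF.prodMk (EuclideanSpace.proj (𝕜 := ℝ) l).hasFDerivAt
  have hU := (H.hasFDerivAt_u (hodographSol ρ l x, x l) hu0 hu1 ht).comp x hz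
  have hT := (H.hasFDerivAt_t (hodographSol ρ l x, x l) hu0 hu1 ht).comp x hz
  have hR := hasFDerivAt_primeNorm l hl (x := x) (by linarith)
  have hr0 : primeNorm x ≠ 0 := by linarith
  have hne := hρu.ne'
  have hPP : inner ℝ (primeProj l x) (primeProj l x) = primeNorm x ^ 2 := by
    rw [real_inner_self_eq_norm_sq, norm_primeProj l hl]
  have hPe : inner ℝ (primeProj l x) (EuclideanSpace.single l (1 : ℝ)) = 0 := by
    rw [EuclideanSpace.inner_single_right]
    simp [primeProj_apply_apply]
  have hPl : primeProj l x l = 0 := by simp [primeProj_apply_apply]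
  have hGP : inner ℝ (hodographGrad ρ ρu ρt l x) (primeProj l x)
      = primeNorm x / ρu (hodographSol ρ l x, x l) := by
    simp only [hodographGrad, inner_add_left, inner_smul_left, hPP, EuclideanSpace.inner_single_left,
      hPl]
    simp
    field_simp
  have hGe : inner ℝ (hodographGrad ρ ρu ρt l x) (EuclideanSpace.single l (1 : ℝ))
      = -(ρt (hodographSol ρ l x, x l) / ρu (hodographSol ρ l x, x l)) := by
    simp only [hodographGrad, inner_add_left, inner_smul_left, hPe, EuclideanSpace.inner_single_left]
    simp
    rfl
  obtain ⟨α, hA, hα⟩ : ∃ α : EuclideanSpace ℝ (Fin n) →L[ℝ] ℝ,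
      HasFDerivAt (fun y => (ρu (hodographSol ρ l y, y l) * primeNorm y)⁻¹) α x ∧
      ∀ h, α h = -((ρu (hodographSol ρ l x, x l) * primeNorm x) ^ 2)⁻¹ *
        (ρu (hodographSol ρ l x, x l) * ((primeNorm x)⁻¹ * inner ℝ (primeProj l x) h) +
          primeNorm x * (ρuu (hodographSol ρ l x, x l) * inner ℝ (hodographGrad ρ ρu ρt l x) h
            + ρut (hodographSol ρ l x, x l) * h l)) :=
    ⟨_, (hasDerivAt_inv (mul_ne_zero hne hr0)).comp_hasFDerivAt x (hU.mul hR), fun h => by simp; ring⟩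
  obtain ⟨γ, hB, hγ⟩ : ∃ γ : EuclideanSpace ℝ (Fin n) →L[ℝ] ℝ,
      HasFDerivAt (fun y => -(ρt (hodographSol ρ l y, y l) * (ρu (hodographSol ρ l y, y l))⁻¹)) γ x ∧
      ∀ h, γ h = -(ρt (hodographSol ρ l x, x l) * (-(ρu (hodographSol ρ l x, x l) ^ 2)⁻¹ *
          (ρuu (hodographSol ρ l x, x l) * inner ℝ (hodographGrad ρ ρu ρt l x) h
            + ρut (hodographSol ρ l x, x l) * h l)) +
        (ρu (hodographSol ρ l x, x l))⁻¹ *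
          (ρut (hodographSol ρ l x, x l) * inner ℝ (hodographGrad ρ ρu ρt l x) h
            + ρtt (hodographSol ρ l x, x l) * h l)) :=
    ⟨_, (hT.mul ((hasDerivAt_inv hne).comp_hasFDerivAt x hU)).neg, fun h => by simp; ring⟩
  have hD := (hA.smul (primeProj l).hasFDerivAt).add
    (hB.smul_const (EuclideanSpace.single l (1 : ℝ)))
  refine ⟨_, hD, ?_⟩
  change ρ (hodographSol ρ l x, x l) = primeNorm x at hu
  rw [hu] at hdet
  simp only at hdet
  set g := hodographSol ρ l x with hg
  set a := (ρu (g, x l) * primeNorm x)⁻¹ with ha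
  have ha0 : a ≠ 0 := inv_ne_zero (mul_ne_zero hne hr0)
  -- The projection differs from the identity by a rank-one map along the axis, which is absorbed
  -- into the `γ` term.
  have hL : a • primeProj l + α.smulRight (primeProj l x)
        + γ.smulRight (EuclideanSpace.single l (1 : ℝ))
      = a • ContinuousLinearMap.id ℝ (EuclideanSpace ℝ (Fin n)) + α.smulRight (primeProj l x)
        + (γ - a • (EuclideanSpace.proj l : EuclideanSpace ℝ (Fin n) →L[ℝ] ℝ)).smulRight
          (EuclideanSpace.single l (1 : ℝ)) := by
    ext1 h
    simp [primeProj_apply]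
    module
  rw [hL, det_smul_id_add_smulRight hn ha0]
  have hel : (EuclideanSpace.single l (1 : ℝ) : EuclideanSpace ℝ (Fin n)) l = 1 := by simp
  have hsplit : primeNorm x ^ (n - 2) ≠ 0 := pow_ne_zero _ hr0
  simp only [sub_apply, smul_apply, hα, hγ, hPP, hPe, hGP, hGe, hPl, hel, PiLp.proj_apply,
    smul_eq_mul]
  set U := ρu (g, x l)
  set T := ρt (g, x l)
  set A := ρuu (g, x l)
  set B := ρut (g, x l)
  set C := ρtt (g, x l)
  set r := primeNorm x
  have hpow : U ^ (n + 2) = U ^ (n - 2) * U ^ 4 := by rw [← pow_add]; congr 1; omega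
  rw [hpow] at hdet
  have hmain : a ^ (n - 2) * ((A * C - B ^ 2) / U ^ 4) = ε * g ^ q := by
    rw [hdet, ha, inv_pow, mul_pow]
    field_simp
  rw [← hmain]
  congr 1
  rw [ha]
  field_simp
  ring

end IsHodographProfile

/-! ### Subdifferentials and the Monge–Ampère measure. -/

section subdifferential

variable {n : ℕ} {Ω : Set (EuclideanSpace ℝ (Fin n))} {v : EuclideanSpace ℝ (Fin n) → ℝ}
  {x y g : EuclideanSpace ℝ (Fin n)}

lemma hasDerivAt_comp_line (hg : HasFDerivAt v (innerSL ℝ g) x) (d : EuclideanSpace ℝ (Fin n)) :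
    HasDerivAt (fun s : ℝ => v (x + s • d)) (inner ℝ g d) 0 := by
  have hline : HasDerivAt (fun s : ℝ => x + s • d) d 0 := by
    simpa using ((hasDerivAt_id (0 : ℝ)).smul_const d).const_add x
  have hg' : HasFDerivAt v (innerSL ℝ g) (x + (0 : ℝ) • d) := by simpa using hg
  exact (hg'.comp_hasDerivAt (0 : ℝ) hline)

/-- The gradient inequality for convex functions. -/
lemma add_inner_le_of_hasFDerivAt (hv : ConvexOn ℝ Ω v) (hx : x ∈ Ω) (hy : y ∈ Ω)
    (hg : HasFDerivAt v (innerSL ℝ g) x) : v x + inner ℝ g (y - x) ≤ v y := by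
  have hd := (hasDerivAt_comp_line hg (y - x)).hasDerivWithinAt (s := Ioi 0)
  rw [hasDerivWithinAt_iff_tendsto_slope' self_notMem_Ioi] at hd
  have hle : inner ℝ g (y - x) ≤ v y - v x := by
    refine le_of_tendsto hd ?_
    filter_upwards [Ioc_mem_nhdsGT (one_pos : (0 : ℝ) < 1)] with s hs
    rw [slope_def_field, div_le_iff₀ (by linarith [hs.1])]
    have h := hv.2 hx hy (sub_nonneg.2 hs.2) hs.1.le (by ring)
    have e : (1 - s) • x + s • y = x + s • (y - x) := by module
    rw [e] at h
    simp only [smul_eq_mul] at h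
    simp only [zero_smul, add_zero, sub_zero]
    linarith
  linarith

lemma eq_of_mem_subdifferential (hΩ : IsOpen Ω) (hx : x ∈ Ω)
    (hg : HasFDerivAt v (innerSL ℝ g) x) {p : EuclideanSpace ℝ (Fin n)}
    (hp : p ∈ subdifferential Ω v x) : p = g := by
  have h1 : HasFDerivAt (fun y => v y - inner ℝ p y) (innerSL ℝ g - innerSL ℝ p) x :=
    hg.sub (innerSL ℝ p).hasFDerivAt
  have hmin : IsLocalMin (fun y => v y - inner ℝ p y) x := by
    filter_upwards [hΩ.mem_nhds hx] with y hy
    have := hp y hy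
    rw [inner_sub_right] at this
    linarith
  have h0 := hmin.hasFDerivAt_eq_zero h1
  rw [← map_sub] at h0
  have : g - p = 0 := by
    have := congrArg (fun φ => φ (g - p)) h0
    simpa only [innerSL_apply_apply, zero_apply, inner_self_eq_zero] using this
  exact (sub_eq_zero.1 this).symm

lemma subdifferential_eq_singleton (hv : ConvexOn ℝ Ω v) (hΩ : IsOpen Ω) (hx : x ∈ Ω)
    (hg : HasFDerivAt v (innerSL ℝ g) x) : subdifferential Ω v x = {g} :=
  eq_singleton_iff_unique_mem.2 ⟨fun _ hy => add_inner_le_of_hasFDerivAt hv hx hy hg,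
    fun _ hp => eq_of_mem_subdifferential hΩ hx hg hp⟩

/-- The gradient of a convex function is injective where its derivative is nonsingular. -/
lemma injOn_gradient (hv : ConvexOn ℝ Ω v) (hΩ : IsOpen Ω) {S : Set (EuclideanSpace ℝ (Fin n))}
    (hS : IsOpen S) (hSΩ : S ⊆ Ω) {G : EuclideanSpace ℝ (Fin n) → EuclideanSpace ℝ (Fin n)}
    (hG : ∀ x ∈ S, HasFDerivAt v (innerSL ℝ (G x)) x)
    {L : EuclideanSpace ℝ (Fin n) → EuclideanSpace ℝ (Fin n) →L[ℝ] EuclideanSpace ℝ (Fin n)}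
    (hL : ∀ x ∈ S, HasFDerivAt G (L x) x) (hdet : ∀ x ∈ S, (L x).det ≠ 0) : InjOn G S := by
  intro x hx y hy hxy
  by_contra hne
  have h1 := add_inner_le_of_hasFDerivAt hv (hSΩ hx) (hSΩ hy) (hG x hx)
  have h2 := add_inner_le_of_hasFDerivAt hv (hSΩ hy) (hSΩ hx) (hG y hy)
  rw [← hxy, ← neg_sub y x, inner_neg_right] at h2
  set d := y - x with hd
  have hline : HasDerivAt (fun s : ℝ => x + s • d) d 0 := by
    simpa using ((hasDerivAt_id (0 : ℝ)).smul_const d).const_add x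
  -- With equal gradients at `x` and `y`, the supporting affine function at `x` also touches at `y`,
  -- hence along the whole segment. So `G` is constant on it near `x`, and `L x` has the kernel
  -- vector `d`.
  have hconst : ∀ s : ℝ, 0 ≤ s → s ≤ 1 → x + s • d ∈ S → G (x + s • d) = G x := by
    intro s hs0 hs1 hsS
    refine (eq_of_mem_subdifferential hΩ (hSΩ hsS) (hG _ hsS) fun w hw => ?_).symm
    have hc := hv.2 (hSΩ hx) (hSΩ hy) (sub_nonneg.2 hs1) hs0 (by ring)
    have e : (1 - s) • x + s • y = x + s • d := by rw [hd]; module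
    rw [e] at hc
    simp only [smul_eq_mul] at hc
    have hw' := add_inner_le_of_hasFDerivAt hv (hSΩ hx) hw (hG x hx)
    have e2 : w - (x + s • d) = (w - x) - s • d := by module
    rw [e2, inner_sub_right, inner_smul_right]
    nlinarith
  have hLd : L x d = 0 := by
    have hL' : HasFDerivAt G (L x) (x + (0 : ℝ) • d) := by simpa using hL x hx
    have hder := (hL'.comp_hasDerivAt (0 : ℝ) hline).hasDerivWithinAt (s := Ici 0)
    have hmem : ∀ᶠ s : ℝ in nhdsWithin 0 (Ici 0), x + s • d ∈ S := by
      have : Filter.Tendsto (fun s : ℝ => x + s • d) (nhdsWithin 0 (Ici 0)) (nhds x) := by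
        have := hline.continuousAt.tendsto
        rw [zero_smul, add_zero] at this
        exact this.mono_left nhdsWithin_le_nhds
      exact this (hS.mem_nhds hx)
    have hev : (G ∘ fun s : ℝ => x + s • d) =ᶠ[nhdsWithin 0 (Ici 0)] fun _ => G x := by
      filter_upwards [hmem, Icc_mem_nhdsGE (one_pos : (0 : ℝ) < 1)] with s hs hs1
      exact hconst s hs1.1 hs1.2 hs
    have h0 : HasDerivWithinAt (G ∘ fun s : ℝ => x + s • d) 0 (Ici 0) 0 :=
      (hasDerivWithinAt_const (0 : ℝ) (Ici 0) (G x)).congr_of_eventuallyEq hev (by simp)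
    exact (uniqueDiffWithinAt_Ici (0 : ℝ)).eq_deriv _ hder h0
  have hd0 : d ≠ 0 := sub_ne_zero.2 (Ne.symm hne)
  have : LinearMap.det (L x : EuclideanSpace ℝ (Fin n) →ₗ[ℝ] EuclideanSpace ℝ (Fin n)) = 0 := by
    by_contra hdet0
    have hker := LinearMap.ker_eq_bot.1 (LinearEquiv.ker (LinearMap.equivOfDetNeZero _ hdet0))
    exact hd0 (hker (by
      change L x d = L x 0
      rw [hLd, map_zero]))
  exact hdet x hx this

end subdifferential

/-- The hyperplane orthogonal to a coordinate axis is a null set. -/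
lemma volume_apply_eq_zero {n : ℕ} (l : Fin n) :
    volume {p : EuclideanSpace ℝ (Fin n) | p l = 0} = 0 := by
  have := Measure.addHaar_submodule (volume : Measure (EuclideanSpace ℝ (Fin n)))
    (LinearMap.ker (EuclideanSpace.proj (𝕜 := ℝ) l : EuclideanSpace ℝ (Fin n) →L[ℝ] ℝ).toLinearMap) (by
      intro h
      have : EuclideanSpace.single l (1 : ℝ) ∈ LinearMap.ker (EuclideanSpace.proj (𝕜 := ℝ) l : EuclideanSpace ℝ (Fin n) →L[ℝ] ℝ).toLinearMap := by
        rw [h]; trivial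
      simp at this)
  convert this using 2
  ext p
  simp

namespace IsHodographProfile

variable {n : ℕ} {q ε : ℝ} {ρ ρu ρt ρuu ρut ρtt : ℝ × ℝ → ℝ} {l : Fin n}

/-- For `x` in the open cylinder or on its boundary, all slopes of supporting affine functions
are orthogonal to the axis. -/
lemma apply_eq_zero_of_mem_subdifferential (H : IsHodographProfile n q ε ρ ρu ρt ρuu ρut ρtt)
    (hl : (l : ℕ) + 1 = n) {x : EuclideanSpace ℝ (Fin n)} (hx : x ∈ Metric.ball 0 1)
    (hr : primeNorm x ≤ 1 / 2) {c : ℝ} {p : EuclideanSpace ℝ (Fin n)}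
    (hp : p ∈ subdifferential (Metric.ball 0 1) (fun y => c * hodographSol ρ l y) x) :
    p l = 0 := by
  have hline : Filter.Tendsto (fun s : ℝ => x + s • EuclideanSpace.single l (1 : ℝ)) (nhds 0)
      (nhds x) := by
    have : Continuous fun s : ℝ => x + s • EuclideanSpace.single l (1 : ℝ) := by fun_prop
    simpa using this.tendsto 0
  have hev := hline (Metric.isOpen_ball.mem_nhds hx)
  obtain ⟨δ, hδ, hδ'⟩ := Metric.mem_nhds_iff.1 hev
  have key : ∀ s : ℝ, |s| < δ → s * p l ≤ 0 := by
    intro s hs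
    have hb : x + s • EuclideanSpace.single l (1 : ℝ) ∈ Metric.ball 0 1 :=
      hδ' (by simpa using hs)
    have h0 := (H.sol_eq_zero_iff hl hx).2 hr
    have hn : primeNorm (x + s • EuclideanSpace.single l (1 : ℝ)) = primeNorm x := by
      rw [← norm_primeProj l hl, ← norm_primeProj l hl]
      congr 1
      rw [primeProj_apply, primeProj_apply]
      simp
      module
    have h1 := (H.sol_eq_zero_iff hl hb).2 (hn.le.trans hr)
    have := hp _ hb
    simp only [h0, h1, add_sub_cancel_left, inner_smul_right, EuclideanSpace.inner_single_right] at this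
    simpa using this
  have h1 := key (δ / 2) (by rw [abs_of_pos (by positivity)]; linarith)
  have h2 := key (-(δ / 2)) (by rw [abs_neg, abs_of_pos (by positivity)]; linarith)
  nlinarith

/-- Outside the cylinder the subdifferential is the gradient, and the area formula applies to this
injective map. Over the rest, the subgradients lie in a hyperplane and the density vanishes. -/
theorem mongeAmpere_eq (H : IsHodographProfile n q ε ρ ρu ρt ρuu ρut ρtt) (hε : 0 < ε)
    (hn : 2 ≤ n) (hl : (l : ℕ) + 1 = n) {c : ℝ} (hc : 0 < c) (hcε : c ^ n * ε = c ^ q)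
    {A : Set (EuclideanSpace ℝ (Fin n))} (hA : MeasurableSet A) (hAB : A ⊆ Metric.ball 0 1) :
    mongeAmpere (Metric.ball 0 1) (fun y => c * hodographSol ρ l y) A
      = ∫⁻ x in A, ENNReal.ofReal ({y | 0 < c * hodographSol ρ l y}.indicator
          (fun y => (c * hodographSol ρ l y) ^ q) x) := by
  set v : EuclideanSpace ℝ (Fin n) → ℝ := fun y => c * hodographSol ρ l y with hv
  set S := {x : EuclideanSpace ℝ (Fin n) | x ∈ Metric.ball 0 1 ∧ 1 / 2 < primeNorm x} with hS
  have hSo : IsOpen S := isOpen_pos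
  have hSB : S ⊆ Metric.ball 0 1 := fun x hx => hx.1
  have hvc : ConvexOn ℝ (Metric.ball 0 1) v := (H.convexOn_sol hε hl).smul hc.le
  set G : EuclideanSpace ℝ (Fin n) → EuclideanSpace ℝ (Fin n) :=
    fun x => c • hodographGrad ρ ρu ρt l x with hG
  have hvG : ∀ x ∈ S, HasFDerivAt v (innerSL ℝ (G x)) x := by
    intro x hx
    have := (H.hasFDerivAt_sol hl hx.1 hx.2).const_mul c
    rwa [← map_smul] at this
  choose! L0 hL0 using fun x (hx : x ∈ S) => H.exists_hasFDerivAt_grad hn hl hx.1 hx.2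
  set L := fun x => c • L0 x with hL
  have hGL : ∀ x ∈ S, HasFDerivAt G (L x) x := fun x hx => (hL0 x hx).1.const_smul c
  have hpos : ∀ x ∈ S, 0 < hodographSol ρ l x := by
    intro x hx
    have := H.sub_le_sol hl hx.1
    linarith [hx.2]
  have hdet : ∀ x ∈ S, (L x).det = v x ^ q := by
    intro x hx
    have h1 : (L x).det = c ^ n * (L0 x).det := by
      rw [hL, ContinuousLinearMap.det, ContinuousLinearMap.det]
      simp [LinearMap.det_smul]
    rw [h1, (hL0 x hx).2, hv]
    simp only
    rw [Real.mul_rpow hc.le (hpos x hx).le, ← mul_assoc, hcε]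
  have hdet_pos : ∀ x ∈ S, 0 < (L x).det := fun x hx => by
    rw [hdet x hx]
    exact Real.rpow_pos_of_pos (mul_pos hc (hpos x hx)) _
  have hinj : InjOn G S := injOn_gradient hvc Metric.isOpen_ball hSo hSB hvG hGL
    fun x hx => (hdet_pos x hx).ne'
  have hunion : (⋃ x ∈ A, subdifferential (Metric.ball 0 1) v x)
      = G '' (A ∩ S) ∪ ⋃ x ∈ A \ S, subdifferential (Metric.ball 0 1) v x := by
    conv_lhs => rw [← inter_union_sdiff A S, biUnion_union]
    congr 1
    rw [image_eq_iUnion]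
    refine iUnion₂_congr fun x hx => ?_
    exact subdifferential_eq_singleton hvc Metric.isOpen_ball (hAB hx.1) (hvG x hx.2)
  have hnull : volume (⋃ x ∈ A \ S, subdifferential (Metric.ball 0 1) v x) = 0 := by
    refine measure_mono_null ?_ (volume_apply_eq_zero l)
    refine iUnion₂_subset fun x hx p hp => ?_
    have hr : primeNorm x ≤ 1 / 2 := not_lt.1 fun h => hx.2 ⟨hAB hx.1, h⟩
    exact H.apply_eq_zero_of_mem_subdifferential hl (hAB hx.1) hr hp
  have hAS : MeasurableSet (A ∩ S) := hA.inter hSo.measurableSet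
  rw [mongeAmpere, hunion, measure_congr (union_ae_eq_left_of_ae_eq_empty (ae_eq_empty.2 hnull)),
    ← lintegral_abs_det_fderiv_eq_addHaar_image volume hAS
      (fun x hx => (hGL x hx.2).hasFDerivWithinAt) (hinj.mono inter_subset_right),
    ← lintegral_inter_add_sdiff _ A hSo.measurableSet]
  have hzero : ∫⁻ x in A \ S, ENNReal.ofReal ({y | 0 < v y}.indicator (fun y => v y ^ q) x) = 0 := by
    rw [setLIntegral_congr_fun (g := fun _ => 0) (hA.diff hSo.measurableSet)]
    · simp
    · intro x hx
      have hr : primeNorm x ≤ 1 / 2 := not_lt.1 fun h => hx.2 ⟨hAB hx.1, h⟩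
      have h0 := (H.sol_eq_zero_iff hl (hAB hx.1)).2 hr
      simp [hv, h0]
  rw [hzero, add_zero]
  refine setLIntegral_congr_fun hAS fun x hx => ?_
  have hvx : 0 < v x := mul_pos hc (hpos x hx.2)
  rw [abs_of_pos (hdet_pos x hx.2), hdet x hx.2, indicator_of_mem (by exact hvx)]

end IsHodographProfile

/-! ### The free boundary: exposed points, dimension, corner. -/

section cylinder

variable {n : ℕ} {l : Fin n}

lemma frontier_primeNorm_le (hl : (l : ℕ) + 1 = n) :
    frontier {x : EuclideanSpace ℝ (Fin n) | primeNorm x ≤ 1 / 2} = {x | primeNorm x = 1 / 2} := by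
  refine Subset.antisymm (frontier_le_subset_eq continuous_primeNorm continuous_const) ?_
  intro x hx
  refine ⟨subset_closure (le_of_eq hx), fun hint => ?_⟩
  have hc : Continuous fun s : ℝ => x + s • primeProj l x := by fun_prop
  have hev : ∀ᶠ s : ℝ in nhds 0, primeNorm (x + s • primeProj l x) ≤ 1 / 2 := by
    have := hc.tendsto 0
    rw [zero_smul, add_zero] at this
    exact this (mem_interior_iff_mem_nhds.1 hint)
  obtain ⟨s, hs, hs0⟩ := ((hev.filter_mono nhdsWithin_le_nhds).and
    (self_mem_nhdsWithin (a := (0 : ℝ)) (s := Ioi 0))).exists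
  have hpp : primeProj l (primeProj l x) = primeProj l x := by
    ext i
    rw [primeProj_apply_apply, primeProj_apply_apply]
    split_ifs <;> rfl
  have hs0' : 0 < s := hs0
  have hx' : primeNorm x = 1 / 2 := hx
  have e : primeProj l x + s • primeProj l x = (1 + s) • primeProj l x := by module
  rw [← norm_primeProj l hl, map_add, map_smul, hpp, e, norm_smul, norm_primeProj l hl, hx',
    Real.norm_of_nonneg (by linarith)] at hs
  linarith

/-- Every point of `K` is the midpoint of a segment in `K` parallel to the axis, so no point is
exposed and the non-strictly convex part is the whole free boundary. -/
lemma nonStrictlyConvexPart_eq (hl : (l : ℕ) + 1 = n) {v : EuclideanSpace ℝ (Fin n) → ℝ}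
    (hK : coincidenceSet (Metric.ball 0 1) v = {x | primeNorm x ≤ 1 / 2} ∩ Metric.ball 0 1) :
    nonStrictlyConvexPart (Metric.ball 0 1) v = {x | primeNorm x = 1 / 2} ∩ Metric.ball 0 1 := by
  have hsc : strictlyConvexPart (Metric.ball 0 1) v = ∅ := by
    rw [eq_empty_iff_forall_notMem]
    rintro x ⟨hxB, hxK, φ, hφ⟩
    have hc : Continuous fun s : ℝ => x + s • EuclideanSpace.single l (1 : ℝ) := by fun_prop
    have hev : ∀ᶠ s : ℝ in nhds 0,
        x + s • EuclideanSpace.single l (1 : ℝ) ∈ Metric.ball 0 1 := by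
      have := hc.tendsto 0
      rw [zero_smul, add_zero] at this
      exact this (Metric.isOpen_ball.mem_nhds hxB)
    obtain ⟨δ, hδ, hδ'⟩ := Metric.mem_nhds_iff.1 hev
    have key : ∀ s : ℝ, |s| < δ →
        x + s • EuclideanSpace.single l (1 : ℝ) ∈ coincidenceSet (Metric.ball 0 1) v := by
      intro s hs
      rw [hK] at hxK ⊢
      refine ⟨?_, hδ' (by simpa using hs)⟩
      have h1 : primeNorm x ≤ 1 / 2 := hxK.1
      change primeNorm _ ≤ 1 / 2
      rw [← norm_primeProj l hl] at h1 ⊢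
      have : primeProj l (x + s • EuclideanSpace.single l (1 : ℝ)) = primeProj l x := by
        rw [primeProj_apply, primeProj_apply]
        simp
        module
      rwa [this]
    have k1 := hφ _ (key (δ / 2) (by rw [abs_of_pos (by positivity)]; linarith))
    have k2 := hφ _ (key (-(δ / 2)) (by rw [abs_neg, abs_of_pos (by positivity)]; linarith))
    simp only [map_add, map_smul, smul_eq_mul] at k1 k2
    have h := k1.2 (by linarith [k2.1])
    rw [add_eq_left] at h
    have := congrArg (fun z : EuclideanSpace ℝ (Fin n) => z l) h
    simp at this
    linarith
  rw [nonStrictlyConvexPart, hsc, sdiff_empty, freeBoundary, hK, inter_comm,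
    frontier_inter_open_inter Metric.isOpen_ball, frontier_primeNorm_le hl]

lemma primeNorm_sq (hl : (l : ℕ) + 1 = n) (x : EuclideanSpace ℝ (Fin n)) :
    primeNorm x ^ 2 = ∑ j ∈ Finset.univ.erase l, x j ^ 2 := by
  have h := primeNorm_sq_add_sq l hl x
  rw [EuclideanSpace.norm_sq_eq, ← Finset.add_sum_erase _ _ (Finset.mem_univ l)] at h
  simp only [Real.norm_eq_abs, sq_abs] at h
  linarith

lemma norm_le_of_abs_apply_le {x : EuclideanSpace ℝ (Fin n)} {M : ℝ} (hM : 0 ≤ M)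
    (h : ∀ j, |x j| ≤ M) : ‖x‖ ≤ n * M := by
  refine abs_le_of_sq_le_sq' ?_ (by positivity) |>.2
  rw [EuclideanSpace.norm_sq_eq]
  calc ∑ j, ‖x j‖ ^ 2 ≤ ∑ _j : Fin n, M ^ 2 := by
        refine Finset.sum_le_sum fun j _ => ?_
        gcongr
        exact h j
    _ = n * M ^ 2 := by simp
    _ ≤ (n * M) ^ 2 := by
        rw [mul_pow]
        gcongr
        rcases Nat.eq_zero_or_pos n with h0 | h0
        · simp [h0]
        · exact le_self_pow₀ (by exact_mod_cast h0) two_ne_zero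

/-- Deletion of the coordinate `i`. -/
def dropCoord (i : Fin n) (x : EuclideanSpace ℝ (Fin n)) : {j : Fin n // j ≠ i} → ℝ := fun j => x j

lemma lipschitzWith_dropCoord (i : Fin n) : LipschitzWith 1 (dropCoord i) := by
  refine LipschitzWith.of_dist_le_mul fun x y => ?_
  rw [NNReal.coe_one, one_mul, dist_pi_le_iff dist_nonneg]
  intro j
  rw [dist_eq_norm, dist_eq_norm]
  exact PiLp.norm_apply_le (x - y) j

lemma dimH_univ_dropCoord (i : Fin n) :
    dimH (univ : Set ({j : Fin n // j ≠ i} → ℝ)) = ((n - 1 : ℕ) : ℝ≥0∞) := by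
  rw [Real.dimH_univ_pi]
  simp [Fintype.card_subtype_compl]

/-- On this piece `x_i` is a Lipschitz function of the other coordinates: they control `x_i² -
y_i²`, and `|x_i + y_i| ≥ 2c` because both have sign `σ`. Thus deleting `x_i` is antilipschitz. -/
lemma dimH_cylinder_piece_le (hl : (l : ℕ) + 1 = n) {i : Fin n} (hi : i ≠ l) {σ c : ℝ}
    (hσ : σ ^ 2 = 1) (hc : 0 < c) :
    dimH {x : EuclideanSpace ℝ (Fin n) | x ∈ Metric.ball 0 1 ∧ primeNorm x = 1 / 2 ∧ c ≤ σ * x i}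
      ≤ ((n - 1 : ℕ) : ℝ≥0∞) := by
  set E := {x : EuclideanSpace ℝ (Fin n) |
    x ∈ Metric.ball 0 1 ∧ primeNorm x = 1 / 2 ∧ c ≤ σ * x i} with hE
  have hanti : AntilipschitzWith (Real.toNNReal (n * (1 + n / c)))
      (fun x : E => dropCoord i x.1) := by
    refine AntilipschitzWith.of_le_mul_dist fun x y => ?_
    obtain ⟨x, hxB, hx, hxi⟩ := x
    obtain ⟨y, hyB, hy, hyi⟩ := y
    simp only
    rw [Real.coe_toNNReal _ (by positivity), Subtype.dist_eq, dist_eq_norm]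
    set D := dist (dropCoord i x) (dropCoord i y) with hD
    have hD0 : 0 ≤ D := dist_nonneg
    have hj : ∀ j, j ≠ i → |x j - y j| ≤ D := fun j hj =>
      dist_le_pi_dist (dropCoord i x) (dropCoord i y) ⟨j, hj⟩
    have hxi' : |x i - y i| ≤ n / c * D := by
      have h1 := primeNorm_sq hl x
      have h2 := primeNorm_sq hl y
      rw [hx, ← Finset.add_sum_erase _ _ (Finset.mem_erase.2 ⟨hi, Finset.mem_univ i⟩)] at h1
      rw [hy, ← Finset.add_sum_erase _ _ (Finset.mem_erase.2 ⟨hi, Finset.mem_univ i⟩)] at h2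
      have h3 : x i ^ 2 - y i ^ 2
          = -∑ j ∈ (Finset.univ.erase l).erase i, (x j ^ 2 - y j ^ 2) := by
        rw [Finset.sum_sub_distrib]; linarith
      have h4 : |x i ^ 2 - y i ^ 2| ≤ n * (2 * D) := by
        rw [h3, abs_neg]
        calc |∑ j ∈ (Finset.univ.erase l).erase i, (x j ^ 2 - y j ^ 2)|
            ≤ ∑ j ∈ (Finset.univ.erase l).erase i, |x j ^ 2 - y j ^ 2| :=
              Finset.abs_sum_le_sum_abs _ _
          _ ≤ ∑ _j ∈ (Finset.univ.erase l).erase i, 2 * D := by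
            refine Finset.sum_le_sum fun j hj' => ?_
            have e : x j ^ 2 - y j ^ 2 = (x j + y j) * (x j - y j) := by ring
            rw [e, abs_mul]
            have := hj j (Finset.ne_of_mem_erase hj')
            have h5 : |x j + y j| ≤ 2 := (abs_add_le _ _).trans (by
              linarith [abs_apply_lt_one j hxB, abs_apply_lt_one j hyB])
            gcongr
          _ ≤ n * (2 * D) := by
            rw [Finset.sum_const, nsmul_eq_mul]
            gcongr
            refine (Finset.card_le_univ _).trans ?_
            simp
      have e : x i ^ 2 - y i ^ 2 = (x i + y i) * (x i - y i) := by ring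
      rw [e, abs_mul] at h4
      have h6 : 2 * c ≤ |x i + y i| := by
        have hσa : |σ| = 1 := by rw [← sq_eq_sq₀ (abs_nonneg _) zero_le_one, sq_abs, hσ, one_pow]
        calc 2 * c ≤ σ * (x i + y i) := by linarith
          _ ≤ |σ * (x i + y i)| := le_abs_self _
          _ = |x i + y i| := by rw [abs_mul, hσa, one_mul]
      rw [div_mul_eq_mul_div, le_div_iff₀ hc]
      nlinarith [abs_nonneg (x i - y i)]
    rw [mul_assoc]
    refine norm_le_of_abs_apply_le (by positivity) fun j => ?_
    have hn0 : 0 ≤ n / c * D := by positivity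
    rw [PiLp.sub_apply]
    by_cases h : j = i
    · rw [h]; linarith
    · linarith [hj j h]
  calc dimH E = dimH ((Subtype.val : E → EuclideanSpace ℝ (Fin n)) '' univ) := by simp
    _ = dimH (univ : Set E) := isometry_subtype_coe.dimH_image _
    _ ≤ dimH ((fun x : E => dropCoord i x.1) '' univ) := hanti.le_dimH_image _
    _ ≤ dimH (univ : Set ({j : Fin n // j ≠ i} → ℝ)) := dimH_mono (subset_univ _)
    _ = _ := dimH_univ_dropCoord i

lemma exists_apply_ne_zero (hl : (l : ℕ) + 1 = n) {x : EuclideanSpace ℝ (Fin n)}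
    (hx : primeNorm x = 1 / 2) : ∃ i, i ≠ l ∧ x i ≠ 0 := by
  by_contra! h
  have := primeNorm_sq hl x
  rw [Finset.sum_eq_zero (fun j hj => by rw [h j (Finset.ne_of_mem_erase hj)]; simp), hx] at this
  norm_num at this

/-- Above, countably many graph pieces cover the surface; below, deleting one coordinate of `x'`
maps it, with constant one, onto a set containing a ball. -/
lemma dimH_cylinder (hn : 2 ≤ n) (hl : (l : ℕ) + 1 = n) :
    dimH ({x : EuclideanSpace ℝ (Fin n) | primeNorm x = 1 / 2} ∩ Metric.ball 0 1)
      = ((n - 1 : ℕ) : ℝ≥0∞) := by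
  refine le_antisymm ?_ ?_
  · have hsub : {x : EuclideanSpace ℝ (Fin n) | primeNorm x = 1 / 2} ∩ Metric.ball 0 1 ⊆
        ⋃ i : {i : Fin n // i ≠ l}, ⋃ k : ℕ, ⋃ σ : {σ : ℝ // σ = 1 ∨ σ = -1},
          {x : EuclideanSpace ℝ (Fin n) | x ∈ Metric.ball 0 1 ∧ primeNorm x = 1 / 2 ∧
            1 / ((k : ℝ) + 1) ≤ σ * x i} := by
      rintro x ⟨hx, hxB⟩
      obtain ⟨i, hi, hxi⟩ := exists_apply_ne_zero hl hx
      obtain ⟨k, hk⟩ := exists_nat_one_div_lt (abs_pos.2 hxi)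
      simp only [mem_iUnion]
      rcases le_or_gt 0 (x i) with h | h
      · exact ⟨⟨i, hi⟩, k, ⟨1, Or.inl rfl⟩, hxB, hx, by rw [abs_of_nonneg h] at hk; simpa using hk.le⟩
      · exact ⟨⟨i, hi⟩, k, ⟨-1, Or.inr rfl⟩, hxB, hx, by rw [abs_of_neg h] at hk; simpa using hk.le⟩
    refine (dimH_mono hsub).trans ?_
    have hcount : Countable {σ : ℝ // σ = 1 ∨ σ = -1} :=
      ((Set.finite_singleton (-1 : ℝ)).insert 1).countable.to_subtype
    simp only [dimH_iUnion]
    refine iSup_le fun i => iSup_le fun k => iSup_le fun σ => ?_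
    refine dimH_cylinder_piece_le hl i.2 ?_ (by positivity)
    rcases σ.2 with h | h <;> rw [h] <;> norm_num
  · have hnpos : (0 : ℝ) < n := by exact_mod_cast (by omega : 0 < n)
    set i : Fin n := ⟨0, by omega⟩ with hi
    have hil : i ≠ l := by
      rw [Ne, Fin.ext_iff]; simp only [hi]; omega
    -- The radius keeps the squares of the remaining coordinates of `x'` below `1/4` in total, so
    -- `x_i` can be solved for, and `x_l` small enough for the point to lie in the unit ball.
    have hopen : Metric.ball (0 : {j : Fin n // j ≠ i} → ℝ) (1 / (2 * n)) ⊆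
        dropCoord i '' ({x : EuclideanSpace ℝ (Fin n) | primeNorm x = 1 / 2} ∩ Metric.ball 0 1) := by
      intro y hy
      have hn0 : (0 : ℝ) < 1 / (2 * n) := by positivity
      have hn4 : (1 : ℝ) / (2 * n) ≤ 1 / 4 := by
        rw [div_le_div_iff₀ (by positivity) (by norm_num)]
        have : (2 : ℝ) ≤ n := by exact_mod_cast hn
        linarith
      have hyj : ∀ j, |y j| < 1 / (2 * n) := by
        rw [mem_ball_zero_iff, pi_norm_lt_iff hn0] at hy
        exact hy
      set z : Fin n → ℝ := fun j => if h : j ≠ i then y ⟨j, h⟩ else 0 with hz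
      have hzj : ∀ j, z j ^ 2 ≤ (1 / (2 * n)) ^ 2 := by
        intro j
        simp only [hz]
        split_ifs with h
        · exact sq_le_sq' (by linarith [(abs_lt.1 (hyj ⟨j, h⟩)).1]) (abs_lt.1 (hyj ⟨j, h⟩)).2.le
        · rw [zero_pow two_ne_zero]; positivity
      set s := ∑ j ∈ (Finset.univ.erase l).erase i, z j ^ 2 with hs
      have hs4 : s ≤ 1 / 4 := by
        calc s ≤ ∑ _j ∈ (Finset.univ.erase l).erase i, (1 / (2 * (n : ℝ))) ^ 2 :=
              Finset.sum_le_sum fun j _ => hzj j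
          _ ≤ n * (1 / (2 * (n : ℝ))) ^ 2 := by
              rw [Finset.sum_const, nsmul_eq_mul]
              gcongr
              refine (Finset.card_le_univ _).trans ?_
              simp
          _ ≤ 1 / 4 := by
              have : (n : ℝ) * (1 / (2 * n)) ^ 2 = 1 / 2 * (1 / (2 * n)) := by field_simp
              rw [this]; linarith
      set x : EuclideanSpace ℝ (Fin n) :=
        WithLp.toLp 2 fun j => if j = i then Real.sqrt (1 / 4 - s) else z j with hx
      have hxj : ∀ j, j ≠ i → x j = z j := fun j hj => by simp [hx, hj]
      have hxi : x i = Real.sqrt (1 / 4 - s) := by simp [hx]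
      have hpn : primeNorm x = 1 / 2 := by
        have h1 := primeNorm_sq hl x
        rw [← Finset.add_sum_erase _ _ (Finset.mem_erase.2 ⟨hil, Finset.mem_univ i⟩), hxi,
          Real.sq_sqrt (by linarith), Finset.sum_congr rfl (g := fun j => z j ^ 2) (fun j hj => by
            rw [hxj j (Finset.ne_of_mem_erase hj)]), ← hs] at h1
        have h2 := primeNorm_nonneg x
        nlinarith
      refine ⟨x, ⟨hpn, ?_⟩, ?_⟩
      · rw [mem_ball_zero_iff]
        have h1 := primeNorm_sq_add_sq l hl x
        rw [hpn, hxj l hil.symm] at h1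
        have h2 := hzj l
        have h3 : (1 / (2 * (n : ℝ))) ^ 2 ≤ (1 / 4) ^ 2 := by gcongr
        nlinarith [norm_nonneg x]
      · ext j
        simp only [dropCoord]
        rw [hxj j j.2]
        simp [hz, j.2]
    have hball : dimH (Metric.ball (0 : {j : Fin n // j ≠ i} → ℝ) (1 / (2 * n)))
        = ((n - 1 : ℕ) : ℝ≥0∞) := by
      rw [Real.dimH_of_mem_nhds (Metric.ball_mem_nhds _ (by positivity)), ← dimH_univ_dropCoord i,
        Real.dimH_univ_eq_finrank]
    rw [← hball]
    exact (dimH_mono hopen).trans ((lipschitzWith_dropCoord i).dimH_image_le _)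

/-- A function that vanishes in the cylinder and grows linearly away from it is not differentiable
on the boundary of the cylinder. -/
lemma not_differentiableAt_of_le (hl : (l : ℕ) + 1 = n) {v : EuclideanSpace ℝ (Fin n) → ℝ} {c : ℝ}
    (hc : 0 < c) (h0 : ∀ x ∈ Metric.ball 0 1, primeNorm x ≤ 1 / 2 → v x = 0)
    (h1 : ∀ x ∈ Metric.ball 0 1, c * (primeNorm x - 1 / 2) ≤ v x)
    {x : EuclideanSpace ℝ (Fin n)} (hxB : x ∈ Metric.ball 0 1) (hx : primeNorm x = 1 / 2) :
    ¬ DifferentiableAt ℝ v x := by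
  intro hd
  have hline : HasDerivAt (fun s : ℝ => x + s • primeProj l x) (primeProj l x) 0 := by
    simpa using ((hasDerivAt_id (0 : ℝ)).smul_const (primeProj l x)).const_add x
  have hd' : HasFDerivAt v (fderiv ℝ v x) (x + (0 : ℝ) • primeProj l x) := by
    simpa using hd.hasFDerivAt
  have hder := hd'.comp_hasDerivAt (0 : ℝ) hline
  set m := fderiv ℝ v x (primeProj l x) with hm
  have hpn : ∀ s : ℝ, -1 ≤ s → primeNorm (x + s • primeProj l x) = (1 + s) * (1 / 2) := by
    intro s hs
    have hpp : primeProj l (primeProj l x) = primeProj l x := by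
      ext i
      rw [primeProj_apply_apply, primeProj_apply_apply]
      split_ifs <;> rfl
    have e : primeProj l x + s • primeProj l x = (1 + s) • primeProj l x := by module
    rw [← norm_primeProj l hl, map_add, map_smul, hpp, e, norm_smul, norm_primeProj l hl, hx,
      Real.norm_of_nonneg (by linarith)]
  have hB : ∀ᶠ s : ℝ in nhds 0, x + s • primeProj l x ∈ Metric.ball 0 1 := by
    have := hline.continuousAt.tendsto
    rw [zero_smul, add_zero] at this
    exact this (Metric.isOpen_ball.mem_nhds hxB)
  have hx0 : v x = 0 := h0 x hxB hx.le
  have hleft : m = 0 := by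
    have hev : (v ∘ fun s : ℝ => x + s • primeProj l x) =ᶠ[nhdsWithin 0 (Iic 0)] fun _ => 0 := by
      filter_upwards [hB.filter_mono nhdsWithin_le_nhds,
        Icc_mem_nhdsLE (show (-1 : ℝ) < 0 by norm_num)] with s hs hs1
      exact h0 _ hs (by rw [hpn s hs1.1]; linarith [hs1.2])
    have hz : HasDerivWithinAt (v ∘ fun s : ℝ => x + s • primeProj l x) 0 (Iic 0) 0 :=
      (hasDerivWithinAt_const (0 : ℝ) (Iic 0) (0 : ℝ)).congr_of_eventuallyEq hev (by simp [hx0])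
    exact (uniqueDiffWithinAt_Iic (0 : ℝ)).eq_deriv _ hder.hasDerivWithinAt hz
  -- Along `x + s x'` the radius is `(1 + s) / 2`, so `v ≥ c s / 2` for small `s > 0`, against a
  -- zero left derivative.
  have hright : c / 2 ≤ m := by
    have hd := hder.hasDerivWithinAt (s := Ioi 0)
    rw [hasDerivWithinAt_iff_tendsto_slope' self_notMem_Ioi] at hd
    refine ge_of_tendsto hd ?_
    filter_upwards [hB.filter_mono nhdsWithin_le_nhds, self_mem_nhdsWithin] with s hs hs0
    have hs0' : 0 < s := hs0
    rw [slope_def_field, le_div_iff₀ (by linarith)]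
    have := h1 _ hs
    rw [hpn s (by linarith)] at this
    simp only [Function.comp_apply, zero_smul, add_zero, hx0]
    linarith
  linarith

end cylinder

/-- A lower bound on symmetric second differences is a lower bound on the second derivative. -/
lemma le_deriv2_of_second_difference {a a' : ℝ → ℝ} {A k : ℝ} (ha : ∀ s, HasDerivAt a (a' s) s)
    (ha' : HasDerivAt a' A 0)
    (h : ∀ᶠ s in nhdsWithin (0 : ℝ) (Ioi 0), k * s ^ 2 ≤ a s + a (-s) - 2 * a 0) : k ≤ A := by
  by_contra! hlt
  set b' : ℝ → ℝ := fun s => a' s - a' (-s) - 2 * k * s with hb'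
  have hneg : HasDerivAt (fun s : ℝ => -s) (-1) 0 := (hasDerivAt_id (0 : ℝ)).neg
  have ha'n : HasDerivAt a' A (-0) := by rwa [neg_zero]
  have hd : HasDerivAt b' (2 * A - 2 * k) 0 :=
    ((ha'.sub (ha'n.comp (0 : ℝ) hneg)).sub ((hasDerivAt_id (0 : ℝ)).const_mul (2 * k))).congr_deriv
      (by ring)
  have hs := hd.hasDerivWithinAt (s := Ioi 0)
  rw [hasDerivWithinAt_iff_tendsto_slope' self_notMem_Ioi] at hs
  have hev := hs.eventually_lt_const (show 2 * A - 2 * k < 0 by linarith)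
  obtain ⟨δ, hδ, hδ'⟩ := mem_nhdsGT_iff_exists_Ioo_subset.1 (hev.and h)
  have hδ0 : 0 < δ := hδ
  have hb'neg : ∀ s ∈ Ioo 0 δ, b' s < 0 := by
    intro s hs
    have := (hδ' hs).1
    rw [slope_def_field, div_neg_iff] at this
    have e : b' 0 = 0 := by simp [hb']
    rw [e] at this
    rcases this with h | h
    · linarith [h.2, hs.1]
    · linarith [h.1]
  set b : ℝ → ℝ := fun s => a s + a (-s) - k * s ^ 2 with hb
  have hbd : ∀ s, HasDerivAt b (b' s) s := fun s => by
    have h1 : HasDerivAt (fun s : ℝ => -s) (-1) s := (hasDerivAt_id s).neg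
    exact (((ha s).add ((ha (-s)).comp s h1)).sub ((hasDerivAt_pow 2 s).const_mul k)).congr_deriv
      (by simp [hb']; ring)
  obtain ⟨s, hs, hsl⟩ := exists_hasDerivAt_eq_slope b b' (show (0 : ℝ) < δ / 2 by linarith)
    (fun s _ => (hbd s).continuousAt.continuousWithinAt) (fun s _ => hbd s)
  have h1 := hb'neg s ⟨hs.1, by linarith [hs.2]⟩
  have h2 := (hδ' (show δ / 2 ∈ Ioo 0 δ from ⟨by linarith, by linarith⟩)).2
  rw [hsl, sub_zero, div_neg_iff] at h1
  simp only [hb, neg_zero] at h1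
  rcases h1 with h1 | h1
  · linarith [h1.2]
  · linarith [h1.1]

/-! ### Distributional second derivatives through second differences. -/

section weak

variable {n : ℕ}

/-- The translation is put on the smooth factor, so `w` need only be integrable. -/
lemma hasDerivAt_integral_translate {w : EuclideanSpace ℝ (Fin n) → ℝ} (hw : Integrable w)
    {ψ : EuclideanSpace ℝ (Fin n) → ℝ} (hψ : ContDiff ℝ ∞ ψ) (hc : HasCompactSupport ψ)
    (e : EuclideanSpace ℝ (Fin n)) (s : ℝ) :
    HasDerivAt (fun s : ℝ => ∫ x, w x * ψ (x + s • e))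
      (∫ x, w x * fderiv ℝ ψ (x + s • e) e) s := by
  have hψ1 : ContDiff ℝ 1 ψ := hψ.of_le (by exact_mod_cast le_top)
  have hcd : Continuous fun x => fderiv ℝ ψ x e := (hψ1.continuous_fderiv one_ne_zero).clm_apply
    continuous_const
  have hcs : HasCompactSupport fun x => fderiv ℝ ψ x e := hc.fderiv_apply (𝕜 := ℝ) e
  obtain ⟨C, hC⟩ := hcs.exists_bound_of_continuous hcd
  obtain ⟨C0, hC0⟩ := hc.exists_bound_of_continuous hψ.continuous
  have hsh : ∀ s : ℝ, Continuous fun x : EuclideanSpace ℝ (Fin n) => x + s • e := fun s => by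
    fun_prop
  refine (hasDerivAt_integral_of_dominated_loc_of_deriv_le (s := univ) Filter.univ_mem
    (bound := fun x => C * ‖w x‖) (F' := fun s x => w x * fderiv ℝ ψ (x + s • e) e) ?_ ?_ ?_ ?_ ?_ ?_).2
  · exact Filter.Eventually.of_forall fun s =>
      hw.aestronglyMeasurable.mul (hψ.continuous.comp (hsh s)).aestronglyMeasurable
  · refine (hw.bdd_mul (hψ.continuous.comp (hsh s)).aestronglyMeasurable
      (Filter.Eventually.of_forall fun x => hC0 (x + s • e))).congr
      (Filter.Eventually.of_forall fun x => mul_comm _ _)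
  · exact hw.aestronglyMeasurable.mul (hcd.comp (hsh s)).aestronglyMeasurable
  · refine Filter.Eventually.of_forall fun x s _ => ?_
    rw [norm_mul, mul_comm]
    gcongr
    exact hC _
  · exact hw.norm.const_mul C
  · refine Filter.Eventually.of_forall fun x s _ => ?_
    have hline : HasDerivAt (fun s : ℝ => x + s • e) e s := by
      simpa using ((hasDerivAt_id s).smul_const e).const_add x
    exact (((hψ1.differentiable one_ne_zero) (x + s • e)).hasFDerivAt.comp_hasDerivAt s
      hline).const_mul (w x)

/-- If `v` has second weak derivatives in `L¹`, then the second distributional derivative of `v` in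
each coordinate direction is an integrable function. -/
lemma MemW21.exists_weak_second {U : Set (EuclideanSpace ℝ (Fin n))}
    {v : EuclideanSpace ℝ (Fin n) → ℝ} (h : MemW21 U v) (i : Fin n) :
    ∃ k : EuclideanSpace ℝ (Fin n) → ℝ, IntegrableOn k U ∧
      ∀ φ : EuclideanSpace ℝ (Fin n) → ℝ, ContDiff ℝ ∞ φ → HasCompactSupport φ → tsupport φ ⊆ U →
        ∫ x in U, v x * fderiv ℝ (fun y => fderiv ℝ φ y (EuclideanSpace.single i 1)) x
          (EuclideanSpace.single i 1) = ∫ x in U, k x * φ x := by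
  obtain ⟨-, g, k, hg, hk⟩ := h
  refine ⟨k i i, (hk i i).1, fun φ hφ hc hU => ?_⟩
  have hφ' : ContDiff ℝ ∞ fun y => fderiv ℝ φ y (EuclideanSpace.single i 1) :=
    (hφ.fderiv_right (m := ∞) (by simp)).clm_apply contDiff_const
  rw [(hg i).2 _ hφ' (hc.fderiv_apply (𝕜 := ℝ) _)
    ((tsupport_fderiv_apply_subset ℝ _).trans hU), (hk i i).2 φ hφ hc hU, neg_neg]

/-- Testing the second distributional derivative against `φ`: a lower bound on second differences
of `w` integrated against `φ` bounds it from below. -/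
lemma le_integral_second_fderiv {w : EuclideanSpace ℝ (Fin n) → ℝ} (hw : Integrable w)
    {φ : EuclideanSpace ℝ (Fin n) → ℝ} (hφ : ContDiff ℝ ∞ φ) (hc : HasCompactSupport φ)
    (i : Fin n) {σ : ℝ} (hσ : σ ^ 2 = 1) {κ : ℝ}
    (h : ∀ᶠ s in nhdsWithin (0 : ℝ) (Ioi 0), ∃ F : EuclideanSpace ℝ (Fin n) → ℝ,
      Integrable F ∧ κ * s ^ 2 ≤ ∫ x, F x ∧ ∀ x, F x ≤
        (w (x + s • σ • EuclideanSpace.single i 1) + w (x - s • σ • EuclideanSpace.single i 1)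
          - 2 * w x) * φ x) :
    κ ≤ ∫ x, w x * fderiv ℝ (fun y => fderiv ℝ φ y (EuclideanSpace.single i 1)) x
          (EuclideanSpace.single i 1) := by
  set e : EuclideanSpace ℝ (Fin n) := σ • EuclideanSpace.single i 1 with he
  have hφ' : ContDiff ℝ ∞ fun y => fderiv ℝ φ y e :=
    (hφ.fderiv_right (m := ∞) (by simp)).clm_apply contDiff_const
  -- The target is the second derivative at `s = 0` of `∫ w(x) φ(x + s e)`; a change of variables
  -- turns its second differences into those of `w`. The sign `σ` disappears because it enters
  -- twice.
  have hd1 := hasDerivAt_integral_translate hw hφ hc e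
  have hd2 := hasDerivAt_integral_translate hw hφ' (hc.fderiv_apply (𝕜 := ℝ) e) e 0
  obtain ⟨C0, hC0⟩ := hc.exists_bound_of_continuous hφ.continuous
  have hint : ∀ d : EuclideanSpace ℝ (Fin n), Integrable fun x => w x * φ (x + d) := fun d =>
    (hw.bdd_mul (hφ.continuous.comp (continuous_add_const d)).aestronglyMeasurable
      (Filter.Eventually.of_forall fun x => hC0 (x + d))).congr
      (Filter.Eventually.of_forall fun x => mul_comm _ _)
  have hint' : ∀ d : EuclideanSpace ℝ (Fin n), Integrable fun x => w (x + d) * φ x := fun d => by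
    have := (hint (-d)).comp_add_right d
    simpa using this
  have htr : ∀ d : EuclideanSpace ℝ (Fin n), ∫ x, w x * φ (x + d) = ∫ x, w (x - d) * φ x := by
    intro d
    rw [← integral_add_right_eq_self (μ := volume) (fun x => w (x - d) * φ x) d]
    simp
  have key := le_deriv2_of_second_difference hd1 hd2 (k := κ) (by
    filter_upwards [h] with s ⟨F, hF, hFs, hFle⟩
    rw [htr, htr, neg_smul, zero_smul, add_comm (∫ x, w (x - s • e) * φ x)]
    have i1 := hint' (s • e)
    have i2 := hint' (-(s • e))
    have i3 := (hint' 0).const_mul 2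
    simp only [add_zero, ← sub_eq_add_neg] at i2 i3
    have i12 : Integrable fun x => w (x + s • e) * φ x + w (x - s • e) * φ x := i1.add i2
    simp only [sub_neg_eq_add, add_zero]
    rw [← integral_const_mul, ← integral_add i1 i2, ← integral_sub i12 i3]
    refine hFs.trans (integral_mono hF (i12.sub i3) fun x => (hFle x).trans (le_of_eq ?_))
    simp only [he]
    ring)
  refine key.trans (le_of_eq ?_)
  congr 1
  ext x
  rw [zero_smul, add_zero]
  congr 1
  have e1 : (fun y => fderiv ℝ φ y e)
      = fun y => σ * fderiv ℝ φ y (EuclideanSpace.single i 1) := by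
    ext y; rw [he, map_smul, smul_eq_mul]
  have hdiff : Differentiable ℝ fun y => fderiv ℝ φ y (EuclideanSpace.single i (1 : ℝ)) :=
    ((hφ.fderiv_right (m := ∞) (by simp)).clm_apply contDiff_const).differentiable (by simp)
  rw [e1, fderiv_const_mul (hdiff x), he, map_smul, smul_apply, smul_eq_mul, smul_eq_mul,
    ← mul_assoc, ← sq, hσ, one_mul]

end weak

/-! ### Thin shells inside the cylinder. -/

section tube

variable {n : ℕ} {l i : Fin n} {σ m R : ℝ} {x x₀ : EuclideanSpace ℝ (Fin n)}

lemma primeNorm_add_smul_single_sq (hl : (l : ℕ) + 1 = n) (hi : i ≠ l) (hσ : σ ^ 2 = 1) (s : ℝ)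
    (x : EuclideanSpace ℝ (Fin n)) :
    primeNorm (x + s • σ • EuclideanSpace.single i (1 : ℝ)) ^ 2
      = primeNorm x ^ 2 + 2 * s * (σ * x i) + s ^ 2 := by
  rw [primeNorm_sq hl, primeNorm_sq hl,
    ← Finset.add_sum_erase _ _ (Finset.mem_erase.2 ⟨hi, Finset.mem_univ i⟩),
    ← Finset.add_sum_erase _ (fun j => x j ^ 2) (Finset.mem_erase.2 ⟨hi, Finset.mem_univ i⟩)]
  have : ∑ j ∈ (Finset.univ.erase l).erase i,
      (x + s • σ • EuclideanSpace.single i (1 : ℝ) : EuclideanSpace ℝ (Fin n)) j ^ 2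
      = ∑ j ∈ (Finset.univ.erase l).erase i, x j ^ 2 := by
    refine Finset.sum_congr rfl fun j hj => ?_
    have := Finset.ne_of_mem_erase hj
    simp [this]
  rw [this]
  simp
  linear_combination s ^ 2 * hσ

/-- Growth of `|x'|` along a coordinate line. -/
lemma primeNorm_add_le_primeNorm (hl : (l : ℕ) + 1 = n) (hi : i ≠ l) (hσ : σ ^ 2 = 1) (hm : 0 < m)
    {s : ℝ} (hs : 0 ≤ s) (hx : m ≤ σ * x i) (hxB : x ∈ Metric.ball 0 1)
    (hxB' : x + s • σ • EuclideanSpace.single i (1 : ℝ) ∈ Metric.ball 0 1) :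
    primeNorm x + m * s ≤ primeNorm (x + s • σ • EuclideanSpace.single i (1 : ℝ)) := by
  have h := primeNorm_add_smul_single_sq hl hi hσ s x
  have h1 := primeNorm_lt_one l hl hxB
  have h2 := primeNorm_lt_one l hl hxB'
  have h3 := primeNorm_nonneg x
  have h4 := primeNorm_nonneg (x + s • σ • EuclideanSpace.single i (1 : ℝ))
  set r := primeNorm x
  set r' := primeNorm (x + s • σ • EuclideanSpace.single i (1 : ℝ))
  have h5 : 2 * s * m ≤ 2 * s * (σ * x i) := by gcongr
  have h6 : 2 * (m * s) ≤ (r' - r) * (r' + r) := by nlinarith [sq_nonneg s]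
  by_contra! hlt
  have h7 : 0 ≤ m * s := by positivity
  have h8 : (r' - r) * (r' + r) ≤ (m * s) * (r' + r) := by
    gcongr
    linarith
  rcases h7.eq_or_lt with h0 | h0
  · rw [← h0] at h6 hlt
    nlinarith
  · nlinarith

lemma norm_smul_smul_single (hσ : σ ^ 2 = 1) (s : ℝ) (i : Fin n) :
    ‖s • σ • (EuclideanSpace.single i (1 : ℝ) : EuclideanSpace ℝ (Fin n))‖ = |s| := by
  have hσa : |σ| = 1 := by rw [← sq_eq_sq₀ (abs_nonneg _) zero_le_one, sq_abs, hσ, one_pow]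
  rw [norm_smul, norm_smul, Real.norm_eq_abs, Real.norm_eq_abs, hσa]
  simp

/-- Fubini along the direction `σ e_i`: each line starting in the small ball crosses the cylinder
and, `|x'|` being 1-Lipschitz and increasing along it, spends length at least `η` in the shell. -/
lemma tube_volume (hl : (l : ℕ) + 1 = n) (hi : i ≠ l) (hσ : σ ^ 2 = 1) (hm : 0 < m) (hm1 : m ≤ 1)
    (hR : 0 < R) (hball : Metric.ball x₀ R ⊆ Metric.ball 0 1) (hx₀ : primeNorm x₀ = 1 / 2)
    (hmx : ∀ x ∈ Metric.ball x₀ R, m ≤ σ * x i) {η : ℝ} (hη0 : 0 < η) (hη : η ≤ R / 4) :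
    ENNReal.ofReal η * volume (Metric.ball x₀ (m * R / 8)) ≤ ENNReal.ofReal R *
      volume {x | x ∈ Metric.ball x₀ R ∧ 1 / 2 - η ≤ primeNorm x ∧ primeNorm x ≤ 1 / 2} := by
  set e : EuclideanSpace ℝ (Fin n) := σ • EuclideanSpace.single i (1 : ℝ) with he
  set S := {x | x ∈ Metric.ball x₀ R ∧ 1 / 2 - η ≤ primeNorm x ∧ primeNorm x ≤ 1 / 2} with hS
  have hSm : MeasurableSet S := by
    refine Metric.isOpen_ball.measurableSet.inter (MeasurableSet.inter ?_ ?_)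
    · exact (isClosed_le continuous_const continuous_primeNorm).measurableSet
    · exact (isClosed_le continuous_primeNorm continuous_const).measurableSet
  set a := R / 4 with ha
  -- With `a = R / 4` this is `m a / 2`: the starting radius is within `m a / 2` of `1/2`, while
  -- moving by `±a` changes it by at least `m a`, which forces a crossing.
  set ρ₂ := m * R / 8 with hρ₂
  have hρa : ρ₂ ≤ a / 2 := by rw [hρ₂, ha]; nlinarith
  have hmem : ∀ x ∈ Metric.ball x₀ ρ₂, ∀ s ∈ Icc (-(2 * a)) (2 * a),
      x + s • e ∈ Metric.ball x₀ R := by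
    intro x hx s hs
    rw [mem_ball_iff_norm] at hx ⊢
    have e1 : x + s • e - x₀ = (x - x₀) + s • e := by abel
    rw [e1]
    refine (norm_add_le _ _).trans_lt ?_
    rw [he, norm_smul_smul_single hσ]
    have := abs_le.2 hs
    linarith
  have hline : ∀ x ∈ Metric.ball x₀ ρ₂, ENNReal.ofReal η
      ≤ ∫⁻ s in Icc (-(2 * a)) (2 * a), S.indicator (fun _ => (1 : ℝ≥0∞)) (x + s • e) := by
    intro x hx
    have hstep : ∀ s s' : ℝ, s ∈ Icc (-(2 * a)) (2 * a) → s' ∈ Icc (-(2 * a)) (2 * a) → s ≤ s' →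
        primeNorm (x + s • e) + m * (s' - s) ≤ primeNorm (x + s' • e) := by
      intro s s' hs hs' hss
      have h1 := hmem x hx s hs
      have h2 := hmem x hx s' hs'
      have e1 : x + s' • e = (x + s • e) + (s' - s) • e := by module
      rw [e1] at h2 ⊢
      exact primeNorm_add_le_primeNorm hl hi hσ hm (sub_nonneg.2 hss) (hmx _ h1) (hball h1)
        (hball h2)
    have hx0 := abs_le.1 ((abs_primeNorm_sub_le l hl x x₀).trans (mem_ball_iff_norm.1 hx).le)
    rw [hx₀] at hx0
    have ha0 : 0 < a := by positivity
    have hma : ρ₂ = m * a / 2 := by rw [hρ₂, ha]; ring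
    have hma0 : 0 < m * a := by positivity
    have h1 := hstep 0 a ⟨by linarith, by linarith⟩ ⟨by linarith, by linarith⟩ ha0.le
    have h2 := hstep (-a) 0 ⟨by linarith, by linarith⟩ ⟨by linarith, by linarith⟩ (by linarith)
    rw [zero_smul, add_zero] at h1 h2
    have hcont : ContinuousOn (fun s : ℝ => primeNorm (x + s • e)) (Icc (-a) a) :=
      (continuous_primeNorm.comp (by fun_prop)).continuousOn
    obtain ⟨s₀, hs₀, hs₀r⟩ := intermediate_value_Icc (by linarith : -a ≤ a) hcont
      (show (1 / 2 : ℝ) ∈ _ from ⟨by linarith, by linarith⟩)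
    simp only at hs₀r
    have hs₀I : s₀ ∈ Icc (-(2 * a)) (2 * a) := ⟨by linarith [hs₀.1], by linarith [hs₀.2]⟩
    have hsub : Icc (s₀ - η) s₀ ⊆ Icc (-(2 * a)) (2 * a) := fun s hs =>
      ⟨by linarith [hs.1, hs₀.1], by linarith [hs.2, hs₀.2]⟩
    calc ENNReal.ofReal η = ∫⁻ _s in Icc (s₀ - η) s₀, 1 := by simp
      _ ≤ ∫⁻ s in Icc (s₀ - η) s₀, S.indicator (fun _ => (1 : ℝ≥0∞)) (x + s • e) := by
        refine setLIntegral_mono' measurableSet_Icc fun s hs => ?_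
        have hsS : x + s • e ∈ S := by
          have k1 := hstep s s₀ (hsub hs) hs₀I hs.2
          rw [hs₀r] at k1
          have k2 := abs_primeNorm_sub_le l hl (x + s₀ • e) (x + s • e)
          have e2 : x + s₀ • e - (x + s • e) = (s₀ - s) • e := by module
          rw [e2, he, norm_smul_smul_single hσ, abs_of_nonneg (sub_nonneg.2 hs.2), ← he, hs₀r] at k2
          have k3 : 0 ≤ m * (s₀ - s) := mul_nonneg hm.le (sub_nonneg.2 hs.2)
          exact ⟨hmem x hx s (hsub hs), by linarith [(abs_le.1 k2).2, hs.1], by linarith⟩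
        rw [indicator_of_mem hsS]
      _ ≤ _ := lintegral_mono_set hsub
  have hmeas : Measurable (Function.uncurry fun (x : EuclideanSpace ℝ (Fin n)) (s : ℝ) =>
      S.indicator (fun _ => (1 : ℝ≥0∞)) (x + s • e)) := by
    have hc : Continuous fun p : EuclideanSpace ℝ (Fin n) × ℝ => p.1 + p.2 • e := by fun_prop
    exact (measurable_const.indicator hSm).comp hc.measurable
  calc ENNReal.ofReal η * volume (Metric.ball x₀ ρ₂)
      = ∫⁻ _x in Metric.ball x₀ ρ₂, ENNReal.ofReal η := by simp
    _ ≤ ∫⁻ x in Metric.ball x₀ ρ₂, ∫⁻ s in Icc (-(2 * a)) (2 * a),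
          S.indicator (fun _ => (1 : ℝ≥0∞)) (x + s • e) :=
        setLIntegral_mono' Metric.isOpen_ball.measurableSet hline
    _ = ∫⁻ s in Icc (-(2 * a)) (2 * a), ∫⁻ x in Metric.ball x₀ ρ₂,
          S.indicator (fun _ => (1 : ℝ≥0∞)) (x + s • e) :=
        lintegral_lintegral_swap hmeas.aemeasurable
    _ ≤ ∫⁻ _s in Icc (-(2 * a)) (2 * a), volume S := by
        refine lintegral_mono fun s => (setLIntegral_le_lintegral _ _).trans (le_of_eq ?_)
        rw [lintegral_add_right_eq_self (fun x => S.indicator (fun _ => (1 : ℝ≥0∞)) x),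
          lintegral_indicator_const hSm, one_mul]
    _ = ENNReal.ofReal R * volume S := by
        rw [setLIntegral_const, Real.volume_Icc, mul_comm]
        congr 2
        rw [ha]; ring

end tube

/-! ### Failure of `W^{2,1}` regularity. -/

section notW21

variable {n : ℕ} {l : Fin n}

lemma volume_cylinder (hl : (l : ℕ) + 1 = n) :
    volume {x : EuclideanSpace ℝ (Fin n) | primeNorm x = 1 / 2} = 0 := by
  rw [← frontier_primeNorm_le hl]
  refine Convex.addHaar_frontier _ fun x hx y hy a b ha hb hab => ?_
  refine (primeNorm_add_smul_le l hl x y ha hb).trans ?_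
  have h1 : primeNorm x ≤ 1 / 2 := hx
  have h2 : primeNorm y ≤ 1 / 2 := hy
  calc a * primeNorm x + b * primeNorm y ≤ a * (1 / 2) + b * (1 / 2) := by gcongr
    _ = 1 / 2 := by rw [← add_mul, hab, one_mul]

/-- A smooth cutoff of the `δ`-neighbourhood of the cylinder `|x'| = 1 / 2`. -/
def tubeBump {x₀ : EuclideanSpace ℝ (Fin n)} (β : ContDiffBump x₀) (χ : ContDiffBump (0 : ℝ))
    (δ : ℝ) (x : EuclideanSpace ℝ (Fin n)) : ℝ :=
  β x * χ ((primeNorm x ^ 2 - 1 / 4) / δ)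

section

variable {x₀ : EuclideanSpace ℝ (Fin n)} (β : ContDiffBump x₀) (χ : ContDiffBump (0 : ℝ)) (δ : ℝ)

/-- The cutoff is taken in the polynomial `|x'|²`, so it is smooth on the axis too. -/
lemma contDiff_tubeBump (hl : (l : ℕ) + 1 = n) : ContDiff ℝ ∞ (tubeBump β χ δ) := by
  unfold tubeBump
  simp only [primeNorm_sq hl]
  refine β.contDiff.mul (χ.contDiff.comp ?_)
  refine ContDiff.div_const (ContDiff.sub (ContDiff.sum fun j _ => ContDiff.pow ?_ 2)
    contDiff_const) _
  exact (EuclideanSpace.proj (𝕜 := ℝ) j : EuclideanSpace ℝ (Fin n) →L[ℝ] ℝ).contDiff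

lemma hasCompactSupport_tubeBump : HasCompactSupport (tubeBump β χ δ) :=
  β.hasCompactSupport.mul_right

lemma tsupport_tubeBump_subset : tsupport (tubeBump β χ δ) ⊆ Metric.closedBall x₀ β.rOut := by
  rw [← β.tsupport_eq]
  exact tsupport_mul_subset_left

lemma tubeBump_nonneg (x : EuclideanSpace ℝ (Fin n)) : 0 ≤ tubeBump β χ δ x :=
  mul_nonneg β.nonneg χ.nonneg

lemma tubeBump_le_one (x : EuclideanSpace ℝ (Fin n)) : tubeBump β χ δ x ≤ 1 :=
  mul_le_one₀ β.le_one χ.nonneg χ.le_one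

end

lemma setIntegral_eq_integral_indicator_mul {U B : Set (EuclideanSpace ℝ (Fin n))} (hU : IsOpen U)
    (hUB : U ⊆ B) (v : EuclideanSpace ℝ (Fin n) → ℝ) {ψ : EuclideanSpace ℝ (Fin n) → ℝ}
    (hψ : tsupport ψ ⊆ U) : ∫ x in U, v x * ψ x = ∫ x, B.indicator v x * ψ x := by
  rw [← integral_indicator hU.measurableSet]
  congr 1
  ext x
  by_cases hx : x ∈ U
  · rw [indicator_of_mem hx, indicator_of_mem (hUB hx)]
  · rw [indicator_of_notMem hx, image_eq_zero_of_notMem_tsupport (fun h => hx (hψ h)), mul_zero]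

theorem not_memW21 (hl : (l : ℕ) + 1 = n) {v : EuclideanSpace ℝ (Fin n) → ℝ} {c : ℝ} (hc : 0 < c)
    (hconv : ConvexOn ℝ (Metric.ball 0 1) v) (hint : IntegrableOn v (Metric.ball 0 1))
    (hnn : ∀ x ∈ Metric.ball 0 1, 0 ≤ v x)
    (h0 : ∀ x ∈ Metric.ball 0 1, primeNorm x ≤ 1 / 2 → v x = 0)
    (h1 : ∀ x ∈ Metric.ball 0 1, c * (primeNorm x - 1 / 2) ≤ v x)
    {U : Set (EuclideanSpace ℝ (Fin n))} (hU : IsOpen U) (hUB : U ⊆ Metric.ball 0 1)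
    {x₀ : EuclideanSpace ℝ (Fin n)} (hx₀U : x₀ ∈ U) (hx₀ : primeNorm x₀ = 1 / 2) :
    ¬ MemW21 U v := by
  intro hW
  obtain ⟨i, hi, hxi⟩ := exists_apply_ne_zero hl hx₀
  obtain ⟨σ, hσ, hσx⟩ : ∃ σ : ℝ, σ ^ 2 = 1 ∧ 0 < σ * x₀ i := by
    rcases lt_or_gt_of_ne hxi with h | h
    · exact ⟨-1, by norm_num, by linarith⟩
    · exact ⟨1, by norm_num, by linarith⟩
  have hσa : |σ| = 1 := by rw [← sq_eq_sq₀ (abs_nonneg _) zero_le_one, sq_abs, hσ, one_pow]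
  set m := σ * x₀ i / 2 with hm
  have hm0 : 0 < m := by positivity
  have hm1 : m ≤ 1 := by
    have h2 : σ * x₀ i ≤ |σ * x₀ i| := le_abs_self _
    rw [abs_mul, hσa, one_mul] at h2
    have := abs_apply_lt_one i (hUB hx₀U)
    linarith
  -- The bump lives in radius `2 R` and shifts have length at most `R`, whence `3 R`; since `σ x₀ i
  -- = 2 m`, the bound `R ≤ m` keeps `σ x i ≥ m` on the ball of radius `R`.
  obtain ⟨R, hR0, hRU, hRm⟩ : ∃ R : ℝ, 0 < R ∧ Metric.closedBall x₀ (3 * R) ⊆ U ∧ R ≤ m := by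
    obtain ⟨r, hr, hrU⟩ := Metric.isOpen_iff.1 hU x₀ hx₀U
    refine ⟨min (r / 4) m, by positivity, fun x hx => hrU ?_, min_le_right _ _⟩
    rw [Metric.mem_closedBall] at hx
    rw [Metric.mem_ball]
    have := min_le_left (r / 4) m
    linarith
  have hmx : ∀ x ∈ Metric.ball x₀ R, m ≤ σ * x i := by
    intro x hx
    rw [mem_ball_iff_norm] at hx
    have h2 : |x i - x₀ i| ≤ ‖x - x₀‖ := PiLp.norm_apply_le (x - x₀) i
    have h3 : |σ * x i - σ * x₀ i| < m := by
      rw [← mul_sub, abs_mul, hσa, one_mul]; linarith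
    have := (abs_lt.1 h3).1
    linarith
  have hRB : Metric.ball x₀ R ⊆ Metric.ball 0 1 := fun x hx => hUB (hRU (by
    rw [Metric.mem_ball] at hx; rw [Metric.mem_closedBall]; linarith))
  set e : EuclideanSpace ℝ (Fin n) := σ • EuclideanSpace.single i (1 : ℝ) with he
  set w := (Metric.ball (0 : EuclideanSpace ℝ (Fin n)) 1).indicator v with hw
  have hwint : Integrable w := hint.integrable_indicator Metric.isOpen_ball.measurableSet
  have hwB : ∀ x ∈ Metric.ball (0 : EuclideanSpace ℝ (Fin n)) 1, w x = v x := fun x hx =>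
    indicator_of_mem hx v
  obtain ⟨k, hk, hkφ⟩ := hW.exists_weak_second i
  set β : ContDiffBump x₀ := ⟨R, 2 * R, hR0, by linarith⟩ with hβ
  set χ : ContDiffBump (0 : ℝ) := ⟨1, 2, one_pos, one_lt_two⟩ with hχ
  set V := (volume (Metric.ball x₀ (m * R / 8))).toReal with hV
  have hV0 : 0 < V := ENNReal.toReal_pos (Metric.measure_ball_pos _ _ (by positivity)).ne'
    measure_ball_lt_top.ne
  -- Second difference at least `c (m/2) s` times shell volume at least `(m/2) (V/R) s`, divided by
  -- `s²`; independent of the cutoff width `δ`.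
  set κ := c * (m / 2) * (m / 2 * V / R) with hκ
  have hκ0 : 0 < κ := by positivity
  have hsupp : ∀ δ, tsupport (tubeBump β χ δ) ⊆ U := fun δ =>
    (tsupport_tubeBump_subset β χ δ).trans ((Metric.closedBall_subset_closedBall (by
      simp only [hβ]; linarith)).trans hRU)
  have hlower : ∀ δ : ℝ, 0 < δ → κ ≤ ∫ x in U, k x * tubeBump β χ δ x := by
    intro δ hδ
    have hφ := contDiff_tubeBump β χ δ hl
    have hφc := hasCompactSupport_tubeBump β χ δ
    rw [← hkφ _ hφ hφc (hsupp δ), setIntegral_eq_integral_indicator_mul hU hUB v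
      (((tsupport_fderiv_apply_subset ℝ _).trans (tsupport_fderiv_apply_subset ℝ _)).trans
        (hsupp δ))]
    refine le_integral_second_fderiv hwint hφ hφc i hσ ?_
    have hsmall : 0 < min (R / 4) δ := by positivity
    filter_upwards [Ioo_mem_nhdsGT hsmall] with s hs
    have hs0 : 0 < s := hs.1
    have hsR : s < R / 4 := hs.2.trans_le (min_le_left _ _)
    have hsδ : s < δ := hs.2.trans_le (min_le_right _ _)
    have hη1 : m / 2 * s ≤ s := by nlinarith
    -- On this shell `v = 0`, while the step `s e` raises `|x'|` by at least `m s`, to at least `1/2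
    -- + m s / 2`. Because `s < δ`, the cutoff equals `1` there; elsewhere convexity makes second
    -- differences nonnegative.
    set S := {x | x ∈ Metric.ball x₀ R ∧ 1 / 2 - m / 2 * s ≤ primeNorm x ∧ primeNorm x ≤ 1 / 2}
      with hS
    have hSm : MeasurableSet S := by
      refine Metric.isOpen_ball.measurableSet.inter (MeasurableSet.inter ?_ ?_)
      · exact (isClosed_le continuous_const continuous_primeNorm).measurableSet
      · exact (isClosed_le continuous_primeNorm continuous_const).measurableSet
    have hSfin : volume S ≠ ⊤ :=
      ((measure_mono (fun x hx => hx.1 : S ⊆ Metric.ball x₀ R)).trans_lt measure_ball_lt_top).ne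
    have htube := tube_volume hl hi hσ hm0 hm1 hR0 hRB hx₀ hmx (η := m / 2 * s) (by positivity)
      (by linarith)
    have htube' : m / 2 * s * V ≤ R * volume.real S := by
      have := ENNReal.toReal_mono (ENNReal.mul_ne_top ENNReal.ofReal_ne_top hSfin) htube
      rwa [ENNReal.toReal_mul, ENNReal.toReal_mul, ENNReal.toReal_ofReal (by positivity),
        ENNReal.toReal_ofReal hR0.le] at this
    have hshift : ∀ x ∈ Metric.closedBall x₀ (2 * R), ∀ s' : ℝ, |s'| ≤ R →
        x + s' • e ∈ Metric.ball (0 : EuclideanSpace ℝ (Fin n)) 1 := by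
      intro x hx s' hs'
      refine hUB (hRU ?_)
      rw [mem_closedBall_iff_norm] at hx ⊢
      have e1 : x + s' • e - x₀ = (x - x₀) + s' • e := by abel
      rw [e1]
      refine (norm_add_le _ _).trans ?_
      rw [he, norm_smul_smul_single hσ]
      linarith
    have hsabs : |s| ≤ R := by rw [abs_of_pos hs0]; linarith
    have hsub : ∀ x, x - s • e = x + (-s) • e := fun x => by module
    refine ⟨S.indicator fun _ => c * (m / 2) * s, ?_, ?_, ?_⟩
    · exact (integrable_indicator_iff hSm).2 (integrableOn_const hSfin)
    · rw [integral_indicator_const _ hSm, smul_eq_mul, hκ]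
      have h3 : m / 2 * V / R * s ≤ volume.real S := by
        rw [div_mul_eq_mul_div, div_le_iff₀ hR0]; linarith
      calc c * (m / 2) * (m / 2 * V / R) * s ^ 2
          = c * (m / 2) * s * (m / 2 * V / R * s) := by ring
        _ ≤ c * (m / 2) * s * volume.real S := by gcongr
        _ = _ := by ring
    · intro x
      by_cases hxS : x ∈ S
      · have hx2 : x ∈ Metric.closedBall x₀ (2 * R) := by
          have := hxS.1
          rw [Metric.mem_ball] at this
          rw [Metric.mem_closedBall]; linarith
        have hxB := hRB hxS.1
        have hp := hshift x hx2 s hsabs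
        have hq := hshift x hx2 (-s) (by rwa [abs_neg])
        rw [← hsub] at hq
        have hφ1 : tubeBump β χ δ x = 1 := by
          unfold tubeBump
          rw [β.one_of_mem_closedBall (Metric.ball_subset_closedBall hxS.1),
            χ.one_of_mem_closedBall, one_mul]
          rw [mem_closedBall_zero_iff, Real.norm_eq_abs, abs_div, abs_of_pos hδ, div_le_iff₀ hδ]
          change _ ≤ 1 * δ
          have h3 := hxS.2.1
          have h4 := hxS.2.2
          have h5 := primeNorm_nonneg x
          rw [abs_le]
          constructor <;> nlinarith
        have hgrow := primeNorm_add_le_primeNorm hl hi hσ hm0 hs0.le (hmx x hxS.1) hxB hp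
        rw [← he] at hgrow
        rw [indicator_of_mem hxS, hφ1, mul_one, hwB x hxB, hwB _ hp, hwB _ hq, h0 x hxB hxS.2.2]
        have h3 := h1 _ hp
        have h4 := hnn _ hq
        have h5 : c * (m / 2 * s) ≤ c * (primeNorm (x + s • e) - 1 / 2) := by
          gcongr
          linarith [hxS.2.1]
        linarith
      · rw [indicator_of_notMem hxS]
        by_cases hx0 : β x = 0
        · simp [tubeBump, hx0]
        · refine mul_nonneg ?_ (tubeBump_nonneg β χ δ x)
          have hx2 : x ∈ Metric.closedBall x₀ (2 * R) := by
            have : x ∈ Function.support β := hx0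
            rw [β.support_eq] at this
            exact Metric.ball_subset_closedBall this
          have hxB : x ∈ Metric.ball (0 : EuclideanSpace ℝ (Fin n)) 1 := by
            simpa using hshift x hx2 0 (by simpa using hR0.le)
          have hp := hshift x hx2 s hsabs
          have hq := hshift x hx2 (-s) (by rwa [abs_neg])
          rw [← hsub] at hq
          rw [hwB x hxB, hwB _ hp, hwB _ hq]
          have h3 := hconv.2 hp hq (show (0 : ℝ) ≤ 1 / 2 by norm_num)
            (show (0 : ℝ) ≤ 1 / 2 by norm_num) (by norm_num)
          have e1 : (1 / 2 : ℝ) • (x + s • e) + (1 / 2 : ℝ) • (x - s • e) = x := by module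
          rw [e1] at h3
          simp only [smul_eq_mul] at h3
          linarith
  -- Off the null set `|x'| = 1/2` the cutoffs vanish eventually, so dominated convergence
  -- contradicts the uniform bound `κ`.
  have hlim : Filter.Tendsto (fun j : ℕ => ∫ x in U, k x * tubeBump β χ (1 / ((j : ℝ) + 1)) x)
      Filter.atTop (nhds (∫ x in U, (0 : ℝ))) := by
    refine tendsto_integral_of_dominated_convergence (fun x => ‖k x‖) ?_ hk.norm ?_ ?_
    · exact fun j => hk.aestronglyMeasurable.mul
        (contDiff_tubeBump β χ _ hl).continuous.aestronglyMeasurable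
    · refine fun j => Filter.Eventually.of_forall fun x => ?_
      rw [norm_mul, Real.norm_of_nonneg (tubeBump_nonneg β χ _ x)]
      exact mul_le_of_le_one_right (norm_nonneg _) (tubeBump_le_one β χ _ x)
    · have hae : ∀ᵐ x ∂(volume.restrict U), primeNorm x ≠ 1 / 2 :=
        ae_restrict_of_ae (measure_eq_zero_iff_ae_notMem.1 (volume_cylinder hl))
      filter_upwards [hae] with x hx
      refine tendsto_const_nhds.congr' ?_
      have hG : 0 < |primeNorm x ^ 2 - 1 / 4| := by
        rw [abs_pos]
        intro h
        apply hx
        nlinarith [primeNorm_nonneg x]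
      obtain ⟨N, hN⟩ := exists_nat_ge (2 / |primeNorm x ^ 2 - 1 / 4|)
      filter_upwards [Filter.eventually_ge_atTop N] with j hj
      have hjN : (N : ℝ) ≤ j := by exact_mod_cast hj
      unfold tubeBump
      rw [χ.zero_of_le_dist, mul_zero, mul_zero]
      rw [dist_zero_right, Real.norm_eq_abs, div_div_eq_mul_div, div_one, abs_mul,
        abs_of_pos (by positivity : (0 : ℝ) < (j : ℝ) + 1)]
      change 2 ≤ _
      rw [div_le_iff₀ hG] at hN
      nlinarith
  rw [integral_zero] at hlim
  have := ge_of_tendsto' hlim fun j => hlower (1 / ((j : ℝ) + 1)) (by positivity)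
  linarith

end notW21

end

/-! ### Scaling and conclusion. -/

theorem proposition2 (n : ℕ) (hn : 2 ≤ n) (q : ℝ) (hq : 0 < q) (hqn : q < n) :
    ∃ v : EuclideanSpace ℝ (Fin n) → ℝ,
      IsObstacleSolution q (Metric.ball 0 1) v ∧
      coincidenceSet (Metric.ball 0 1) v = {x | primeNorm x ≤ 1 / 2} ∩ Metric.ball 0 1 ∧
      nonStrictlyConvexPart (Metric.ball 0 1) v =
        {x | primeNorm x = 1 / 2} ∩ Metric.ball 0 1 ∧
      dimH (nonStrictlyConvexPart (Metric.ball 0 1) v) = ((n - 1 : ℕ) : ℝ≥0∞) ∧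
      (∃ L : ℝ≥0, LipschitzOnWith L v (Metric.ball 0 1)) ∧
      (∀ x ∈ nonStrictlyConvexPart (Metric.ball 0 1) v, ¬ DifferentiableAt ℝ v x) ∧
      ∀ U : Set (EuclideanSpace ℝ (Fin n)), IsOpen U → U ⊆ Metric.ball 0 1 →
        (U ∩ nonStrictlyConvexPart (Metric.ball 0 1) v).Nonempty → ¬ MemW21 U v := by
  obtain ⟨ε, hε, ρ, ρu, ρt, ρuu, ρut, ρtt, H⟩ := exists_isHodographProfile n hq
  set l : Fin n := ⟨n - 1, by omega⟩ with hldef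
  have hl : (l : ℕ) + 1 = n := by simp only [hldef]; omega
  -- The solution of `c^(n-q) ε = 1`, which exists because `n - q ≠ 0`; it scales `ε` out of the
  -- equation.
  set c : ℝ := ε ^ (-(1 / ((n : ℝ) - q))) with hcdef
  have hc : 0 < c := Real.rpow_pos_of_pos hε _
  have hcε : c ^ n * ε = c ^ q := by
    have hnq : (n : ℝ) - q ≠ 0 := by linarith
    have h1 : c ^ n = c ^ q * c ^ ((n : ℝ) - q) := by
      rw [← Real.rpow_natCast, ← Real.rpow_add hc]; congr 1; ring
    have h2 : c ^ ((n : ℝ) - q) = ε⁻¹ := by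
      rw [hcdef, ← Real.rpow_mul hε.le, ← Real.rpow_neg_one]
      congr 1
      field_simp
    rw [h1, h2, mul_assoc, inv_mul_cancel₀ hε.ne', mul_one]
  set v : EuclideanSpace ℝ (Fin n) → ℝ := fun x => c * hodographSol ρ l x with hv
  have hconv : ConvexOn ℝ (Metric.ball 0 1) v := (H.convexOn_sol hε hl).smul hc.le
  have hnn : ∀ x ∈ Metric.ball 0 1, 0 ≤ v x := fun x hx => mul_nonneg hc.le (H.sol_nonneg hl hx)
  have hzero : ∀ x ∈ Metric.ball 0 1, (v x = 0 ↔ primeNorm x ≤ 1 / 2) := fun x hx => by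
    rw [← H.sol_eq_zero_iff hl hx, hv]
    simp [hc.ne']
  have hlow : ∀ x ∈ Metric.ball 0 1, c * (primeNorm x - 1 / 2) ≤ v x := fun x hx =>
    mul_le_mul_of_nonneg_left (H.sub_le_sol hl hx) hc.le
  have hK : coincidenceSet (Metric.ball 0 1) v
      = {x | primeNorm x ≤ 1 / 2} ∩ Metric.ball 0 1 := by
    ext x
    constructor
    · exact fun hx => ⟨(hzero x hx.1).1 hx.2, hx.1⟩
    · exact fun hx => ⟨hx.2, (hzero x hx.2).2 hx.1⟩
  have hnsc := nonStrictlyConvexPart_eq hl hK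
  have hLip : LipschitzOnWith (Real.toNNReal (c * 4)) v (Metric.ball 0 1) := by
    refine LipschitzOnWith.of_dist_le_mul fun x hx y hy => ?_
    rw [Real.coe_toNNReal _ (by positivity), Real.dist_eq, dist_eq_norm, hv]
    simp only
    rw [← mul_sub, abs_mul, abs_of_pos hc, mul_assoc]
    gcongr
    exact H.abs_sol_sub_le hl hx hy
  have hint : IntegrableOn v (Metric.ball 0 1) := by
    have hconst : IntegrableOn (fun _ : EuclideanSpace ℝ (Fin n) => c) (Metric.ball 0 1) :=
      integrableOn_const measure_ball_lt_top.ne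
    refine hconst.mono'
      (hLip.continuousOn.aestronglyMeasurable Metric.isOpen_ball.measurableSet) ?_
    refine (ae_restrict_iff' Metric.isOpen_ball.measurableSet).2
      (Filter.Eventually.of_forall fun x hx => ?_)
    rw [Real.norm_of_nonneg (hnn x hx)]
    exact mul_le_of_le_one_right hc.le
      (H.inv_lt_one (primeNorm_lt_one l hl hx) (abs_apply_lt_one l hx)).le
  refine ⟨v, ⟨hconv, hnn, fun A hA hAB => H.mongeAmpere_eq hε hn hl hc hcε hA hAB⟩, hK, hnsc, ?_,
    ⟨_, hLip⟩, ?_, ?_⟩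
  · rw [hnsc]
    exact dimH_cylinder hn hl
  · rw [hnsc]
    exact fun x hx => not_differentiableAt_of_le hl hc (fun y hy => (hzero y hy).2) hlow hx.2 hx.1
  · rw [hnsc]
    rintro U hU hUB ⟨x₀, hx₀U, hx₀, -⟩
    exact not_memW21 hl hc hconv hint hnn (fun y hy => (hzero y hy).2) hlow hU hUB hx₀U hx₀
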